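/- Let $0\le\gamma\le\alpha\le1$. **Trees.** An $[n]$-tree is a rooted tree (root of degree one) with leaves labelled $1,\dots,n$ in which every other vertex (branch point) has at least two children; edges ending in a leaf are external, the others internal (the only edge of the $[1]$-tree counts as external). A semi-planar $[n]$-tree is an $[n]$-tree in which the subtrees of every branch point carry a left-to-right order such that the two subtrees with the smallest least labels stand leftmost; the order of these two is disregarded. The projection $\hat\pi$ forgets the orders. **Growth processes.** The semi-planar $(\alpha,\gamma)$-growth process $(\hat T_n)_{n\ge1}$ is the Markov chain that starts from the $[1]$-tree and obtains $\hat T_{n+1}$ from $\hat T_n$ by inserting leaf $n+1$, with probability $w/(n-\alpha)$ for an insertion of weight $w$: weight $1-\alpha$ for each external edge, $\gamma$ for each internal edge, and at a branch point with $c$ children weight $\alpha$ for each of the $c-2$ gaps to the immediate left of a subtree that is not one of the two leftmost, and weight $\alpha-\gamma$ for the place to the right of all its subtrees. The (non-planar) $(\alpha,\gamma)$-growth process $(T_n)_{n\ge1}$ is defined in the same way on $[n]$-trees, with a single insertion of weight $(c-1)\alpha-\gamma$ into a branch point with $c$ children. In both cases the step from $n=1$ to $n=2$ is deterministic. **Down-step.**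 Let $n\ge2$, let $\hat t$ be a semi-planar $[n]$-tree, $i\in[n]$, and let $v$ be the parent of leaf $i$. Let $a$ be the least leaf label in the subtrees of $v$ other than leaf $i$. If $v$ has two children, let $b$ be the least label of the leaves that are descendants of the parent of $v$ but not of $v$ ($b=0$ if the parent of $v$ is the root). If $v$ has more than two children, let $b$ be the least label in the first subtree of $v$ not containing $a$ to the right of leaf $i$, if $i$ is one of the two smallest of the least labels of the subtrees of $v$, and to the left of leaf $i$ otherwise. Put $\tilde\imath=\max\{i,a,b\}$. The down-step from $i$ swaps the labels $i$ and $\tilde\imath$ (all positions being kept), deletes leaf $\tilde\imath$ (contracting its parent if only one other child remains), and relabels the remaining leaves increasingly by $1,\dots,n-1$; this yields a semi-planar $[n-1]$-tree. **Chain.** For $n\ge2$, a transition of the semi-planar $(\alpha,\gamma)$-chain $(\hat T_n(m))_{m\ge0}$ on semi-planar $[n]$-trees consists of choosing $i\in[n]$ uniformly, performing the down-step from $i$, and inserting leaf $n$ by the semi-planar $(\alpha,\gamma)$-growth rule. **Theorem.** 1. For every $n\ge2$ and every initial distribution, $\hat T_n(m)$ converges in distribution to $\hat T_n$ as $m\to\infty$.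 2. For every $n\ge1$, $\hat\pi(\hat T_n)$ and $T_n$ have the same distribution. 3. For every $n\ge2$, every $i\in[n]$ and every $j$ such that the event $E_{i,j}$ that $\tilde\imath=j$ in $\hat T_n$ has positive probability: conditional on $E_{i,j}$, the result of the down-step from $i$ applied to $\hat T_n$ has the distribution of $\hat T_{n-1}$. -/

import Mathlib

open MeasureTheory ProbabilityTheory Filter
open scoped ENNReal

noncomputable section

/-! ### Planar trees -/

/-- A planar (ordered) rooted tree with leaves labelled by natural numbers: `node cs` is a branch
point whose subtrees, from left to right, are `cs`.  The extra root vertex of degree one below the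
first vertex is implicit, so that a subtree stands both for its top vertex and for the edge
leading down from that vertex to its parent. -/
inductive PlanarTree : Type
  | leaf (i : ℕ) : PlanarTree
  | node (cs : List PlanarTree) : PlanarTree

namespace PlanarTree

mutual
/-- The list of leaf labels, from left to right. -/
def leaves : PlanarTree → List ℕ
  | leaf i => [i]
  | node cs => forestLeaves cs
/-- The list of leaf labels of a list of trees. -/
def forestLeaves : List PlanarTree → List ℕ
  | [] => []
  | c :: cs => leaves c ++ forestLeaves cs
end

/-- The least leaf label in a list of trees (`0` if there is none). -/
def forestMin (cs : List PlanarTree) : ℕ := sInf {i | i ∈ forestLeaves cs}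

/-- The least leaf label of a tree. -/
def minLabel (t : PlanarTree) : ℕ := sInf {i | i ∈ leaves t}

mutual
/-- Every branch point has at least two children. -/
def Branching : PlanarTree → Prop
  | leaf _ => True
  | node cs => 2 ≤ cs.length ∧ ForestBranching cs
/-- `Branching` for every tree of a list. -/
def ForestBranching : List PlanarTree → Prop
  | [] => True
  | c :: cs => Branching c ∧ ForestBranching cs
end

/-- In a list of subtrees, the first one has the least, and the second one the second least,
smallest leaf label. -/
def LeastTwoFirst : List PlanarTree → Prop
  | a :: b :: cs => minLabel a < minLabel b ∧ ∀ c ∈ cs, minLabel b < minLabel c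
  | _ => False

mutual
/-- At every branch point there are at least two subtrees, and the two with the smallest leaf
labels stand leftmost, in increasing order of least label. -/
def SemiPlanar : PlanarTree → Prop
  | leaf _ => True
  | node cs => LeastTwoFirst cs ∧ ForestSemiPlanar cs
/-- `SemiPlanar` for every tree of a list. -/
def ForestSemiPlanar : List PlanarTree → Prop
  | [] => True
  | c :: cs => SemiPlanar c ∧ ForestSemiPlanar cs
end

/-! ### Insertion of a leaf -/

/-- The weights and results of inserting leaf `j` into a branch point with subtrees `cs`, where
`c = cs.length`: in location `l = k + 1 ∈ {1, …, c - 1}` the new leaf has the two leftmost subtrees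
and exactly `l - 1 = k` further subtrees to its left; the weight is `α` for `l ≤ c - 2` and
`α - γ` for `l = c - 1`. -/
def branchInsertions (α γ : ℝ) (j : ℕ) (cs : List PlanarTree) : List (ℝ × PlanarTree) :=
  (List.range (cs.length - 1)).map fun k =>
    (if k + 1 = cs.length - 1 then α - γ else α, node (cs.insertIdx (k + 2) (leaf j)))

mutual
/-- All ways of inserting leaf `j` into a semi-planar tree: the list of the pairs (weight,
resulting tree), one for every edge and for every branch point together with an admissible
location.  The weight of the edge below a leaf is `1 - α`, that of the edge below a branch point
is `γ`. -/
def insertions (α γ : ℝ) (j : ℕ) : PlanarTree → List (ℝ × PlanarTree)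
  | leaf i => [(1 - α, node [leaf i, leaf j])]
  | node cs => (γ, node [node cs, leaf j]) :: branchInsertions α γ j cs ++
      (forestInsertions α γ j cs).map fun p => (p.1, node p.2)
/-- All ways of inserting leaf `j` into one of the trees of a list. -/
def forestInsertions (α γ : ℝ) (j : ℕ) : List PlanarTree → List (ℝ × List PlanarTree)
  | [] => []
  | c :: cs => (insertions α γ j c).map (fun p => (p.1, p.2 :: cs)) ++
      (forestInsertions α γ j cs).map fun p => (p.1, c :: p.2)
end

/-! ### Local search, swapping, deleting and relabelling -/

mutual
/-- The spinal decomposition from leaf `i`: for the branch points on the ancestral line from leaf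
`i`, starting with its parent, the subtrees of the spinal bush to the left and to the right of the
ancestral line, each in their left-to-right order (`none` if `i` is not a leaf label). -/
def spine (i : ℕ) : PlanarTree → Option (List (List PlanarTree × List PlanarTree))
  | leaf k => if k = i then some [] else none
  | node cs => forestSpine i [] cs
/-- Auxiliary: the spinal decomposition of a branch point with subtrees `left ++ cs`, when leaf `i`
is looked for in `cs`. -/
def forestSpine (i : ℕ) (left : List PlanarTree) :
    List PlanarTree → Option (List (List PlanarTree × List PlanarTree))
  | [] => none
  | c :: cs =>
    match spine i c with
    | some s => some (s ++ [(left, cs)])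
    | none => forestSpine i (left ++ [c]) cs
end

/-- The least leaf label in the first one of a list of spinal bushes (`0` if the list is empty).
Applied to the full spinal decomposition from leaf `i`, this is `a`. -/
def firstMin : List (List PlanarTree × List PlanarTree) → ℕ
  | [] => 0
  | p :: _ => forestMin (p.1 ++ p.2)

open Classical in
/-- `b`: if the parent of leaf `i` has two children, the least leaf label in the second spinal
bush (`0` if there is none).  Otherwise the least leaf label in the first subtree not containing
`a` to the right of leaf `i`, if the rank of `i` among the least labels of the subtrees of the
parent is at most two, and to the left of leaf `i`, if the rank is larger. -/
def secondMin (i : ℕ) : List (List PlanarTree × List PlanarTree) → ℕ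
  | [] => 0
  | p :: s =>
    let a := forestMin (p.1 ++ p.2)
    if (p.1 ++ p.2).length + 1 = 2 then firstMin s
    else if ((p.1 ++ p.2).filter fun c => minLabel c < i).length + 1 ≤ 2 then
      match p.2.find? fun c => a ∉ leaves c with
      | some c => minLabel c
      | none => 0
    else
      match p.1.reverse.find? fun c => a ∉ leaves c with
      | some c => minLabel c
      | none => 0

/-- The label `max {i, a, b}` found by the local search from leaf `i`. -/
def search (t : PlanarTree) (i : ℕ) : ℕ :=
  match spine i t with
  | none => i
  | some s => max i (max (firstMin s) (secondMin i s))

mutual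
/-- Change the leaf labels by `f`, all positions being kept. -/
def relabel (f : ℕ → ℕ) : PlanarTree → PlanarTree
  | leaf i => leaf (f i)
  | node cs => node (forestRelabel f cs)
/-- Change the leaf labels in a list of trees. -/
def forestRelabel (f : ℕ → ℕ) : List PlanarTree → List PlanarTree
  | [] => []
  | c :: cs => relabel f c :: forestRelabel f cs
end

/-- Swapping the labels `i` and `j`. -/
def swapLabels (i j : ℕ) (t : PlanarTree) : PlanarTree := relabel (Equiv.swap i j) t

/-- The tree with subtrees `cs` at its first vertex: this vertex is contracted away if it has only
one child, and nothing is left if it has none. -/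
def ofChildren : List PlanarTree → Option PlanarTree
  | [] => none
  | [c] => some c
  | c :: d :: cs => some (node (c :: d :: cs))

mutual
/-- Deletion of leaf `j`, its parent being contracted away if it had only two children (`none` if
no leaf is left). -/
def delete (j : ℕ) : PlanarTree → Option PlanarTree
  | leaf i => if i = j then none else some (leaf i)
  | node cs => ofChildren (forestDelete j cs)
/-- Deletion of leaf `j` in a list of trees. -/
def forestDelete (j : ℕ) : List PlanarTree → List PlanarTree
  | [] => []
  | c :: cs =>
    match delete j c with
    | none => forestDelete j cs
    | some d => d :: forestDelete j cs
end

/-- Move the tree with the least label to the front of the list, the order of the other ones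
being kept. -/
def leastFirst : List PlanarTree → List PlanarTree
  | [] => []
  | c :: cs =>
    match leastFirst cs with
    | [] => [c]
    | d :: ds => if minLabel c < minLabel d then c :: cs else d :: c :: ds

/-- Move the trees with the least and the second least label to the first two places of the list,
the order of the other ones being kept. -/
def leastTwoFirst (cs : List PlanarTree) : List PlanarTree :=
  match leastFirst cs with
  | [] => []
  | c :: ds => c :: leastFirst ds

mutual
/-- The canonical representative of a planar tree in which, at every branch point, the order of the
two subtrees with the smallest labels is forgotten.  On a planar tree in which these two subtrees
stand leftmost at every branch point, it only sorts these two. -/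
def canon : PlanarTree → PlanarTree
  | leaf i => leaf i
  | node cs => node (leastTwoFirst (forestCanon cs))
/-- `canon` for every tree of a list. -/
def forestCanon : List PlanarTree → List PlanarTree
  | [] => []
  | c :: cs => canon c :: forestCanon cs
end

/-- Swap the labels `i` and `j`, delete leaf `j`, relabel the leaves above `j` increasingly, and
forget the order of the two subtrees with the smallest labels at every branch point.  (The default
value would be used only if `t` had no leaf other than `j`.) -/
def swapDelete (t : PlanarTree) (i j : ℕ) : PlanarTree :=
  canon (relabel (fun k => if j < k then k - 1 else k) (((swapLabels i j t).delete j).getD (leaf 1)))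

mutual
/-- The collection of the leaf sets of all subtrees: the tree shape. -/
def clusters : PlanarTree → Finset (Finset ℕ)
  | leaf i => {{i}}
  | node cs => insert (forestLeaves cs).toFinset (forestClusters cs)
/-- The leaf sets of all subtrees of the trees of a list. -/
def forestClusters : List PlanarTree → Finset (Finset ℕ)
  | [] => ∅
  | c :: cs => clusters c ∪ forestClusters cs
end

end PlanarTree

namespace PlanarTree

@[simp] lemma mem_forestLeaves {i : ℕ} {cs : List PlanarTree} :
    i ∈ forestLeaves cs ↔ ∃ c ∈ cs, i ∈ leaves c := by
  induction cs with
  | nil => simp [forestLeaves]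
  | cons c cs ih => simp [forestLeaves, ih]

lemma forestLeaves_append (cs ds : List PlanarTree) :
    forestLeaves (cs ++ ds) = forestLeaves cs ++ forestLeaves ds := by
  induction cs with
  | nil => simp [forestLeaves]
  | cons c cs ih => simp [forestLeaves, ih]

lemma forestLeaves_perm {cs ds : List PlanarTree} (h : cs.Perm ds) :
    (forestLeaves cs).Perm (forestLeaves ds) := by
  induction h with
  | nil => exact List.Perm.refl _
  | cons c _ ih => exact ih.append_left _
  | swap c d l =>
    simp only [forestLeaves, ← List.append_assoc]
    exact List.perm_append_comm.append_right _
  | trans _ _ ih ih' => exact ih.trans ih'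

lemma forestBranching_iff {cs : List PlanarTree} :
    ForestBranching cs ↔ ∀ c ∈ cs, Branching c := by
  induction cs with
  | nil => simp [ForestBranching]
  | cons c cs ih => simp [ForestBranching, ih]

lemma forestSemiPlanar_iff {cs : List PlanarTree} :
    ForestSemiPlanar cs ↔ ∀ c ∈ cs, SemiPlanar c := by
  induction cs with
  | nil => simp [ForestSemiPlanar]
  | cons c cs ih => simp [ForestSemiPlanar, ih]

lemma LeastTwoFirst.two_le {cs : List PlanarTree} (h : LeastTwoFirst cs) : 2 ≤ cs.length := by
  match cs, h with
  | [], h => exact h.elim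
  | [_], h => exact h.elim
  | _ :: _ :: _, _ => simp

mutual
lemma SemiPlanar.branching : ∀ {t : PlanarTree}, SemiPlanar t → Branching t
  | leaf _, _ => trivial
  | node _, h => ⟨h.1.two_le, ForestSemiPlanar.branching h.2⟩
lemma ForestSemiPlanar.branching : ∀ {cs : List PlanarTree}, ForestSemiPlanar cs → ForestBranching cs
  | [], _ => trivial
  | _ :: _, h => ⟨SemiPlanar.branching h.1, ForestSemiPlanar.branching h.2⟩
end

mutual
lemma Branching.leaves_ne_nil : ∀ {t : PlanarTree}, Branching t → leaves t ≠ []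
  | leaf _, _ => by simp [leaves]
  | node cs, h => by
    rw [leaves]
    exact ForestBranching.leaves_ne_nil h.2 (by have := h.1; rintro rfl; simp at this)
lemma ForestBranching.leaves_ne_nil : ∀ {cs : List PlanarTree}, ForestBranching cs → cs ≠ [] →
    forestLeaves cs ≠ []
  | [], _, h => absurd rfl h
  | c :: cs, h, _ => by
    have := Branching.leaves_ne_nil h.1
    simp [forestLeaves, this]
end

lemma minLabel_mem {t : PlanarTree} (h : Branching t) : minLabel t ∈ leaves t :=
  Nat.sInf_mem (s := {i | i ∈ leaves t}) (List.exists_mem_of_ne_nil _ h.leaves_ne_nil)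

lemma minLabel_le {t : PlanarTree} {i : ℕ} (h : i ∈ leaves t) : minLabel t ≤ i :=
  Nat.sInf_le h

lemma minLabel_congr {s t : PlanarTree} (h : ∀ i, i ∈ leaves s ↔ i ∈ leaves t) :
    minLabel s = minLabel t := by
  unfold minLabel
  congr 1
  ext i
  exact h i

lemma minLabel_insert {s t : PlanarTree} {j : ℕ} (ht : Branching t) (hj : ∀ i ∈ leaves t, i < j)
    (h : (leaves s).Perm (j :: leaves t)) : minLabel s = minLabel t := by
  have hm : ∀ i, i ∈ leaves s ↔ i = j ∨ i ∈ leaves t := fun i => by simp [h.mem_iff]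
  have h1 := minLabel_mem ht
  refine le_antisymm (minLabel_le ((hm _).2 (Or.inr h1))) ?_
  have h2 : minLabel s ∈ leaves s :=
    Nat.sInf_mem (s := {i | i ∈ leaves s}) ⟨j, (hm j).2 (Or.inl rfl)⟩
  rcases (hm _).1 h2 with h3 | h3
  · rw [h3]; exact (hj _ h1).le
  · exact minLabel_le h3

lemma leastTwoFirst_map {cs ds : List PlanarTree} (h : ds.map minLabel = cs.map minLabel)
    (hc : LeastTwoFirst cs) : LeastTwoFirst ds := by
  match cs, ds, h, hc with
  | [], _, _, hc => exact hc.elim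
  | [_], _, _, hc => exact hc.elim
  | _ :: _ :: _, [], h, _ => simp at h
  | _ :: _ :: _, [_], h, _ => simp at h
  | a :: b :: cs, a' :: b' :: ds, h, hc =>
    simp only [List.map_cons, List.cons.injEq] at h
    obtain ⟨h1, h2, h3⟩ := h
    refine ⟨by rw [h1, h2]; exact hc.1, fun c hcm => ?_⟩
    have : minLabel c ∈ cs.map minLabel := h3 ▸ List.mem_map_of_mem hcm
    obtain ⟨d, hd, hd'⟩ := List.mem_map.1 this
    rw [h2, ← hd']
    exact hc.2 d hd

lemma branchInsertions_spec {α γ : ℝ} {j : ℕ} {cs : List PlanarTree} (h : SemiPlanar (node cs))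
    (hj : ∀ i ∈ forestLeaves cs, i < j) {p : ℝ × PlanarTree}
    (hp : p ∈ branchInsertions α γ j cs) :
    SemiPlanar p.2 ∧ (leaves p.2).Perm (j :: forestLeaves cs) := by
  obtain ⟨k, hk, rfl⟩ := List.mem_map.1 hp
  have hk' := List.mem_range.1 hk
  obtain ⟨h1, h2⟩ := h
  have hperm : (cs.insertIdx (k + 2) (leaf j)).Perm (leaf j :: cs) :=
    List.perm_insertIdx _ _ (by omega)
  have hs : ForestSemiPlanar (cs.insertIdx (k + 2) (leaf j)) := by
    rw [forestSemiPlanar_iff] at h2 ⊢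
    intro c hc
    rcases List.mem_cons.1 (hperm.mem_iff.1 hc) with rfl | hc
    · trivial
    · exact h2 c hc
  refine ⟨⟨?_, hs⟩, ?_⟩
  · match cs, h1 with
    | a :: b :: cs, h1 =>
      simp only [List.insertIdx_succ_cons]
      refine ⟨h1.1, fun c hc => ?_⟩
      rcases List.eq_or_mem_of_mem_insertIdx hc with rfl | hc
      · have hb : Branching b := (SemiPlanar.branching h2.2.1)
        have : minLabel (leaf j) = j := by simp [minLabel, leaves]
        rw [this]
        exact hj _ (mem_forestLeaves.2 ⟨b, by simp, minLabel_mem hb⟩)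
      · exact h1.2 c hc
  · simpa [leaves, forestLeaves] using forestLeaves_perm hperm

mutual
lemma insertions_spec {α γ : ℝ} {j : ℕ} : ∀ {t : PlanarTree}, SemiPlanar t →
    (∀ i ∈ leaves t, i < j) → ∀ p ∈ insertions α γ j t,
      SemiPlanar p.2 ∧ (leaves p.2).Perm (j :: leaves t)
  | leaf i, _, hj, p, hp => by
    have : i < j := hj i (by simp [leaves])
    simp only [insertions, List.mem_singleton] at hp
    subst hp
    refine ⟨⟨⟨by simpa [minLabel, leaves] using this, by simp⟩, trivial, trivial, trivial⟩, ?_⟩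
    simp only [leaves, forestLeaves, List.singleton_append]
    exact List.Perm.swap _ _ _
  | node cs, h, hj, p, hp => by
    simp only [insertions, List.cons_append, List.mem_cons, List.mem_append, List.mem_map] at hp
    rcases hp with rfl | hp | ⟨q, hq, rfl⟩
    · have hb := minLabel_mem (SemiPlanar.branching h)
      refine ⟨⟨⟨?_, by simp⟩, h, trivial, trivial⟩, ?_⟩
      · have : minLabel (leaf j) = j := by simp [minLabel, leaves]
        rw [this]
        exact hj _ hb
      · simp [leaves, forestLeaves]
    · exact branchInsertions_spec h hj hp
    · obtain ⟨h1, h2, h3⟩ := forestInsertions_spec h.2 hj q hq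
      exact ⟨⟨leastTwoFirst_map h2 h.1, h1⟩, h3⟩
lemma forestInsertions_spec {α γ : ℝ} {j : ℕ} : ∀ {cs : List PlanarTree}, ForestSemiPlanar cs →
    (∀ i ∈ forestLeaves cs, i < j) → ∀ p ∈ forestInsertions α γ j cs,
      ForestSemiPlanar p.2 ∧ p.2.map minLabel = cs.map minLabel ∧
        (forestLeaves p.2).Perm (j :: forestLeaves cs)
  | [], _, _, p, hp => by simp [forestInsertions] at hp
  | c :: cs, h, hj, p, hp => by
    have hc : ∀ i ∈ leaves c, i < j := fun i hi => hj i (by simp [forestLeaves, hi])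
    have hcs : ∀ i ∈ forestLeaves cs, i < j := fun i hi =>
      hj i (by rw [forestLeaves]; exact List.mem_append_right _ hi)
    simp only [forestInsertions, List.mem_append, List.mem_map] at hp
    rcases hp with ⟨q, hq, rfl⟩ | ⟨q, hq, rfl⟩
    · obtain ⟨h1, h2⟩ := insertions_spec h.1 hc q hq
      refine ⟨⟨h1, h.2⟩, ?_, ?_⟩
      · simp [minLabel_insert (SemiPlanar.branching h.1) hc h2]
      · simpa [forestLeaves] using h2.append_right (forestLeaves cs)
    · obtain ⟨h1, h2, h3⟩ := forestInsertions_spec h.2 hcs q hq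
      refine ⟨⟨h.1, h1⟩, by simp [h2], ?_⟩
      simpa [forestLeaves] using (h3.append_left (leaves c)).trans List.perm_middle
end

lemma branchInsertions_sum (α γ : ℝ) (j : ℕ) {cs : List PlanarTree} (h : 2 ≤ cs.length) :
    ((branchInsertions α γ j cs).map Prod.fst).sum = ((cs.length : ℝ) - 1) * α - γ := by
  obtain ⟨m, hm⟩ : ∃ m, cs.length = m + 2 := ⟨cs.length - 2, by omega⟩
  have h1 : ∀ k ∈ List.range m, (if k + 1 = m + 1 then α - γ else α) = α := fun k hk => by
    rw [if_neg]; have := List.mem_range.1 hk; omega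
  simp only [branchInsertions, List.map_map, Function.comp_def, hm]
  rw [show m + 2 - 1 = m + 1 from rfl, List.range_succ, List.map_append, List.sum_append,
    List.map_congr_left h1]
  simp
  ring

mutual
/-- The total weight of all insertions into a tree with `n` leaves is `n - α`. -/
lemma insertions_sum (α γ : ℝ) (j : ℕ) : ∀ {t : PlanarTree}, Branching t →
    ((insertions α γ j t).map Prod.fst).sum = (leaves t).length - α
  | leaf _, _ => by simp [insertions, leaves]
  | node cs, h => by
    have := forestInsertions_sum α γ j h.2
    have h2 := branchInsertions_sum α γ j h.1
    simp only [insertions, leaves, List.map_append, List.map_cons, List.sum_append, List.sum_cons,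
      List.map_map, Function.comp_def] at *
    rw [this, h2]
    ring
lemma forestInsertions_sum (α γ : ℝ) (j : ℕ) : ∀ {cs : List PlanarTree}, ForestBranching cs →
    ((forestInsertions α γ j cs).map Prod.fst).sum = (forestLeaves cs).length - cs.length * α
  | [], _ => by simp [forestInsertions, forestLeaves]
  | c :: cs, h => by
    have := forestInsertions_sum α γ j h.2
    have h2 := insertions_sum α γ j h.1
    simp only [forestInsertions, forestLeaves, List.map_append, List.sum_append,
      List.map_map, Function.comp_def, List.length_append, List.length_cons] at *
    rw [this, h2]
    push_cast
    ring
end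

mutual
lemma insertions_nonneg {α γ : ℝ} (h : 0 ≤ γ ∧ γ ≤ α ∧ α ≤ 1) (j : ℕ) :
    ∀ (t : PlanarTree), ∀ p ∈ insertions α γ j t, 0 ≤ p.1
  | leaf _, p, hp => by
    simp only [insertions, List.mem_singleton] at hp
    subst hp
    simpa using h.2.2
  | node cs, p, hp => by
    simp only [insertions, List.cons_append, List.mem_cons, List.mem_append, List.mem_map] at hp
    rcases hp with rfl | hp | ⟨q, hq, rfl⟩
    · exact h.1
    · obtain ⟨k, -, rfl⟩ := List.mem_map.1 hp
      dsimp only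
      split_ifs
      · linarith
      · linarith
    · exact forestInsertions_nonneg h j cs q hq
lemma forestInsertions_nonneg {α γ : ℝ} (h : 0 ≤ γ ∧ γ ≤ α ∧ α ≤ 1) (j : ℕ) :
    ∀ (cs : List PlanarTree), ∀ p ∈ forestInsertions α γ j cs, 0 ≤ p.1
  | [], p, hp => by simp [forestInsertions] at hp
  | c :: cs, p, hp => by
    simp only [forestInsertions, List.mem_append, List.mem_map] at hp
    rcases hp with ⟨q, hq, rfl⟩ | ⟨q, hq, rfl⟩
    · exact insertions_nonneg h j c q hq
    · exact forestInsertions_nonneg h j cs q hq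
end

end PlanarTree

namespace PlanarTree

mutual
lemma leaves_relabel (f : ℕ → ℕ) : ∀ t : PlanarTree, leaves (relabel f t) = (leaves t).map f
  | leaf _ => by simp [relabel, leaves]
  | node cs => by simp [relabel, leaves, leaves_forestRelabel f cs]
lemma leaves_forestRelabel (f : ℕ → ℕ) : ∀ cs : List PlanarTree,
    forestLeaves (forestRelabel f cs) = (forestLeaves cs).map f
  | [] => by simp [forestRelabel, forestLeaves]
  | c :: cs => by
    simp [forestRelabel, forestLeaves, leaves_relabel f c, leaves_forestRelabel f cs]
end

lemma length_forestRelabel (f : ℕ → ℕ) (cs : List PlanarTree) :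
    (forestRelabel f cs).length = cs.length := by
  induction cs with
  | nil => rfl
  | cons c cs ih => simp [forestRelabel, ih]

mutual
lemma Branching.relabel (f : ℕ → ℕ) : ∀ {t : PlanarTree}, Branching t → Branching (relabel f t)
  | leaf _, _ => trivial
  | node cs, h => ⟨(length_forestRelabel f cs).symm ▸ h.1, ForestBranching.relabel f h.2⟩
lemma ForestBranching.relabel (f : ℕ → ℕ) : ∀ {cs : List PlanarTree}, ForestBranching cs →
    ForestBranching (forestRelabel f cs)
  | [], _ => trivial
  | _ :: _, h => ⟨Branching.relabel f h.1, ForestBranching.relabel f h.2⟩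
end

lemma ofChildren_spec {cs : List PlanarTree} (h : ForestBranching cs) :
    (ofChildren cs = none → forestLeaves cs = []) ∧
      ∀ t, ofChildren cs = some t → Branching t ∧ leaves t = forestLeaves cs := by
  match cs, h with
  | [], _ => simp [ofChildren, forestLeaves]
  | [c], h => simp [ofChildren, forestLeaves, h.1]
  | c :: d :: cs, h =>
    refine ⟨by simp [ofChildren], fun t ht => ?_⟩
    simp only [ofChildren, Option.some.injEq] at ht
    subst ht
    exact ⟨⟨by simp, h⟩, by simp [leaves]⟩

mutual
lemma delete_spec (j : ℕ) : ∀ {t : PlanarTree}, Branching t →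
    (delete j t = none → (leaves t).filter (· ≠ j) = []) ∧
      ∀ s, delete j t = some s → Branching s ∧ leaves s = (leaves t).filter (· ≠ j)
  | leaf i, _ => by
    by_cases h : i = j
    · simp [delete, leaves, h]
    · refine ⟨by simp [delete, h], fun s hs => ?_⟩
      simp only [delete, if_neg h, Option.some.injEq] at hs
      subst hs
      exact ⟨trivial, by simp [leaves, h]⟩
  | node cs, h => by
    obtain ⟨h1, h2⟩ := forestDelete_spec j h.2
    have := ofChildren_spec h1
    rw [h2] at this
    simpa only [delete, leaves] using this
lemma forestDelete_spec (j : ℕ) : ∀ {cs : List PlanarTree}, ForestBranching cs →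
    ForestBranching (forestDelete j cs) ∧
      forestLeaves (forestDelete j cs) = (forestLeaves cs).filter (· ≠ j)
  | [], _ => by simp [forestDelete, forestLeaves, ForestBranching]
  | c :: cs, h => by
    obtain ⟨h1, h2⟩ := delete_spec j h.1
    obtain ⟨h3, h4⟩ := forestDelete_spec j h.2
    simp only [forestDelete, forestLeaves, List.filter_append]
    cases hd : delete j c with
    | none => exact ⟨h3, by rw [h1 hd, h4]; simp⟩
    | some d =>
      obtain ⟨h5, h6⟩ := h2 d hd
      exact ⟨⟨h5, h3⟩, by simp only [forestLeaves]; rw [h6, h4]⟩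
end

lemma leastFirst_spec (cs : List PlanarTree) : (leastFirst cs).Perm cs ∧
    ∀ c ds, leastFirst cs = c :: ds → ∀ d ∈ ds, minLabel c ≤ minLabel d := by
  induction cs with
  | nil => simp [leastFirst]
  | cons c cs ih =>
    obtain ⟨h1, h2⟩ := ih
    rw [leastFirst]
    cases hl : leastFirst cs with
    | nil =>
      rw [hl] at h1
      have : cs = [] := h1.symm.eq_nil
      subst this
      simp
    | cons d ds =>
      rw [hl] at h1
      have h3 := h2 d ds hl
      dsimp only
      split_ifs with hlt
      · refine ⟨List.Perm.refl _, fun a as ha e he => ?_⟩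
        obtain ⟨rfl, rfl⟩ := List.cons.inj ha
        rcases List.mem_cons.1 (h1.mem_iff.2 he) with rfl | he
        · exact hlt.le
        · exact hlt.le.trans (h3 e he)
      · refine ⟨(List.Perm.swap _ _ _).trans (h1.cons _), fun a as ha e he => ?_⟩
        obtain ⟨rfl, rfl⟩ := List.cons.inj ha
        rcases List.mem_cons.1 he with rfl | he
        · exact not_lt.1 hlt
        · exact h3 e he

lemma leastTwoFirst_perm (cs : List PlanarTree) : (leastTwoFirst cs).Perm cs := by
  have h := (leastFirst_spec cs).1
  rw [leastTwoFirst]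
  cases hl : leastFirst cs with
  | nil => rw [hl] at h; exact h
  | cons c ds => rw [hl] at h; exact ((leastFirst_spec ds).1.cons c).trans h

lemma pairwise_minLabel {cs : List PlanarTree} (hb : ForestBranching cs)
    (hn : (forestLeaves cs).Nodup) : cs.Pairwise fun c d => minLabel c ≠ minLabel d := by
  induction cs with
  | nil => exact List.Pairwise.nil
  | cons c cs ih =>
    rw [forestLeaves, List.nodup_append] at hn
    refine List.Pairwise.cons (fun d hd he => ?_) (ih hb.2 hn.2.1)
    have h1 := minLabel_mem hb.1
    have h2 := minLabel_mem (forestBranching_iff.1 hb.2 d hd)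
    exact hn.2.2 _ h1 _ (mem_forestLeaves.2 ⟨d, hd, h2⟩) he

lemma leastTwoFirst_spec {cs : List PlanarTree} (hl : 2 ≤ cs.length) (hb : ForestBranching cs)
    (hn : (forestLeaves cs).Nodup) : LeastTwoFirst (leastTwoFirst cs) := by
  have hp := leastTwoFirst_perm cs
  have hpw : (leastTwoFirst cs).Pairwise fun c d => minLabel c ≠ minLabel d :=
    (hp.pairwise_iff (fun h => h.symm)).2 (pairwise_minLabel hb hn)
  obtain ⟨h1, h2⟩ := leastFirst_spec cs
  rw [← hp.length_eq] at hl
  rw [leastTwoFirst] at hl hpw ⊢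
  cases hc : leastFirst cs with
  | nil => rw [hc] at hl; simp at hl
  | cons c ds =>
    rw [hc] at hl hpw
    obtain ⟨h3, h4⟩ := leastFirst_spec ds
    dsimp only at hl hpw ⊢
    cases hd : leastFirst ds with
    | nil => rw [hd] at hl; simp at hl
    | cons d es =>
      rw [hd] at hpw
      simp only [List.pairwise_cons] at hpw
      refine ⟨lt_of_le_of_ne (h2 c ds hc d ?_) (hpw.1 d (by simp)), fun e he => ?_⟩
      · exact h3.mem_iff.1 (by simp [hd])
      · exact lt_of_le_of_ne (h4 d es hd e he) (hpw.2.1 e he)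

mutual
lemma canon_spec : ∀ {t : PlanarTree}, Branching t → (leaves t).Nodup →
    SemiPlanar (canon t) ∧ (leaves (canon t)).Perm (leaves t)
  | leaf _, _, _ => ⟨trivial, List.Perm.refl _⟩
  | node cs, h, hn => by
    rw [leaves] at hn
    obtain ⟨h1, h2, h3⟩ := forestCanon_spec h.2 hn
    have hp := leastTwoFirst_perm (forestCanon cs)
    refine ⟨⟨leastTwoFirst_spec (h3.symm ▸ h.1) h1.branching (h2.nodup_iff.2 hn), ?_⟩, ?_⟩
    · rw [forestSemiPlanar_iff] at h1 ⊢
      exact fun c hc => h1 c (hp.mem_iff.1 hc)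
    · simp only [canon, leaves]
      exact (forestLeaves_perm hp).trans h2
lemma forestCanon_spec : ∀ {cs : List PlanarTree}, ForestBranching cs → (forestLeaves cs).Nodup →
    ForestSemiPlanar (forestCanon cs) ∧ (forestLeaves (forestCanon cs)).Perm (forestLeaves cs) ∧
      (forestCanon cs).length = cs.length
  | [], _, _ => ⟨trivial, List.Perm.refl _, rfl⟩
  | c :: cs, h, hn => by
    rw [forestLeaves, List.nodup_append] at hn
    obtain ⟨h1, h2⟩ := canon_spec h.1 hn.1
    obtain ⟨h3, h4, h5⟩ := forestCanon_spec h.2 hn.2.1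
    exact ⟨⟨h1, h3⟩, by simpa only [forestCanon, forestLeaves] using h2.append h4,
      by simp [forestCanon, h5]⟩
end

mutual
lemma spine_mem (i : ℕ) : ∀ (t : PlanarTree) (s : List (List PlanarTree × List PlanarTree)),
    spine i t = some s → ∀ p ∈ s, ∀ k ∈ forestLeaves (p.1 ++ p.2), k ∈ leaves t
  | leaf k, s, h, p, hp => by
    rw [spine] at h
    split_ifs at h
    simp only [Option.some.injEq] at h
    subst h
    simp at hp
  | node cs, s, h, p, hp => fun k hk => by
    rw [spine] at h
    have := forestSpine_mem i cs [] s h p hp k hk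
    simpa [leaves] using this
lemma forestSpine_mem (i : ℕ) : ∀ (cs left : List PlanarTree)
    (s : List (List PlanarTree × List PlanarTree)), forestSpine i left cs = some s →
    ∀ p ∈ s, ∀ k ∈ forestLeaves (p.1 ++ p.2), k ∈ forestLeaves (left ++ cs)
  | [], left, s, h, p, hp => by simp [forestSpine] at h
  | c :: cs, left, s, h, p, hp => fun k hk => by
    rw [forestSpine] at h
    cases hc : spine i c with
    | none =>
      rw [hc] at h
      have := forestSpine_mem i cs (left ++ [c]) s h p hp k hk
      simpa using this
    | some s' =>
      rw [hc] at h
      simp only [Option.some.injEq] at h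
      subst h
      simp only [forestLeaves_append, forestLeaves, List.mem_append]
      rcases List.mem_append.1 hp with hp | hp
      · exact Or.inr (Or.inl (spine_mem i c s' hc p hp k hk))
      · simp only [List.mem_singleton] at hp
        subst hp
        simp only [forestLeaves_append, List.mem_append] at hk
        tauto
end

lemma forestMin_mem (cs : List PlanarTree) : forestMin cs = 0 ∨ forestMin cs ∈ forestLeaves cs := by
  rcases Set.eq_empty_or_nonempty {i | i ∈ forestLeaves cs} with h | h
  · left; rw [forestMin, h]; exact Nat.sInf_empty
  · right; exact Nat.sInf_mem h

lemma minLabel_mem' {c : PlanarTree} {cs : List PlanarTree} (h : c ∈ cs) :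
    minLabel c = 0 ∨ minLabel c ∈ forestLeaves cs := by
  rcases Set.eq_empty_or_nonempty {i | i ∈ leaves c} with hc | hc
  · left; rw [minLabel, hc]; exact Nat.sInf_empty
  · right; exact mem_forestLeaves.2 ⟨c, h, Nat.sInf_mem hc⟩

lemma secondMin_mem (i : ℕ) (s : List (List PlanarTree × List PlanarTree)) :
    secondMin i s = 0 ∨ ∃ p ∈ s, secondMin i s ∈ forestLeaves (p.1 ++ p.2) := by
  match s with
  | [] => exact Or.inl rfl
  | p :: s =>
    simp only [secondMin]
    split_ifs
    · match s with
      | [] => exact Or.inl rfl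
      | q :: s => exact (forestMin_mem (q.1 ++ q.2)).imp_right fun h => ⟨q, by simp, h⟩
    · split
      · next c hc =>
        have hm := List.mem_of_find?_eq_some hc
        exact (minLabel_mem' (cs := p.1 ++ p.2) (by simp [hm])).imp_right
          fun h => ⟨p, by simp, h⟩
      · exact Or.inl rfl
    · split
      · next c hc =>
        have hm := List.mem_of_find?_eq_some hc
        exact (minLabel_mem' (cs := p.1 ++ p.2) (by simp [List.mem_reverse.1 hm])).imp_right
          fun h => ⟨p, by simp, h⟩
      · exact Or.inl rfl

lemma search_mem {t : PlanarTree} {i : ℕ} (hi : i ∈ leaves t) : search t i ∈ leaves t := by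
  rw [search]
  cases hs : spine i t with
  | none => exact hi
  | some s =>
    have h0 := spine_mem i t s hs
    have h1 : firstMin s = 0 ∨ firstMin s ∈ leaves t := by
      match s with
      | [] => exact Or.inl rfl
      | p :: s => exact (forestMin_mem (p.1 ++ p.2)).imp_right (h0 p (by simp) _)
    have h2 : secondMin i s = 0 ∨ secondMin i s ∈ leaves t :=
      (secondMin_mem i s).imp_right fun ⟨p, hp, h⟩ => h0 p hp _ h
    dsimp only
    have key : ∀ a b : ℕ, a ∈ leaves t → (b = 0 ∨ b ∈ leaves t) → max a b ∈ leaves t := by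
      rintro a b ha (rfl | hb)
      · simpa using ha
      · rcases max_choice a b with h | h <;> rw [h] <;> assumption
    rw [← max_assoc]
    exact key _ _ (key _ _ hi h1) h2

end PlanarTree

/-! ### Semi-planar `[n]`-trees -/

/-- Semi-planar trees with leaves labelled by `1, …, n`.  Each such tree is given by its canonical
planar representative: at every branch point the two subtrees with the smallest leaf labels stand
leftmost, in increasing order of least label (so that their order carries no information), and
are followed by the other subtrees in their left-to-right order. -/
structure SemiPlanarTree (n : ℕ) where
  tree : PlanarTree
  semiPlanar : tree.SemiPlanar
  leaves_perm : tree.leaves.Perm (List.range' 1 n)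

namespace SemiPlanarTree

@[ext] lemma ext {n : ℕ} {s t : SemiPlanarTree n} (h : s.tree = t.tree) : s = t := by
  cases s; cases t; simp_all

instance (n : ℕ) : TopologicalSpace (SemiPlanarTree n) := ⊥
instance (n : ℕ) : DiscreteTopology (SemiPlanarTree n) := ⟨rfl⟩
instance (n : ℕ) : MeasurableSpace (SemiPlanarTree n) := ⊤
instance (n : ℕ) : DiscreteMeasurableSpace (SemiPlanarTree n) := ⟨fun _ => trivial⟩

lemma mem_leaves {n : ℕ} (t : SemiPlanarTree n) {i : ℕ} :
    i ∈ t.tree.leaves ↔ 1 ≤ i ∧ i ≤ n := by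
  rw [t.leaves_perm.mem_iff, List.mem_range'_1]
  omega

lemma nodup_leaves {n : ℕ} (t : SemiPlanarTree n) : t.tree.leaves.Nodup :=
  t.leaves_perm.nodup_iff.2 List.nodup_range'

lemma length_leaves {n : ℕ} (t : SemiPlanarTree n) : t.tree.leaves.length = n := by
  rw [t.leaves_perm.length_eq, List.length_range']

end SemiPlanarTree

/-- The probability of an insertion of weight `w` into a tree with `n` leaves: `w / (n - α)`.  Into
the tree with one leaf there is exactly one insertion, which then has probability `1` (for `α < 1`
this is the same). -/
def insertionProb (α : ℝ) (n : ℕ) (w : ℝ) : ℝ≥0∞ :=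
  if n = 1 then 1 else ENNReal.ofReal (w / (n - α))

lemma PlanarTree.insertions_prob {α γ : ℝ} (h : 0 ≤ γ ∧ γ ≤ α ∧ α ≤ 1) {n : ℕ} (hn : n ≠ 0)
    (t : SemiPlanarTree n) (j : ℕ) :
    ((insertions α γ j t.tree).map fun p => insertionProb α n p.1).sum = 1 := by
  by_cases h1 : n = 1
  · subst h1
    have hl := t.length_leaves
    cases ht : t.tree with
    | leaf i => simp [insertions, insertionProb]
    | node cs =>
      exfalso
      have hb := t.semiPlanar.branching
      rw [ht] at hl hb
      match cs, hb with
      | [], hb => simp [Branching] at hb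
      | [c], hb => simp [Branching] at hb
      | c :: d :: cs, hb =>
        have h1 := List.length_pos_iff.2 hb.2.1.leaves_ne_nil
        have h2 := List.length_pos_iff.2 hb.2.2.1.leaves_ne_nil
        simp only [leaves, forestLeaves, List.length_append] at hl
        omega
  · have hpos : (0 : ℝ) < n - α := by
      have : (2 : ℝ) ≤ n := by exact_mod_cast (show 2 ≤ n by omega)
      linarith [h.2.2]
    have key : ∀ l : List (ℝ × PlanarTree), (∀ p ∈ l, 0 ≤ p.1) →
        (l.map fun p => insertionProb α n p.1).sum =
          ENNReal.ofReal ((l.map Prod.fst).sum / (n - α)) ∧ 0 ≤ (l.map Prod.fst).sum := by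
      intro l
      induction l with
      | nil => simp
      | cons p l ih =>
        intro hl
        obtain ⟨h2, h3⟩ := ih fun q hq => hl q (List.mem_cons_of_mem _ hq)
        have h4 := hl p List.mem_cons_self
        refine ⟨?_, by simpa using add_nonneg h4 h3⟩
        rw [List.map_cons, List.sum_cons, h2, List.map_cons, List.sum_cons, insertionProb, if_neg h1]
        rw [add_div, ENNReal.ofReal_add (by positivity) (by positivity)]
    rw [(key _ (insertions_nonneg h j t.tree)).1, insertions_sum α γ j t.semiPlanar.branching,
      t.length_leaves, div_self hpos.ne', ENNReal.ofReal_one]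

namespace SemiPlanarTree

open Classical in
/-- The growth rule: the distribution of the semi-planar tree obtained from `t` by inserting leaf
`n + 1` according to the weights, i.e. `t'` has as its probability the sum of
`w / (n - α)` over all insertions, of weight `w`, that yield `t'`. -/
def growStep {α γ : ℝ} (h : 0 ≤ γ ∧ γ ≤ α ∧ α ≤ 1) (n : ℕ) (t : SemiPlanarTree (n + 1)) :
    PMF (SemiPlanarTree (n + 1 + 1)) :=
  ⟨fun t' => ((t.tree.insertions α γ (n + 2)).map fun p =>
      if p.2 = t'.tree then insertionProb α (n + 1) p.1 else 0).sum, by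
    have hs : ∀ p ∈ t.tree.insertions α γ (n + 2), ∃ t' : SemiPlanarTree (n + 1 + 1),
        t'.tree = p.2 := by
      intro p hp
      obtain ⟨h1, h2⟩ := PlanarTree.insertions_spec t.semiPlanar
        (fun i hi => by have := t.mem_leaves.1 hi; omega) p hp
      refine ⟨⟨p.2, h1, h2.trans ?_⟩, rfl⟩
      refine (t.leaves_perm.cons _).trans ?_
      rw [List.range'_1_concat (n := n + 1), show 1 + (n + 1) = n + 2 by omega]
      exact (List.perm_append_singleton _ _).symm
    rw [← PlanarTree.insertions_prob h (Nat.succ_ne_zero n) t (n + 2)]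
    generalize t.tree.insertions α γ (n + 2) = l at hs
    induction l with
    | nil => simp
    | cons p l ih =>
      simp only [List.map_cons, List.sum_cons]
      refine HasSum.add ?_ (ih fun q hq => hs q (List.mem_cons_of_mem _ hq))
      obtain ⟨t', ht'⟩ := hs p List.mem_cons_self
      have := hasSum_ite_eq t' (insertionProb α (n + 1) p.1)
      convert this using 2 with s
      rw [← ht']
      refine if_congr ⟨fun e => (SemiPlanarTree.ext e).symm, fun e => by rw [e]⟩ rfl rfl⟩

lemma swapDelete_spec {n : ℕ} (t : SemiPlanarTree (n + 2)) (i : Fin (n + 2)) :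
    (t.tree.swapDelete (i + 1) (t.tree.search (i + 1))).SemiPlanar ∧
      (t.tree.swapDelete (i + 1) (t.tree.search (i + 1))).leaves.Perm (List.range' 1 (n + 1)) := by
  have hi : (i : ℕ) + 1 ∈ t.tree.leaves := t.mem_leaves.2 (by omega)
  have hk := PlanarTree.search_mem hi
  generalize t.tree.search (i + 1) = k at hk
  generalize (i : ℕ) + 1 = i at hi
  have hk' := t.mem_leaves.1 hk
  have hi' := t.mem_leaves.1 hi
  set u := t.tree.swapLabels i k with hu
  have hub : u.Branching := PlanarTree.Branching.relabel _ t.semiPlanar.branching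
  have hul : u.leaves = t.tree.leaves.map (Equiv.swap i k) := PlanarTree.leaves_relabel _ _
  have hun : u.leaves.Nodup := by
    rw [hul]; exact t.nodup_leaves.map (Equiv.injective _)
  have hum : ∀ x, x ∈ u.leaves ↔ 1 ≤ x ∧ x ≤ n + 2 := by
    intro x
    rw [hul, List.mem_map]
    constructor
    · rintro ⟨y, hy, rfl⟩
      have := t.mem_leaves.1 hy
      rw [Equiv.swap_apply_def]
      split_ifs <;> assumption
    · intro hx
      refine ⟨Equiv.swap i k x, t.mem_leaves.2 ?_, Equiv.swap_apply_self _ _ _⟩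
      rw [Equiv.swap_apply_def]
      split_ifs <;> assumption
  obtain ⟨h1, h2⟩ := PlanarTree.delete_spec k hub
  cases hd : u.delete k with
  | none =>
    exfalso
    have h3 := h1 hd
    obtain ⟨x, hx, hxk⟩ : ∃ x, x ∈ u.leaves ∧ x ≠ k := by
      by_cases hk1 : k = 1
      · exact ⟨2, (hum 2).2 (by omega), by omega⟩
      · exact ⟨1, (hum 1).2 (by omega), by omega⟩
    have : x ∈ u.leaves.filter (· ≠ k) := by simp [hx, hxk]
    rw [h3] at this
    simp at this
  | some v =>
    obtain ⟨h3, h4⟩ := h2 v hd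
    set f : ℕ → ℕ := fun x => if k < x then x - 1 else x with hf
    have hlv : (PlanarTree.relabel f v).leaves = (u.leaves.filter (· ≠ k)).map f := by
      rw [PlanarTree.leaves_relabel, h4]
    have hfn : (PlanarTree.relabel f v).leaves.Nodup := by
      rw [hlv]
      refine List.Nodup.map_on ?_ (hun.filter _)
      intro x hx y hy hxy
      have hx' := (List.mem_filter.1 hx).2
      have hy' := (List.mem_filter.1 hy).2
      simp only [decide_not, Bool.not_eq_eq_eq_not, Bool.not_true, decide_eq_false_iff_not]
        at hx' hy'
      simp only [hf] at hxy
      split_ifs at hxy <;> omega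
    obtain ⟨h5, h6⟩ := PlanarTree.canon_spec (h3.relabel f) hfn
    have he : t.tree.swapDelete i k = PlanarTree.canon (PlanarTree.relabel f v) := by
      rw [PlanarTree.swapDelete, ← hu, hd, Option.getD_some]
    rw [he]
    refine ⟨h5, h6.trans ?_⟩
    rw [List.perm_ext_iff_of_nodup hfn List.nodup_range']
    intro x
    rw [hlv, List.mem_range'_1, List.mem_map]
    constructor
    · rintro ⟨y, hy, rfl⟩
      have hy1 := (hum y).1 (List.mem_filter.1 hy).1
      have hy2 := (List.mem_filter.1 hy).2
      simp only [decide_not, Bool.not_eq_eq_eq_not, Bool.not_true, decide_eq_false_iff_not] at hy2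
      simp only [hf]
      split_ifs <;> omega
    · intro hx
      by_cases hxk : x < k
      · refine ⟨x, ?_, by simp only [hf]; rw [if_neg (by omega)]⟩
        simp only [List.mem_filter, hum]
        exact ⟨by omega, by simp; omega⟩
      · refine ⟨x + 1, ?_, by simp only [hf]; rw [if_pos (by omega)]; omega⟩
        simp only [List.mem_filter, hum]
        exact ⟨by omega, by simp; omega⟩

/-- The down-step from leaf `i + 1`: with `k` the label found by the local search, swap the labels
`i + 1` and `k`, delete leaf `k`, and relabel. -/
def downStep {n : ℕ} (t : SemiPlanarTree (n + 2)) (i : Fin (n + 2)) : SemiPlanarTree (n + 1) where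
  tree := t.tree.swapDelete (i + 1) (t.tree.search (i + 1))
  semiPlanar := (t.swapDelete_spec i).1
  leaves_perm := (t.swapDelete_spec i).2

/-- One transition of the semi-planar chain: a uniform leaf, the down-step, the growth rule. -/
def chainStep {α γ : ℝ} (h : 0 ≤ γ ∧ γ ≤ α ∧ α ≤ 1) (n : ℕ) (t : SemiPlanarTree (n + 2)) :
    PMF (SemiPlanarTree (n + 2)) :=
  (PMF.uniformOfFintype (Fin (n + 2))).bind fun i => growStep h n (t.downStep i)

end SemiPlanarTree

/-! ### Non-planar `[n]`-trees -/

/-- Non-planar rooted multifurcating trees with leaves labelled by `1, …, n`.  A vertex other than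
the root is identified with the set of the labels of the leaves above it, and the tree with the
collection of these sets: singletons are leaves, sets with at least two elements are branch
points, and each set also stands for the edge leading down from the vertex to its parent. -/
structure LabelledTree (n : ℕ) where
  clusters : Finset (Finset ℕ)
  subset_labels : ∀ C ∈ clusters, C ⊆ Finset.Icc 1 n
  nonempty : ∀ C ∈ clusters, C.Nonempty
  labels_mem : Finset.Icc 1 n ∈ clusters
  singleton_mem : ∀ i ∈ Finset.Icc 1 n, {i} ∈ clusters
  laminar : ∀ C ∈ clusters, ∀ D ∈ clusters, C ⊆ D ∨ D ⊆ C ∨ Disjoint C D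

namespace LabelledTree

@[ext] lemma ext {n : ℕ} {s t : LabelledTree n} (h : s.clusters = t.clusters) : s = t := by
  cases s; cases t; simp_all

instance (n : ℕ) : MeasurableSpace (LabelledTree n) := ⊤
instance (n : ℕ) : DiscreteMeasurableSpace (LabelledTree n) := ⟨fun _ => trivial⟩

/-- The children of the vertex `C`: the maximal elements of `H` strictly below `C`. -/
def children (H : Finset (Finset ℕ)) (C : Finset ℕ) : Finset (Finset ℕ) :=
  H.filter fun D => D ⊂ C ∧ ∀ E ∈ H, D ⊂ E → ¬ E ⊂ C

/-- Insert leaf `j` into the edge below the vertex `C`: there is a new branch point on this edge,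
with children `C` and `j`. -/
def insertEdge (H : Finset (Finset ℕ)) (C : Finset ℕ) (j : ℕ) : Finset (Finset ℕ) :=
  insert {j} (insert (insert j C) (H.image fun D => if C ⊂ D then insert j D else D))

/-- Insert leaf `j` into the branch point `C`, as a new child of it. -/
def insertBranch (H : Finset (Finset ℕ)) (C : Finset ℕ) (j : ℕ) : Finset (Finset ℕ) :=
  insert {j} (H.image fun D => if C ⊆ D then insert j D else D)

/-- The weight of the edge below the vertex `C`. -/
def edgeWeight (α γ : ℝ) (C : Finset ℕ) : ℝ := if C.card = 1 then 1 - α else γ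

/-- The weight of the branch point `C`. -/
def branchWeight (α γ : ℝ) (H : Finset (Finset ℕ)) (C : Finset ℕ) : ℝ :=
  ((children H C).card - 1) * α - γ

/-- The branch points. -/
def branchPoints (H : Finset (Finset ℕ)) : Finset (Finset ℕ) := H.filter fun C => 2 ≤ C.card

lemma exists_of_attach {n : ℕ} (t : LabelledTree n) {C : Finset ℕ} (hC : C ∈ t.clusters)
    (K : Finset (Finset ℕ))
    (h1 : ∀ X ∈ K, X = {n + 1} ∨ (∃ D ∈ t.clusters, C ⊆ D ∧ X = insert (n + 1) D) ∨
      (X ∈ t.clusters ∧ (C ⊆ X → X = C)))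
    (h2 : {n + 1} ∈ K) (h3 : insert (n + 1) (Finset.Icc 1 n) ∈ K)
    (h4 : ∀ i ∈ Finset.Icc 1 n, {i} ∈ K) : ∃ s : LabelledTree (n + 1), s.clusters = K := by
  have hI : Finset.Icc 1 (n + 1) = insert (n + 1) (Finset.Icc 1 n) := by
    ext x; simp only [Finset.mem_Icc, Finset.mem_insert]; omega
  have hj : ∀ D ∈ t.clusters, n + 1 ∉ D := fun D hD hm => by
    have := Finset.mem_Icc.1 (t.subset_labels D hD hm); omega
  have hCne := t.nonempty C hC
  have key : ∀ D ∈ t.clusters, C ⊆ D → ∀ E ∈ t.clusters, (C ⊆ E → E = C) →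
      E ⊆ insert (n + 1) D ∨ Disjoint E (insert (n + 1) D) := by
    intro D hD hCD E hE hCE
    rcases t.laminar D hD E hE with h | h | h
    · have h5 := hCE (hCD.trans h)
      left; rw [h5]; exact hCD.trans (Finset.subset_insert _ _)
    · left; exact h.trans (Finset.subset_insert _ _)
    · right
      rw [Finset.disjoint_insert_right]
      exact ⟨hj E hE, h.symm⟩
  refine ⟨⟨K, ?_, ?_, hI ▸ h3, ?_, ?_⟩, rfl⟩
  · intro X hX
    rw [hI]
    rcases h1 X hX with rfl | ⟨D, hD, -, rfl⟩ | ⟨hD, -⟩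
    · simp
    · exact Finset.insert_subset_insert _ (t.subset_labels D hD)
    · exact (t.subset_labels X hD).trans (Finset.subset_insert _ _)
  · intro X hX
    rcases h1 X hX with rfl | ⟨D, hD, -, rfl⟩ | ⟨hD, -⟩
    · simp
    · simp
    · exact t.nonempty X hD
  · intro i hi
    rw [hI, Finset.mem_insert] at hi
    rcases hi with rfl | hi
    · exact h2
    · exact h4 i hi
  · intro X hX Y hY
    rcases h1 X hX with rfl | ⟨D, hD, hCD, rfl⟩ | ⟨hD, hCX⟩ <;>
    rcases h1 Y hY with rfl | ⟨E, hE, hCE, rfl⟩ | ⟨hE, hCY⟩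
    · left; exact subset_rfl
    · left; simp
    · right; right; simpa using hj Y hE
    · right; left; simp
    · rcases t.laminar D hD E hE with h | h | h
      · left; exact Finset.insert_subset_insert _ h
      · right; left; exact Finset.insert_subset_insert _ h
      · obtain ⟨x, hx⟩ := hCne
        exact absurd (hCE hx) (Finset.disjoint_left.1 h (hCD hx))
    · rcases key D hD hCD Y hE hCY with h | h
      · exact Or.inr (Or.inl h)
      · exact Or.inr (Or.inr h.symm)
    · right; right; simpa using hj X hD
    · rcases key E hE hCE X hD hCX with h | h
      · exact Or.inl h
      · exact Or.inr (Or.inr h)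
    · exact t.laminar X hD Y hE

lemma exists_insertEdge {n : ℕ} (t : LabelledTree n) {C : Finset ℕ} (hC : C ∈ t.clusters) :
    ∃ s : LabelledTree (n + 1), s.clusters = insertEdge t.clusters C (n + 1) := by
  refine t.exists_of_attach hC _ ?_ (by simp [insertEdge]) ?_ ?_
  · intro X hX
    simp only [insertEdge, Finset.mem_insert, Finset.mem_image] at hX
    rcases hX with rfl | rfl | ⟨D, hD, rfl⟩
    · exact Or.inl rfl
    · exact Or.inr (Or.inl ⟨C, hC, subset_rfl, rfl⟩)
    · split_ifs with h
      · exact Or.inr (Or.inl ⟨D, hD, h.subset, rfl⟩)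
      · exact Or.inr (Or.inr ⟨hD, fun hs => by
          by_contra hne; exact h (hs.ssubset_of_ne (Ne.symm hne))⟩)
  · simp only [insertEdge, Finset.mem_insert, Finset.mem_image]
    by_cases h : C = Finset.Icc 1 n
    · right; left; rw [h]
    · right; right
      exact ⟨_, t.labels_mem, if_pos ((t.subset_labels C hC).ssubset_of_ne h)⟩
  · intro i hi
    simp only [insertEdge, Finset.mem_insert, Finset.mem_image]
    right; right
    refine ⟨_, t.singleton_mem i hi, if_neg fun h => ?_⟩
    have := Finset.ssubset_singleton_iff.1 h
    exact (t.nonempty C hC).ne_empty this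

lemma exists_insertBranch {n : ℕ} (t : LabelledTree n) {C : Finset ℕ}
    (hC : C ∈ branchPoints t.clusters) :
    ∃ s : LabelledTree (n + 1), s.clusters = insertBranch t.clusters C (n + 1) := by
  obtain ⟨hC, h2⟩ := Finset.mem_filter.1 hC
  refine t.exists_of_attach hC _ ?_ (by simp [insertBranch]) ?_ ?_
  · intro X hX
    simp only [insertBranch, Finset.mem_insert, Finset.mem_image] at hX
    rcases hX with rfl | ⟨D, hD, rfl⟩
    · exact Or.inl rfl
    · split_ifs with h
      · exact Or.inr (Or.inl ⟨D, hD, h, rfl⟩)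
      · exact Or.inr (Or.inr ⟨hD, fun hs => absurd hs h⟩)
  · simp only [insertBranch, Finset.mem_insert, Finset.mem_image]
    right
    exact ⟨_, t.labels_mem, if_pos (t.subset_labels C hC)⟩
  · intro i hi
    simp only [insertBranch, Finset.mem_insert, Finset.mem_image]
    right
    refine ⟨_, t.singleton_mem i hi, if_neg fun h => ?_⟩
    have := Finset.card_le_card h
    simp at this
    omega

/-- Every vertex other than `[n]` is the child of exactly one branch point. -/
lemma existsUnique_parent {n : ℕ} (t : LabelledTree n) {D : Finset ℕ} (hD : D ∈ t.clusters)
    (hne : D ≠ Finset.Icc 1 n) :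
    ∃! C, C ∈ branchPoints t.clusters ∧ D ∈ children t.clusters C := by
  have hS : (t.clusters.filter fun C => D ⊂ C).Nonempty :=
    ⟨_, Finset.mem_filter.2 ⟨t.labels_mem, (t.subset_labels D hD).ssubset_of_ne hne⟩⟩
  obtain ⟨C, hC, hmin⟩ := Finset.exists_min_image _ Finset.card hS
  obtain ⟨hC1, hC2⟩ := Finset.mem_filter.1 hC
  have hDn := t.nonempty D hD
  refine ⟨C, ⟨Finset.mem_filter.2 ⟨hC1, ?_⟩, Finset.mem_filter.2 ⟨hD, hC2, ?_⟩⟩, ?_⟩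
  · have h1 := Finset.card_lt_card hC2
    have h2 := Finset.card_pos.2 hDn
    omega
  · intro E hE hDE hEC
    have h1 := hmin E (Finset.mem_filter.2 ⟨hE, hDE⟩)
    have h2 := Finset.card_lt_card hEC
    omega
  · rintro E ⟨hE1, hE2⟩
    obtain ⟨-, hE3, hE4⟩ := Finset.mem_filter.1 hE2
    have hE0 := (Finset.mem_filter.1 hE1).1
    have h1 : ¬ C ⊂ E := hE4 C hC1 hC2
    rcases t.laminar C hC1 E hE0 with h | h | h
    · by_contra hne'
      exact h1 (h.ssubset_of_ne (Ne.symm hne'))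
    · exact Finset.eq_of_subset_of_card_le h (hmin E (Finset.mem_filter.2 ⟨hE0, hE3⟩))
    · obtain ⟨x, hx⟩ := hDn
      exact absurd (hE3.subset hx) (Finset.disjoint_left.1 h (hC2.subset hx))

lemma sum_card_children {n : ℕ} (t : LabelledTree n) :
    ∑ C ∈ branchPoints t.clusters, (children t.clusters C).card + 1 = t.clusters.card := by
  rw [← Finset.card_erase_add_one t.labels_mem]
  congr 1
  rw [← Finset.card_biUnion]
  · congr 1
    ext D
    simp only [Finset.mem_biUnion, Finset.mem_erase]
    constructor
    · rintro ⟨C, hC, hD⟩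
      obtain ⟨h1, h2, -⟩ := Finset.mem_filter.1 hD
      refine ⟨?_, h1⟩
      rintro rfl
      exact (h2.trans_subset (t.subset_labels C (Finset.mem_filter.1 hC).1)).ne rfl
    · rintro ⟨h1, h2⟩
      obtain ⟨C, hC, -⟩ := t.existsUnique_parent h2 h1
      exact ⟨C, hC⟩
  · intro C hC E hE hne
    rw [Function.onFun, Finset.disjoint_left]
    intro D h1 h2
    refine hne ((t.existsUnique_parent (Finset.mem_filter.1 h1).1 ?_).unique ⟨hC, h1⟩ ⟨hE, h2⟩)
    rintro rfl
    have h3 := (Finset.mem_filter.1 h1).2.1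
    exact (h3.trans_subset (t.subset_labels C (Finset.mem_filter.1 hC).1)).ne rfl

lemma two_le_card_children {n : ℕ} (t : LabelledTree n) {C : Finset ℕ}
    (hC : C ∈ branchPoints t.clusters) : 2 ≤ (children t.clusters C).card := by
  obtain ⟨hC, h2⟩ := Finset.mem_filter.1 hC
  have h : ∀ x ∈ C, ∃ D ∈ children t.clusters C, x ∈ D := by
    intro x hx
    have hS : (t.clusters.filter fun D => D ⊂ C ∧ x ∈ D).Nonempty := by
      refine ⟨{x}, Finset.mem_filter.2 ⟨t.singleton_mem x (t.subset_labels C hC hx), ?_, by simp⟩⟩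
      refine (Finset.singleton_subset_iff.2 hx).ssubset_of_ne ?_
      rintro rfl
      simp at h2
    obtain ⟨D, hD, hmax⟩ := Finset.exists_max_image _ Finset.card hS
    obtain ⟨hD1, hD2, hD3⟩ := Finset.mem_filter.1 hD
    refine ⟨D, Finset.mem_filter.2 ⟨hD1, hD2, fun E hE hDE hEC => ?_⟩, hD3⟩
    have h1 := hmax E (Finset.mem_filter.2 ⟨hE, hEC, hDE.subset hD3⟩)
    have h2 := Finset.card_lt_card hDE
    omega
  by_contra hlt
  obtain ⟨x, hx⟩ := t.nonempty C hC
  obtain ⟨D, hD, hxD⟩ := h x hx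
  have h1 : (children t.clusters C).card ≤ 1 := by omega
  have hsub : C ⊆ D := fun y hy => by
    obtain ⟨E, hE, hyE⟩ := h y hy
    rwa [Finset.card_le_one.1 h1 D hD E hE]
  exact (((Finset.mem_filter.1 hD).2.1).trans_subset hsub).ne rfl

lemma card_leaves {n : ℕ} (t : LabelledTree n) :
    (t.clusters.filter fun C => C.card = 1).card = n := by
  have : (t.clusters.filter fun C => C.card = 1) = (Finset.Icc 1 n).image fun i => {i} := by
    ext C
    simp only [Finset.mem_filter, Finset.mem_image]
    constructor
    · rintro ⟨h1, h2⟩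
      obtain ⟨i, rfl⟩ := Finset.card_eq_one.1 h2
      exact ⟨i, t.subset_labels _ h1 (by simp), rfl⟩
    · rintro ⟨i, hi, rfl⟩
      exact ⟨t.singleton_mem i hi, by simp⟩
  rw [this, Finset.card_image_of_injective _ Finset.singleton_injective]
  simp

lemma weights_nonneg {α γ : ℝ} (h : 0 ≤ γ ∧ γ ≤ α ∧ α ≤ 1) {n : ℕ} (t : LabelledTree n) :
    (∀ C, 0 ≤ edgeWeight α γ C) ∧
      ∀ C ∈ branchPoints t.clusters, 0 ≤ branchWeight α γ t.clusters C := by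
  refine ⟨fun C => ?_, fun C hC => ?_⟩
  · rw [edgeWeight]
    split_ifs <;> linarith
  · have h1 : (2 : ℝ) ≤ (children t.clusters C).card := by
      exact_mod_cast t.two_le_card_children hC
    rw [branchWeight]
    nlinarith

/-- The total weight of all insertable parts of a tree with `n` leaves is `n - α`. -/
lemma weights_sum (α γ : ℝ) {n : ℕ} (t : LabelledTree n) :
    ∑ C ∈ t.clusters, edgeWeight α γ C +
      ∑ C ∈ branchPoints t.clusters, branchWeight α γ t.clusters C = n - α := by
  have h1 := t.card_leaves
  have h2 : (t.clusters.filter fun C => ¬ C.card = 1) = branchPoints t.clusters := by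
    rw [branchPoints]
    refine Finset.filter_congr fun C hC => ?_
    have := Finset.card_pos.2 (t.nonempty C hC)
    omega
  have h3 := Finset.card_filter_add_card_filter_not (s := t.clusters) (fun C => C.card = 1)
  rw [h1, h2, ← t.sum_card_children] at h3
  have h4 : ((n : ℝ) + (branchPoints t.clusters).card) =
      ∑ C ∈ branchPoints t.clusters, ((children t.clusters C).card : ℝ) + 1 := by
    exact_mod_cast h3
  have h5 : ∑ C ∈ t.clusters, edgeWeight α γ C =
      n * (1 - α) + (branchPoints t.clusters).card * γ := by
    simp only [edgeWeight]
    rw [Finset.sum_ite, h2, Finset.sum_const, Finset.sum_const, h1]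
    simp
  have h6 : ∑ C ∈ branchPoints t.clusters, branchWeight α γ t.clusters C =
      (∑ C ∈ branchPoints t.clusters, ((children t.clusters C).card : ℝ)) * α -
        (branchPoints t.clusters).card * α - (branchPoints t.clusters).card * γ := by
    simp only [branchWeight, Finset.sum_sub_distrib, sub_mul, Finset.sum_mul, Finset.sum_const]
    simp
  rw [h5, h6]
  have h7 : ∑ C ∈ branchPoints t.clusters, ((children t.clusters C).card : ℝ) =
      n + (branchPoints t.clusters).card - 1 := by linarith
  rw [h7]
  ring

lemma weights_prob {α γ : ℝ} (h : 0 ≤ γ ∧ γ ≤ α ∧ α ≤ 1) {n : ℕ} (hn : n ≠ 0)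
    (t : LabelledTree n) :
    ∑ C ∈ t.clusters, insertionProb α n (edgeWeight α γ C) +
      ∑ C ∈ branchPoints t.clusters, insertionProb α n (branchWeight α γ t.clusters C) = 1 := by
  by_cases h1 : n = 1
  · subst h1
    have hC : t.clusters = {{1}} := by
      ext C
      rw [Finset.mem_singleton]
      constructor
      · intro hC
        have h2 := t.subset_labels C hC
        rw [Finset.Icc_self] at h2
        exact (Finset.subset_singleton_iff.1 h2).resolve_left (t.nonempty C hC).ne_empty
      · rintro rfl
        exact t.singleton_mem 1 (by simp)
    rw [hC]
    simp [branchPoints, insertionProb]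
  · have hpos : (0 : ℝ) < n - α := by
      have : (2 : ℝ) ≤ n := by exact_mod_cast (show 2 ≤ n by omega)
      linarith [h.2.2]
    obtain ⟨h2, h3⟩ := t.weights_nonneg h
    simp only [insertionProb, if_neg h1]
    rw [← ENNReal.ofReal_sum_of_nonneg (fun C _ => div_nonneg (h2 C) hpos.le),
      ← ENNReal.ofReal_sum_of_nonneg (fun C hC => div_nonneg (h3 C hC) hpos.le),
      ← ENNReal.ofReal_add
        (Finset.sum_nonneg fun C _ => div_nonneg (h2 C) hpos.le)
        (Finset.sum_nonneg fun C hC => div_nonneg (h3 C hC) hpos.le),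
      ← Finset.sum_div, ← Finset.sum_div, ← add_div, t.weights_sum, div_self hpos.ne',
      ENNReal.ofReal_one]

open Classical in
/-- The growth rule on non-planar trees: the distribution of the tree obtained from `t` by
inserting leaf `n + 1` into an edge or a branch point according to the weights. -/
def growStep {α γ : ℝ} (h : 0 ≤ γ ∧ γ ≤ α ∧ α ≤ 1) (n : ℕ) (t : LabelledTree (n + 1)) :
    PMF (LabelledTree (n + 1 + 1)) :=
  ⟨fun t' =>
    ∑ C ∈ t.clusters, (if insertEdge t.clusters C (n + 2) = t'.clusters then
      insertionProb α (n + 1) (edgeWeight α γ C) else 0) +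
    ∑ C ∈ branchPoints t.clusters, (if insertBranch t.clusters C (n + 2) = t'.clusters then
      insertionProb α (n + 1) (branchWeight α γ t.clusters C) else 0), by
    have key : ∀ (K : Finset (Finset ℕ)) (p : ℝ≥0∞),
        (∃ s : LabelledTree (n + 1 + 1), s.clusters = K) →
        HasSum (fun t' : LabelledTree (n + 1 + 1) => if K = t'.clusters then p else 0) p := by
      rintro _ p ⟨s, rfl⟩
      have := hasSum_ite_eq s p
      convert this using 2 with t'
      exact if_congr ⟨fun e => (LabelledTree.ext e).symm, fun e => by rw [e]⟩ rfl rfl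
    rw [← t.weights_prob h (Nat.succ_ne_zero n)]
    exact (hasSum_sum fun C hC => key _ _ (t.exists_insertEdge hC)).add
      (hasSum_sum fun C hC => key _ _ (t.exists_insertBranch hC))⟩

end LabelledTree

/-! ### The projection -/

namespace PlanarTree

mutual
lemma clusters_spec : ∀ {t : PlanarTree}, Branching t →
    (leaves t).toFinset ∈ clusters t ∧ (∀ i ∈ leaves t, {i} ∈ clusters t) ∧
      (∀ C ∈ clusters t, C ⊆ (leaves t).toFinset ∧ C.Nonempty) ∧
      ((leaves t).Nodup → ∀ C ∈ clusters t, ∀ D ∈ clusters t, C ⊆ D ∨ D ⊆ C ∨ Disjoint C D)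
  | leaf i, _ => by simp [leaves, clusters]
  | node cs, h => by
    obtain ⟨h1, h2, h3⟩ := forestClusters_spec h.2
    have hne : forestLeaves cs ≠ [] := Branching.leaves_ne_nil (t := node cs) h
    simp only [leaves, clusters, Finset.mem_insert]
    refine ⟨Or.inl trivial, fun i hi => Or.inr (h1 i hi), ?_, fun hn => ?_⟩
    · rintro C (rfl | hC)
      · exact ⟨subset_rfl, by simpa [Finset.nonempty_iff_ne_empty] using hne⟩
      · exact h2 C hC
    · rintro C (rfl | hC) D (rfl | hD)
      · exact Or.inl subset_rfl
      · exact Or.inr (Or.inl (h2 D hD).1)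
      · exact Or.inl (h2 C hC).1
      · exact h3 hn C hC D hD
lemma forestClusters_spec : ∀ {cs : List PlanarTree}, ForestBranching cs →
    (∀ i ∈ forestLeaves cs, {i} ∈ forestClusters cs) ∧
      (∀ C ∈ forestClusters cs, C ⊆ (forestLeaves cs).toFinset ∧ C.Nonempty) ∧
      ((forestLeaves cs).Nodup → ∀ C ∈ forestClusters cs, ∀ D ∈ forestClusters cs,
        C ⊆ D ∨ D ⊆ C ∨ Disjoint C D)
  | [], _ => by simp [forestLeaves, forestClusters]
  | c :: cs, h => by
    obtain ⟨-, h1, h2, h3⟩ := clusters_spec h.1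
    obtain ⟨g1, g2, g3⟩ := forestClusters_spec h.2
    simp only [forestLeaves, forestClusters, Finset.mem_union, List.mem_append,
      List.toFinset_append, List.nodup_append]
    refine ⟨fun i hi => hi.imp (h1 i) (g1 i), ?_, fun hn => ?_⟩
    · rintro C (hC | hC)
      · exact ⟨(h2 C hC).1.trans Finset.subset_union_left, (h2 C hC).2⟩
      · exact ⟨(g2 C hC).1.trans Finset.subset_union_right, (g2 C hC).2⟩
    · have hd : Disjoint (leaves c).toFinset (forestLeaves cs).toFinset := by
        rw [Finset.disjoint_left]
        intro x hx hy
        exact hn.2.2 x (List.mem_toFinset.1 hx) x (List.mem_toFinset.1 hy) rfl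
      rintro C (hC | hC) D (hD | hD)
      · exact h3 hn.1 C hC D hD
      · exact Or.inr (Or.inr (hd.mono (h2 C hC).1 (g2 D hD).1))
      · exact Or.inr (Or.inr (hd.symm.mono (g2 C hC).1 (h2 D hD).1))
      · exact g3 hn.2.1 C hC D hD
end

end PlanarTree

/-- The projection of a semi-planar tree to its tree shape. -/
def SemiPlanarTree.proj {n : ℕ} (t : SemiPlanarTree n) : LabelledTree n where
  clusters := t.tree.clusters
  subset_labels C hC := by
    intro i hi
    have := ((PlanarTree.clusters_spec t.semiPlanar.branching).2.2.1 C hC).1 hi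
    exact Finset.mem_Icc.2 (t.mem_leaves.1 (List.mem_toFinset.1 this))
  nonempty C hC := ((PlanarTree.clusters_spec t.semiPlanar.branching).2.2.1 C hC).2
  labels_mem := by
    have h := (PlanarTree.clusters_spec t.semiPlanar.branching).1
    have : t.tree.leaves.toFinset = Finset.Icc 1 n := by
      ext i; simp [t.mem_leaves]
    rwa [this] at h
  singleton_mem i hi := (PlanarTree.clusters_spec t.semiPlanar.branching).2.1 i
    (t.mem_leaves.2 (Finset.mem_Icc.1 hi))
  laminar := (PlanarTree.clusters_spec t.semiPlanar.branching).2.2.2 t.nodup_leaves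

/-! ### Markov chains -/

/-- The process `X`, with (discrete) state space `S k` at time `k`, is a Markov chain whose
transition from time `k` to time `k + 1` is given by the kernel `K k`; its initial distribution is
arbitrary. -/
structure IsMarkovChain {Ω : Type*} [MeasurableSpace Ω] (μ : Measure Ω) {S : ℕ → Type*}
    [∀ k, MeasurableSpace (S k)] (X : ∀ k, Ω → S k) (K : ∀ k, S k → PMF (S (k + 1))) : Prop where
  measurable : ∀ k, Measurable (X k)
  transition : ∀ (k : ℕ) (x : ∀ j, S j) (y : S (k + 1)),
    μ {ω | (∀ j ≤ k, X j ω = x j) ∧ X (k + 1) ω = y} =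
      μ {ω | ∀ j ≤ k, X j ω = x j} * K k (x k) y

/-- `T 0, T 1, …` are the first, second, … steps of a semi-planar `(α, γ)`-growth process. -/
def IsSemiPlanarGrowthProcess {α γ : ℝ} (h : 0 ≤ γ ∧ γ ≤ α ∧ α ≤ 1) {Ω : Type*}
    [MeasurableSpace Ω] (μ : Measure Ω) (T : ∀ k : ℕ, Ω → SemiPlanarTree (k + 1)) : Prop :=
  IsMarkovChain μ T (SemiPlanarTree.growStep h)

/-- `T 0, T 1, …` are the first, second, … steps of an `(α, γ)`-growth process. -/
def IsGrowthProcess {α γ : ℝ} (h : 0 ≤ γ ∧ γ ≤ α ∧ α ≤ 1) {Ω : Type*}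
    [MeasurableSpace Ω] (μ : Measure Ω) (T : ∀ k : ℕ, Ω → LabelledTree (k + 1)) : Prop :=
  IsMarkovChain μ T (LabelledTree.growStep h)

/-- `X` is a semi-planar `(α, γ)`-chain on the semi-planar `[n + 2]`-trees. -/
def IsSemiPlanarChain {α γ : ℝ} (h : 0 ≤ γ ∧ γ ≤ α ∧ α ≤ 1) {Ω : Type*}
    [MeasurableSpace Ω] (μ : Measure Ω) (n : ℕ) (X : ℕ → Ω → SemiPlanarTree (n + 2)) : Prop :=
  IsMarkovChain μ (S := fun _ => SemiPlanarTree (n + 2)) X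
    (fun _ => SemiPlanarTree.chainStep h n)

end

/-!
The results rest on one identity for a single growth step. Let `t` be a semi-planar tree with
`N ≥ 2` leaves, `i` one of its leaves, and insert leaf `N + 1` into `t` by the growth rule. Of the
total weight `N - α` of the insertions, those for which the local search from leaf `i` finds the
new leaf have weight exactly `1`, and for each of them the down-step gives back `t`. All the other
insertions do not change the label found, and they correspond, with the same weights, to the
insertions into the tree obtained from `t` by the down-step. So, with probability `1 / (N - α)`,
the down-step undoes the growth step, and otherwise the two commute.

At the level of planar trees this identity is `PlanarTree.KeyIdentity`, proved by induction along
the ancestral line of leaf `i` (`PlanarTree.keyIdentity`). At the parent of leaf `i`, the weight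
`1` arises as `(1 - α) + α` if the parent has at least three children, and as
`(1 - α) + (α - γ) + γ` if it has two; further down, nothing happens, since the search sees the
rest of the tree only through the least label of the next spinal bush. To pass to semi-planar
trees, one has to know that the down-step never moves a subtree with one of the two least labels
away from the two leftmost places (`PlanarTree.weakSemiPlanar_shift`) and that insertion commutes
with sorting these two (`PlanarTree.wsum_insertions_canon`). The result is
`SemiPlanarTree.tsum_growStep_downStep`.

By induction on the number of leaves, in the growth process the label found by the local search is
independent of the tree after the down-step, which has the law of the previous tree
(`SemiPlanarTree.tsum_growthLaw_downStep`). This is the statement on conditional distributions;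
summed over the labels found and averaged over the leaves, it says that the law of the growth
process is stationary for the chain (`SemiPlanarTree.growthLaw_bind_chainStep`). Convergence
follows by Doeblin's argument (`SemiPlanarTree.exists_forall_le_chainLaw`): if leaf `1` is chosen
in every transition, then, because down-step and growth commute with positive probability, `n`
transitions replace the tree with `n + 2` leaves with positive probability by one grown from the
unique tree with two leaves, whose law is the stationary one.

For the projection, the weights of the places at a branch point with `c` children add up to
`(c - 1) * α - γ`, so that the projection intertwines the two growth rules
(`SemiPlanarTree.map_proj_growStep`).
-/

namespace PlanarTree

/-! ### Relabelling, deletion and canonical representatives -/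

lemma forestRelabel_eq_map (f : ℕ → ℕ) (cs : List PlanarTree) :
    forestRelabel f cs = cs.map (relabel f) := by
  induction cs with
  | nil => rfl
  | cons c cs ih => simp [forestRelabel, ih]

lemma forestCanon_eq_map (cs : List PlanarTree) : forestCanon cs = cs.map canon := by
  induction cs with
  | nil => rfl
  | cons c cs ih => simp [forestCanon, ih]

lemma minLabel_leaf (i : ℕ) : minLabel (leaf i) = i := by simp [minLabel, leaves]

mutual
lemma relabel_relabel (f g : ℕ → ℕ) : ∀ t : PlanarTree,
    relabel f (relabel g t) = relabel (f ∘ g) t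
  | leaf _ => rfl
  | node cs => by simp [relabel, forestRelabel_forestRelabel f g cs]
lemma forestRelabel_forestRelabel (f g : ℕ → ℕ) : ∀ cs : List PlanarTree,
    forestRelabel f (forestRelabel g cs) = forestRelabel (f ∘ g) cs
  | [] => rfl
  | c :: cs => by
    simp [forestRelabel, relabel_relabel f g c, forestRelabel_forestRelabel f g cs]
end

mutual
lemma relabel_eq_self {f : ℕ → ℕ} : ∀ {t : PlanarTree}, (∀ k ∈ leaves t, f k = k) →
    relabel f t = t
  | leaf i, h => by simp [relabel, h i (by simp [leaves])]
  | node cs, h => by rw [relabel, forestRelabel_eq_self (by simpa [leaves] using h)]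
lemma forestRelabel_eq_self {f : ℕ → ℕ} : ∀ {cs : List PlanarTree},
    (∀ k ∈ forestLeaves cs, f k = k) → forestRelabel f cs = cs
  | [], _ => rfl
  | c :: cs, h => by
    simp only [forestLeaves, List.mem_append] at h
    rw [forestRelabel, relabel_eq_self fun k hk => h k (Or.inl hk),
      forestRelabel_eq_self fun k hk => h k (Or.inr hk)]
end

mutual
lemma delete_relabel {f : ℕ → ℕ} (hf : Function.Injective f) (i : ℕ) : ∀ t : PlanarTree,
    delete (f i) (relabel f t) = (delete i t).map (relabel f)
  | leaf k => by by_cases h : k = i <;> simp [delete, relabel, hf.eq_iff, h]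
  | node cs => by
    rw [relabel, delete, delete, forestDelete_relabel hf i cs]
    rcases forestDelete i cs with _ | ⟨a, _ | ⟨b, l⟩⟩ <;> simp [ofChildren, forestRelabel, relabel]
lemma forestDelete_relabel {f : ℕ → ℕ} (hf : Function.Injective f) (i : ℕ) :
    ∀ cs : List PlanarTree,
    forestDelete (f i) (forestRelabel f cs) = forestRelabel f (forestDelete i cs)
  | [] => rfl
  | c :: cs => by
    rw [forestRelabel, forestDelete, forestDelete, delete_relabel hf i c,
      forestDelete_relabel hf i cs]
    cases delete i c <;> simp [forestRelabel]
end

lemma ofChildren_of_two_le {cs : List PlanarTree} (h : 2 ≤ cs.length) :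
    ofChildren cs = some (node cs) := by
  match cs, h with
  | _ :: _ :: _, _ => rfl

mutual
lemma delete_of_not_mem {i : ℕ} : ∀ {t : PlanarTree}, Branching t → i ∉ leaves t →
    delete i t = some t
  | leaf k, _, h => by
    rw [delete, if_neg]
    rintro rfl
    simp [leaves] at h
  | node cs, hb, h => by
    rw [delete, forestDelete_of_not_mem hb.2 h, ofChildren_of_two_le hb.1]
lemma forestDelete_of_not_mem {i : ℕ} : ∀ {cs : List PlanarTree}, ForestBranching cs →
    i ∉ forestLeaves cs → forestDelete i cs = cs
  | [], _, _ => rfl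
  | c :: cs, hb, h => by
    simp only [forestLeaves, List.mem_append, not_or] at h
    simp [forestDelete, delete_of_not_mem hb.1 h.1, forestDelete_of_not_mem hb.2 h.2]
end

lemma forestDelete_append (i : ℕ) (l r : List PlanarTree) :
    forestDelete i (l ++ r) = forestDelete i l ++ forestDelete i r := by
  induction l with
  | nil => rfl
  | cons c l ih => rw [List.cons_append, forestDelete, forestDelete, ih]; cases delete i c <;> rfl

lemma forestBranching_append {l r : List PlanarTree} :
    ForestBranching (l ++ r) ↔ ForestBranching l ∧ ForestBranching r := by
  simp [forestBranching_iff, or_imp, forall_and]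

lemma forestSemiPlanar_append {l r : List PlanarTree} :
    ForestSemiPlanar (l ++ r) ↔ ForestSemiPlanar l ∧ ForestSemiPlanar r := by
  simp [forestSemiPlanar_iff, or_imp, forall_and]

lemma delete_node_leaf {i : ℕ} {l r : List PlanarTree} (hl : ForestBranching l)
    (hr : ForestBranching r) (hil : i ∉ forestLeaves l) (hir : i ∉ forestLeaves r) :
    delete i (node (l ++ leaf i :: r)) = ofChildren (l ++ r) := by
  rw [delete, forestDelete_append, forestDelete_of_not_mem hl hil, forestDelete,
    forestDelete_of_not_mem hr hir]
  simp [delete]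

lemma delete_node_cons {i : ℕ} {l r : List PlanarTree} {c c' : PlanarTree}
    (hl : ForestBranching l) (hr : ForestBranching r) (hil : i ∉ forestLeaves l)
    (hir : i ∉ forestLeaves r) (h2 : l ++ r ≠ []) (hc : delete i c = some c') :
    delete i (node (l ++ c :: r)) = some (node (l ++ c' :: r)) := by
  rw [delete, forestDelete_append, forestDelete_of_not_mem hl hil, forestDelete,
    forestDelete_of_not_mem hr hir, hc, ofChildren_of_two_le]
  have := List.length_pos_iff.2 h2
  simp at this ⊢
  omega

lemma leastFirst_of_forall_lt {a : PlanarTree} {cs : List PlanarTree}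
    (h : ∀ c ∈ cs, minLabel a < minLabel c) : leastFirst (a :: cs) = a :: cs := by
  rw [leastFirst]
  cases hc : leastFirst cs with
  | nil =>
    have := (leastFirst_spec cs).1
    rw [hc] at this
    simp [this.symm.eq_nil]
  | cons d ds =>
    have := (leastFirst_spec cs).1
    rw [hc] at this
    have hd := h d (this.mem_iff.1 (by simp))
    simp [hd]

/-- The two leftmost subtrees have the least smallest labels, in whichever order. -/
def LeastTwoLeft : List PlanarTree → Prop
  | a :: b :: cs => minLabel a ≠ minLabel b ∧
      ∀ c ∈ cs, minLabel a < minLabel c ∧ minLabel b < minLabel c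
  | _ => False

lemma LeastTwoFirst.leastTwoLeft {cs : List PlanarTree} (h : LeastTwoFirst cs) :
    LeastTwoLeft cs := by
  match cs, h with
  | [], h => exact h.elim
  | [_], h => exact h.elim
  | _ :: _ :: _, h => exact ⟨h.1.ne, fun c hc => ⟨h.1.trans (h.2 c hc), h.2 c hc⟩⟩

/-- Sort the two leftmost trees of a list by their least labels. -/
noncomputable def sortTwo : List PlanarTree → List PlanarTree
  | a :: b :: cs => if minLabel a < minLabel b then a :: b :: cs else b :: a :: cs
  | cs => cs

lemma leastTwoFirst_eq_sortTwo {cs : List PlanarTree} (h : LeastTwoLeft cs) :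
    leastTwoFirst cs = sortTwo cs := by
  match cs, h with
  | [], h => exact h.elim
  | [_], h => exact h.elim
  | a :: b :: cs, h =>
    have hb : leastFirst (b :: cs) = b :: cs := leastFirst_of_forall_lt fun c hc => (h.2 c hc).2
    have ha : leastFirst (a :: cs) = a :: cs := leastFirst_of_forall_lt fun c hc => (h.2 c hc).1
    rw [leastTwoFirst, leastFirst, hb]
    dsimp only
    split_ifs with h1
    · simp [hb, sortTwo, h1]
    · simp [ha, sortTwo, h1]

lemma sortTwo_of_leastTwoFirst {cs : List PlanarTree} (h : LeastTwoFirst cs) :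
    sortTwo cs = cs := by
  match cs, h with
  | [], h => exact h.elim
  | [_], h => exact h.elim
  | _ :: _ :: _, h => simp [sortTwo, h.1]

lemma leastTwoFirst_eq_self {cs : List PlanarTree} (h : LeastTwoFirst cs) :
    leastTwoFirst cs = cs := by
  rw [leastTwoFirst_eq_sortTwo h.leastTwoLeft, sortTwo_of_leastTwoFirst h]

mutual
lemma canon_eq_self : ∀ {t : PlanarTree}, SemiPlanar t → canon t = t
  | leaf _, _ => rfl
  | node cs, h => by rw [canon, forestCanon_eq_self h.2, leastTwoFirst_eq_self h.1]
lemma forestCanon_eq_self : ∀ {cs : List PlanarTree}, ForestSemiPlanar cs → forestCanon cs = cs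
  | [], _ => rfl
  | c :: cs, h => by rw [forestCanon, canon_eq_self h.1, forestCanon_eq_self h.2]
end

/-- The order of the two leftmost subtrees of a semi-planar tree carries no information. -/
lemma canon_swap {a b : PlanarTree} {cs : List PlanarTree} (h : SemiPlanar (node (a :: b :: cs))) :
    canon (node (b :: a :: cs)) = node (a :: b :: cs) := by
  obtain ⟨h1, ha, hb, hc⟩ := h
  have h2 : LeastTwoLeft (b :: a :: cs) :=
    ⟨h1.1.ne', fun c hc => ⟨h1.2 c hc, h1.1.trans (h1.2 c hc)⟩⟩
  rw [canon, forestCanon, forestCanon, canon_eq_self ha, canon_eq_self hb, forestCanon_eq_self hc,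
    leastTwoFirst_eq_sortTwo h2, sortTwo, if_neg h1.1.le.not_gt]

lemma minLabel_canon {t : PlanarTree} (h : Branching t) (hn : (leaves t).Nodup) :
    minLabel (canon t) = minLabel t :=
  minLabel_congr fun _ => (canon_spec h hn).2.mem_iff

/-! ### Weighted sums over insertions -/

/-- The weighted sum of the values of `F` over a list of pairs (weight, object).  Applied to
`insertions`, it is the expectation of `F` under the growth rule, up to normalization. -/
noncomputable def wsum {β : Type*} (l : List (ℝ × β)) (F : β → ℝ) : ℝ :=
  (l.map fun p => p.1 * F p.2).sum

section wsum
variable {β δ : Type*}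

@[simp] lemma wsum_nil (F : β → ℝ) : wsum [] F = 0 := rfl

@[simp] lemma wsum_cons (p : ℝ × β) (l : List (ℝ × β)) (F : β → ℝ) :
    wsum (p :: l) F = p.1 * F p.2 + wsum l F := by simp [wsum]

@[simp] lemma wsum_append (l l' : List (ℝ × β)) (F : β → ℝ) :
    wsum (l ++ l') F = wsum l F + wsum l' F := by simp [wsum]

lemma wsum_map (l : List (ℝ × β)) (f : β → δ) (F : δ → ℝ) :
    wsum (l.map fun p => (p.1, f p.2)) F = wsum l fun b => F (f b) := by
  simp [wsum, Function.comp_def]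

lemma wsum_congr {l : List (ℝ × β)} {F G : β → ℝ} (h : ∀ p ∈ l, F p.2 = G p.2) :
    wsum l F = wsum l G := by
  unfold wsum
  congr 1
  exact List.map_congr_left fun p hp => by rw [h p hp]

end wsum

/-- The weight of the insertion into a branch point with `c` children at position `k + 2`. -/
noncomputable def gapWeight (α γ : ℝ) (c k : ℕ) : ℝ := if k + 1 = c - 1 then α - γ else α

lemma wsum_branchInsertions (α γ : ℝ) (j : ℕ) (cs : List PlanarTree) (F : PlanarTree → ℝ) :
    wsum (branchInsertions α γ j cs) F =
      ∑ k ∈ Finset.range (cs.length - 1), gapWeight α γ cs.length k *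
        F (node (cs.insertIdx (k + 2) (leaf j))) := by
  change _ = (Multiset.map _ (List.range (cs.length - 1) : Multiset ℕ)).sum
  rw [Multiset.map_coe, Multiset.sum_coe, wsum, branchInsertions, List.map_map]
  rfl

end PlanarTree

namespace PlanarTree

/-! ### Insertions, relabelling and sorting -/

lemma wsum_insertions_node (α γ : ℝ) (j : ℕ) (cs : List PlanarTree) (F : PlanarTree → ℝ) :
    wsum (insertions α γ j (node cs)) F = γ * F (node [node cs, leaf j]) +
      ∑ k ∈ Finset.range (cs.length - 1), gapWeight α γ cs.length k *
        F (node (cs.insertIdx (k + 2) (leaf j))) +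
      wsum (forestInsertions α γ j cs) fun ds => F (node ds) := by
  rw [insertions, wsum_append, wsum_cons, wsum_branchInsertions, wsum_map]

lemma wsum_forestInsertions_cons (α γ : ℝ) (j : ℕ) (c : PlanarTree) (cs : List PlanarTree)
    (F : List PlanarTree → ℝ) :
    wsum (forestInsertions α γ j (c :: cs)) F =
      wsum (insertions α γ j c) (fun d => F (d :: cs)) +
      wsum (forestInsertions α γ j cs) (fun ds => F (c :: ds)) := by
  rw [forestInsertions, wsum_append, wsum_map _ (fun d => d :: cs), wsum_map]

lemma wsum_forestInsertions_append (α γ : ℝ) (j : ℕ) (l r : List PlanarTree) :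
    ∀ F : List PlanarTree → ℝ, wsum (forestInsertions α γ j (l ++ r)) F =
      wsum (forestInsertions α γ j l) (fun d => F (d ++ r)) +
      wsum (forestInsertions α γ j r) (fun d => F (l ++ d)) := by
  induction l with
  | nil => intro F; simp [forestInsertions]
  | cons c l ih =>
    intro F
    simp only [List.cons_append, wsum_forestInsertions_cons, ih, add_assoc]

lemma wsum_forestInsertions_middle (α γ : ℝ) (j : ℕ) (l r : List PlanarTree) (c : PlanarTree)
    (F : List PlanarTree → ℝ) : wsum (forestInsertions α γ j (l ++ c :: r)) F =
      wsum (insertions α γ j c) (fun d => F (l ++ d :: r)) +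
      (wsum (forestInsertions α γ j l) (fun d => F (d ++ c :: r)) +
      wsum (forestInsertions α γ j r) (fun d => F (l ++ c :: d))) := by
  rw [wsum_forestInsertions_append, wsum_forestInsertions_cons]
  ring

mutual
/-- Relabelling commutes with the insertion of a leaf. -/
lemma wsum_insertions_relabel (α γ : ℝ) (f : ℕ → ℕ) (j : ℕ) : ∀ (t : PlanarTree)
    (F : PlanarTree → ℝ), wsum (insertions α γ (f j) (relabel f t)) F =
      wsum (insertions α γ j t) fun u => F (relabel f u)
  | leaf i, F => by simp [insertions, relabel, forestRelabel]
  | node cs, F => by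
    rw [relabel, wsum_insertions_node, wsum_insertions_node,
      wsum_forestInsertions_relabel α γ f j cs]
    simp only [relabel, forestRelabel, forestRelabel_eq_map, List.map_insertIdx, List.length_map]
lemma wsum_forestInsertions_relabel (α γ : ℝ) (f : ℕ → ℕ) (j : ℕ) : ∀ (cs : List PlanarTree)
    (F : List PlanarTree → ℝ), wsum (forestInsertions α γ (f j) (forestRelabel f cs)) F =
      wsum (forestInsertions α γ j cs) fun ds => F (forestRelabel f ds)
  | [], F => rfl
  | c :: cs, F => by
    rw [forestRelabel, wsum_forestInsertions_cons, wsum_forestInsertions_cons,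
      wsum_insertions_relabel α γ f j c, wsum_forestInsertions_relabel α γ f j cs]
    simp only [forestRelabel]
end

mutual
/-- At every branch point, the two subtrees with the least smallest labels stand leftmost, in
whichever order. -/
def WeakSemiPlanar : PlanarTree → Prop
  | leaf _ => True
  | node cs => LeastTwoLeft cs ∧ ForestWeakSemiPlanar cs
/-- `WeakSemiPlanar` for every tree of a list. -/
def ForestWeakSemiPlanar : List PlanarTree → Prop
  | [] => True
  | c :: cs => WeakSemiPlanar c ∧ ForestWeakSemiPlanar cs
end

lemma forestWeakSemiPlanar_iff {cs : List PlanarTree} :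
    ForestWeakSemiPlanar cs ↔ ∀ c ∈ cs, WeakSemiPlanar c := by
  induction cs with
  | nil => simp [ForestWeakSemiPlanar]
  | cons c cs ih => simp [ForestWeakSemiPlanar, ih]

lemma LeastTwoLeft.two_le {cs : List PlanarTree} (h : LeastTwoLeft cs) : 2 ≤ cs.length := by
  match cs, h with
  | [], h => exact h.elim
  | [_], h => exact h.elim
  | _ :: _ :: _, _ => simp

mutual
lemma WeakSemiPlanar.branching : ∀ {t : PlanarTree}, WeakSemiPlanar t → Branching t
  | leaf _, _ => trivial
  | node _, h => ⟨h.1.two_le, ForestWeakSemiPlanar.branching h.2⟩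
lemma ForestWeakSemiPlanar.branching : ∀ {cs : List PlanarTree},
    ForestWeakSemiPlanar cs → ForestBranching cs
  | [], _ => trivial
  | _ :: _, h => ⟨WeakSemiPlanar.branching h.1, ForestWeakSemiPlanar.branching h.2⟩
end

mutual
lemma SemiPlanar.weak : ∀ {t : PlanarTree}, SemiPlanar t → WeakSemiPlanar t
  | leaf _, _ => trivial
  | node _, h => ⟨h.1.leastTwoLeft, ForestSemiPlanar.weak h.2⟩
lemma ForestSemiPlanar.weak : ∀ {cs : List PlanarTree},
    ForestSemiPlanar cs → ForestWeakSemiPlanar cs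
  | [], _ => trivial
  | _ :: _, h => ⟨SemiPlanar.weak h.1, ForestSemiPlanar.weak h.2⟩
end

/-- `LeastTwoLeft` as a property of the list of the least labels. -/
lemma leastTwoLeft_iff {cs : List PlanarTree} : LeastTwoLeft cs ↔
    ∃ a b ms, cs.map minLabel = a :: b :: ms ∧ a ≠ b ∧ ∀ c ∈ ms, a < c ∧ b < c := by
  match cs with
  | [] => simp [LeastTwoLeft]
  | [_] => simp [LeastTwoLeft]
  | a :: b :: cs =>
    simp only [LeastTwoLeft, List.map_cons, List.cons.injEq]
    constructor
    · rintro ⟨h1, h2⟩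
      exact ⟨_, _, _, ⟨rfl, rfl, rfl⟩, h1, by simpa using h2⟩
    · rintro ⟨_, _, _, ⟨rfl, rfl, rfl⟩, h1, h2⟩
      exact ⟨h1, by simpa using h2⟩

lemma leastTwoLeft_congr {cs ds : List PlanarTree} (h : ds.map minLabel = cs.map minLabel) :
    LeastTwoLeft ds ↔ LeastTwoLeft cs := by
  rw [leastTwoLeft_iff, leastTwoLeft_iff, h]

mutual
lemma insertions_leaves {α γ : ℝ} {j : ℕ} : ∀ {t : PlanarTree}, Branching t →
    ∀ p ∈ insertions α γ j t, (leaves p.2).Perm (j :: leaves t) ∧ Branching p.2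
  | leaf i, _, p, hp => by
    simp only [insertions, List.mem_singleton] at hp
    subst hp
    exact ⟨List.Perm.swap _ _ _, by simp [Branching, ForestBranching]⟩
  | node cs, h, p, hp => by
    simp only [insertions, List.cons_append, List.mem_cons, List.mem_append, List.mem_map] at hp
    rcases hp with rfl | hp | ⟨q, hq, rfl⟩
    · refine ⟨?_, by simp, h, trivial, trivial⟩
      simp only [leaves, forestLeaves, List.append_nil]
      exact List.perm_append_singleton _ _
    · obtain ⟨k, hk, rfl⟩ := List.mem_map.1 hp
      have hk' := List.mem_range.1 hk
      have hperm : (cs.insertIdx (k + 2) (leaf j)).Perm (leaf j :: cs) :=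
        List.perm_insertIdx _ _ (by omega)
      refine ⟨by simpa [leaves, forestLeaves] using forestLeaves_perm hperm, ?_, ?_⟩
      · rw [hperm.length_eq]; have := h.1; simp; omega
      · rw [forestBranching_iff]
        intro c hc
        rcases List.mem_cons.1 (hperm.mem_iff.1 hc) with rfl | hc
        · trivial
        · exact forestBranching_iff.1 h.2 c hc
    · obtain ⟨h1, h2, h3⟩ := forestInsertions_leaves h.2 q hq
      exact ⟨h1, h3 ▸ h.1, h2⟩
lemma forestInsertions_leaves {α γ : ℝ} {j : ℕ} : ∀ {cs : List PlanarTree}, ForestBranching cs →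
    ∀ p ∈ forestInsertions α γ j cs, (forestLeaves p.2).Perm (j :: forestLeaves cs) ∧
      ForestBranching p.2 ∧ p.2.length = cs.length
  | [], _, p, hp => by simp [forestInsertions] at hp
  | c :: cs, h, p, hp => by
    simp only [forestInsertions, List.mem_append, List.mem_map] at hp
    rcases hp with ⟨q, hq, rfl⟩ | ⟨q, hq, rfl⟩
    · obtain ⟨h1, h2⟩ := insertions_leaves h.1 q hq
      refine ⟨by simpa [forestLeaves] using h1.append_right (forestLeaves cs), ⟨h2, h.2⟩, by simp⟩
    · obtain ⟨h1, h2, h3⟩ := forestInsertions_leaves h.2 q hq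
      refine ⟨?_, ⟨h.1, h2⟩, by simp [h3]⟩
      simpa [forestLeaves] using (h1.append_left (leaves c)).trans List.perm_middle
end

/-- An insertion of a largest label into a list of trees does not change their least labels. -/
lemma forestInsertions_minLabel {α γ : ℝ} {j : ℕ} : ∀ {cs : List PlanarTree}, ForestBranching cs →
    (∀ k ∈ forestLeaves cs, k < j) → ∀ p ∈ forestInsertions α γ j cs,
      p.2.map minLabel = cs.map minLabel
  | [], _, _, p, hp => by simp [forestInsertions] at hp
  | c :: cs, h, hj, p, hp => by
    have hc : ∀ i ∈ leaves c, i < j := fun i hi => hj i (by simp [forestLeaves, hi])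
    have hcs : ∀ i ∈ forestLeaves cs, i < j := fun i hi =>
      hj i (by rw [forestLeaves]; exact List.mem_append_right _ hi)
    simp only [forestInsertions, List.mem_append, List.mem_map] at hp
    rcases hp with ⟨q, hq, rfl⟩ | ⟨q, hq, rfl⟩
    · simp [minLabel_insert h.1 hc (insertions_leaves h.1 q hq).1]
    · simp [forestInsertions_minLabel h.2 hcs q hq]

lemma map_minLabel_forestCanon {cs : List PlanarTree} (h : ForestBranching cs)
    (hn : (forestLeaves cs).Nodup) : (forestCanon cs).map minLabel = cs.map minLabel := by
  induction cs with
  | nil => rfl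
  | cons c cs ih =>
    rw [forestLeaves, List.nodup_append] at hn
    simp [forestCanon, minLabel_canon h.1 hn.1, ih h.2 hn.2.1]

lemma canon_node_of_leastTwoLeft {cs : List PlanarTree} (h : ForestBranching cs)
    (hn : (forestLeaves cs).Nodup) (h2 : LeastTwoLeft cs) :
    canon (node cs) = node (sortTwo (forestCanon cs)) := by
  rw [canon, leastTwoFirst_eq_sortTwo
    ((leastTwoLeft_congr (map_minLabel_forestCanon h hn)).2 h2)]

/-- Exchange the two leftmost trees of a list. -/
def swapTwo : List PlanarTree → List PlanarTree
  | a :: b :: cs => b :: a :: cs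
  | cs => cs

/-- As the new label is larger than all the others, the insertion does not change the order of the
least labels of the two leftmost trees. -/
lemma wsum_forestInsertions_sortTwo (α γ : ℝ) {j : ℕ} {cs : List PlanarTree}
    (h : ForestBranching cs) (hj : ∀ k ∈ forestLeaves cs, k < j) (F : List PlanarTree → ℝ) :
    wsum (forestInsertions α γ j (sortTwo cs)) F =
      wsum (forestInsertions α γ j cs) fun ds => F (sortTwo ds) := by
  match cs, h, hj with
  | [], _, _ => rfl
  | [c], _, _ =>
    simp only [sortTwo, wsum_forestInsertions_cons]
    rfl
  | a :: b :: cs, h, hj =>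
    have key : ∀ p ∈ forestInsertions α γ j (a :: b :: cs), sortTwo p.2 =
        if minLabel a < minLabel b then p.2 else swapTwo p.2 := by
      intro p hp
      have := forestInsertions_minLabel h hj p hp
      match hp2 : p.2, this with
      | [], this => simp at this
      | [_], this => simp at this
      | c :: d :: ds, this =>
        simp only [List.map_cons, List.cons.injEq] at this
        simp only [sortTwo, this.1, this.2.1, swapTwo]
    rw [wsum_congr (F := fun e => F (sortTwo e))
      (G := fun e => F (if minLabel a < minLabel b then e else swapTwo e))
      (fun p hp => congrArg F (key p hp)), sortTwo]
    split_ifs with hlt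
    · rfl
    · simp only [wsum_forestInsertions_cons, swapTwo]
      ring

lemma sortTwo_insertIdx {cs : List PlanarTree} (h : 2 ≤ cs.length) (k : ℕ) (x : PlanarTree) :
    sortTwo (cs.insertIdx (k + 2) x) = (sortTwo cs).insertIdx (k + 2) x := by
  match cs, h with
  | a :: b :: cs, _ => simp only [List.insertIdx_succ_cons, sortTwo]; split_ifs <;> rfl

lemma length_sortTwo (cs : List PlanarTree) : (sortTwo cs).length = cs.length := by
  match cs with
  | [] => rfl
  | [_] => rfl
  | a :: b :: cs => simp only [sortTwo]; split_ifs <;> rfl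

mutual
/-- Insertion of a leaf with the largest label commutes with sorting the two leftmost subtrees. -/
lemma wsum_insertions_canon (α γ : ℝ) {j : ℕ} : ∀ {t : PlanarTree}, WeakSemiPlanar t →
    (leaves t).Nodup → (∀ k ∈ leaves t, k < j) → ∀ F : PlanarTree → ℝ,
    wsum (insertions α γ j (canon t)) F = wsum (insertions α γ j t) fun u => F (canon u)
  | leaf i, _, _, hj, F => by
    have : i < j := hj i (by simp [leaves])
    have h2 : SemiPlanar (node [leaf i, leaf j]) :=
      ⟨⟨by simpa [minLabel_leaf] using this, by simp⟩, trivial, trivial, trivial⟩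
    rw [canon_eq_self (t := leaf i) trivial]
    simp only [insertions, wsum_cons, wsum_nil, canon_eq_self h2]
  | node cs, h, hn, hj, F => by
    rw [leaves] at hn hj
    have hb := h.2.branching
    obtain ⟨hs, hp, hl⟩ := forestCanon_spec hb hn
    have hbc := hs.branching
    have h2 : LeastTwoLeft (forestCanon cs) :=
      (leastTwoLeft_congr (map_minLabel_forestCanon hb hn)).2 h.1
    rw [canon_node_of_leastTwoLeft hb hn h.1, wsum_insertions_node, wsum_insertions_node,
      wsum_forestInsertions_sortTwo α γ hbc (fun k hk => hj k (hp.mem_iff.1 hk)),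
      wsum_forestInsertions_canon α γ h.2 hn hj, length_sortTwo, hl]
    have hjn : j ∉ forestLeaves cs := fun hm => (hj j hm).false
    congr 1
    · congr 1
      · congr 2
        have h3 : LeastTwoFirst [canon (node cs), leaf j] := by
          refine ⟨?_, by simp⟩
          rw [minLabel_leaf, minLabel_canon h.branching (by rwa [leaves])]
          exact hj _ (by simpa [leaves] using minLabel_mem h.branching)
        rw [canon, forestCanon, forestCanon, forestCanon, leastTwoFirst_eq_self (by
          simpa [canon] using h3), canon_node_of_leastTwoLeft hb hn h.1]
        simp [canon]
      · refine Finset.sum_congr rfl fun k hk => ?_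
        have hk' := Finset.mem_range.1 hk
        congr 2
        have hperm : (cs.insertIdx (k + 2) (leaf j)).Perm (leaf j :: cs) :=
          List.perm_insertIdx _ _ (by omega)
        have hfl := forestLeaves_perm hperm
        rw [canon_node_of_leastTwoLeft, forestCanon_eq_map (List.insertIdx _ _ _),
          List.map_insertIdx, ← forestCanon_eq_map, sortTwo_insertIdx h2.two_le, canon]
        · rw [forestBranching_iff]
          intro c hc
          rcases List.mem_cons.1 (hperm.mem_iff.1 hc) with rfl | hc
          · trivial
          · exact forestBranching_iff.1 hb c hc
        · rw [hfl.nodup_iff]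
          simpa [forestLeaves, leaves, hn] using hjn
        · match cs, h.1, hj, hb with
          | a :: b :: cs, h1, hj, hb =>
            simp only [List.insertIdx_succ_cons]
            refine ⟨h1.1, fun c hc => ?_⟩
            rcases List.eq_or_mem_of_mem_insertIdx hc with rfl | hc
            · rw [minLabel_leaf]
              exact ⟨hj _ (mem_forestLeaves.2 ⟨a, by simp, minLabel_mem hb.1⟩),
                hj _ (mem_forestLeaves.2 ⟨b, by simp, minLabel_mem hb.2.1⟩)⟩
            · exact h1.2 c hc
    · refine wsum_congr fun p hp => ?_
      obtain ⟨g1, g2, -⟩ := forestInsertions_leaves hb p hp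
      have g3 := forestInsertions_minLabel hb hj p hp
      rw [canon_node_of_leastTwoLeft g2 (g1.nodup_iff.2 (by simpa [hn] using hjn))
        ((leastTwoLeft_congr g3).2 h.1)]
lemma wsum_forestInsertions_canon (α γ : ℝ) {j : ℕ} : ∀ {cs : List PlanarTree},
    ForestWeakSemiPlanar cs →
    (forestLeaves cs).Nodup → (∀ k ∈ forestLeaves cs, k < j) → ∀ F : List PlanarTree → ℝ,
    wsum (forestInsertions α γ j (forestCanon cs)) F =
      wsum (forestInsertions α γ j cs) fun ds => F (forestCanon ds)
  | [], _, _, _, _ => rfl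
  | c :: cs, h, hn, hj, F => by
    simp only [forestLeaves, List.nodup_append] at hn
    simp only [forestLeaves, List.mem_append] at hj
    rw [forestCanon, wsum_forestInsertions_cons, wsum_forestInsertions_cons,
      wsum_insertions_canon α γ h.1 hn.1 (fun k hk => hj k (Or.inl hk)),
      wsum_forestInsertions_canon α γ h.2 hn.2.1 (fun k hk => hj k (Or.inr hk))]
    simp only [forestCanon]
end

end PlanarTree

namespace PlanarTree

/-! ### The local search -/

mutual
lemma spine_eq_none {i : ℕ} : ∀ {t : PlanarTree}, i ∉ leaves t → spine i t = none
  | leaf k, h => by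
    rw [spine, if_neg]
    rintro rfl
    simp [leaves] at h
  | node cs, h => by rw [spine, forestSpine_eq_none _ (by simpa only [leaves] using h)]
lemma forestSpine_eq_none {i : ℕ} : ∀ {cs : List PlanarTree} (left : List PlanarTree),
    i ∉ forestLeaves cs → forestSpine i left cs = none
  | [], _, _ => rfl
  | c :: cs, left, h => by
    simp only [forestLeaves, List.mem_append, not_or] at h
    rw [forestSpine, spine_eq_none h.1]
    exact forestSpine_eq_none _ h.2
end

lemma forestSpine_middle {i : ℕ} {c : PlanarTree} {s : List (List PlanarTree × List PlanarTree)}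
    (hc : spine i c = some s) (r : List PlanarTree) : ∀ (l left : List PlanarTree),
    i ∉ forestLeaves l → forestSpine i left (l ++ c :: r) = some (s ++ [(left ++ l, r)])
  | [], left, _ => by rw [List.nil_append, forestSpine, hc, List.append_nil]
  | d :: l, left, h => by
    simp only [forestLeaves, List.mem_append, not_or] at h
    rw [List.cons_append, forestSpine, spine_eq_none h.1]
    simpa using forestSpine_middle hc r l (left ++ [d]) h.2

lemma spine_node {i : ℕ} {c : PlanarTree} {s : List (List PlanarTree × List PlanarTree)}
    {l : List PlanarTree} (hc : spine i c = some s) (hl : i ∉ forestLeaves l)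
    (r : List PlanarTree) : spine i (node (l ++ c :: r)) = some (s ++ [(l, r)]) := by
  rw [spine, forestSpine_middle hc r l [] hl, List.nil_append]

mutual
lemma exists_spine {i : ℕ} : ∀ {t : PlanarTree}, i ∈ leaves t → ∃ s, spine i t = some s
  | leaf k, h => by
    simp only [leaves, List.mem_singleton] at h
    exact ⟨[], by rw [spine, if_pos h.symm]⟩
  | node cs, h => exists_forestSpine [] (by simpa only [leaves] using h)
lemma exists_forestSpine {i : ℕ} : ∀ {cs : List PlanarTree} (left : List PlanarTree),
    i ∈ forestLeaves cs → ∃ s, forestSpine i left cs = some s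
  | [], _, h => by simp [forestLeaves] at h
  | c :: cs, left, h => by
    simp only [forestLeaves, List.mem_append] at h
    rw [forestSpine]
    by_cases hc : i ∈ leaves c
    · obtain ⟨s, hs⟩ := exists_spine hc
      exact ⟨_, by rw [hs]⟩
    · rw [spine_eq_none hc]
      exact exists_forestSpine _ (h.resolve_left hc)
end

/-- The label found by the local search from leaf `i` with spinal decomposition `s`. -/
noncomputable def searchList (i : ℕ) (s : List (List PlanarTree × List PlanarTree)) : ℕ :=
  max i (max (firstMin s) (secondMin i s))

/-- The label found by the local search from leaf `i` in a tree whose spine `σ` outside of the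
subtree `u` containing `i` is given. -/
noncomputable def localSearch (i : ℕ) (u : PlanarTree)
    (σ : List (List PlanarTree × List PlanarTree)) : ℕ :=
  searchList i ((spine i u).getD [] ++ σ)

lemma search_eq_localSearch {i : ℕ} {t : PlanarTree} (h : i ∈ leaves t) :
    search t i = localSearch i t [] := by
  obtain ⟨s, hs⟩ := exists_spine h
  simp [search, localSearch, searchList, hs]

/-- Beyond the first spinal bush, only the least label of the second one matters. -/
lemma searchList_append_congr (i : ℕ) {s τ τ' : List (List PlanarTree × List PlanarTree)}
    (hs : s ≠ []) (h : firstMin τ = firstMin τ') :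
    searchList i (s ++ τ) = searchList i (s ++ τ') := by
  match s, hs with
  | [p], _ =>
    simp only [searchList, secondMin, List.cons_append, List.nil_append, h]
    rfl
  | p :: q :: s, _ => simp [searchList, firstMin, secondMin]

lemma spine_leaf_self (i : ℕ) : spine i (leaf i) = some [] := by simp [spine]

lemma exists_middle {i : ℕ} : ∀ {cs : List PlanarTree}, i ∈ forestLeaves cs →
    ∃ l c r, cs = l ++ c :: r ∧ i ∈ leaves c ∧ i ∉ forestLeaves l
  | [], h => by simp [forestLeaves] at h
  | c :: cs, h => by
    by_cases hc : i ∈ leaves c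
    · exact ⟨[], c, cs, rfl, hc, by simp [forestLeaves]⟩
    · simp only [forestLeaves, List.mem_append, hc, false_or] at h
      obtain ⟨l, d, r, rfl, hd, hl⟩ := exists_middle h
      exact ⟨c :: l, d, r, rfl, hd, by
        simp only [forestLeaves, List.mem_append, not_or]; exact ⟨hc, hl⟩⟩

lemma spine_ne_nil {i : ℕ} {t : PlanarTree} {s : List (List PlanarTree × List PlanarTree)}
    (hs : spine i t = some s) (ht : t ≠ leaf i) : s ≠ [] := by
  have hm : i ∈ leaves t := by
    by_contra hm
    rw [spine_eq_none hm] at hs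
    cases hs
  cases t with
  | leaf k =>
    simp only [leaves, List.mem_singleton] at hm
    exact absurd (by rw [hm]) ht
  | node cs =>
    obtain ⟨l, c, r, rfl, hc, hl⟩ := exists_middle (by simpa only [leaves] using hm)
    obtain ⟨s', hs'⟩ := exists_spine hc
    rw [spine_node hs' hl] at hs
    simp only [Option.some.injEq] at hs
    simp [← hs]

lemma localSearch_node {i : ℕ} {c : PlanarTree} {l : List PlanarTree} (hc : i ∈ leaves c)
    (hl : i ∉ forestLeaves l) (r : List PlanarTree)
    (σ : List (List PlanarTree × List PlanarTree)) :
    localSearch i (node (l ++ c :: r)) σ = localSearch i c ((l, r) :: σ) := by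
  obtain ⟨s, hs⟩ := exists_spine hc
  simp [localSearch, hs, spine_node hs hl]

/-- If leaf `i` is not itself the top vertex of the subtree, then the search depends on the
surrounding tree only through the least label in the next spinal bush. -/
lemma localSearch_congr {i : ℕ} {c : PlanarTree} (hc : i ∈ leaves c) (hci : c ≠ leaf i)
    {σ σ' : List (List PlanarTree × List PlanarTree)} (h : firstMin σ = firstMin σ') :
    localSearch i c σ = localSearch i c σ' := by
  obtain ⟨s, hs⟩ := exists_spine hc
  simp only [localSearch, hs, Option.getD_some]
  exact searchList_append_congr i (spine_ne_nil hs hci) h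

lemma forestMin_insert {cs ds : List PlanarTree} {j : ℕ} (hb : ForestBranching cs) (hne : cs ≠ [])
    (hj : ∀ k ∈ forestLeaves cs, k < j)
    (h : (forestLeaves ds).Perm (j :: forestLeaves cs)) : forestMin ds = forestMin cs := by
  have h1 : forestMin cs ∈ forestLeaves cs :=
    Nat.sInf_mem (s := {i | i ∈ forestLeaves cs})
      (List.exists_mem_of_ne_nil _ (hb.leaves_ne_nil hne))
  refine le_antisymm (Nat.sInf_le (h.mem_iff.2 (by simp [h1]))) ?_
  have h2 : forestMin ds ∈ forestLeaves ds :=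
    Nat.sInf_mem (s := {i | i ∈ forestLeaves ds}) ⟨j, h.mem_iff.2 (by simp)⟩
  rcases List.mem_cons.1 (h.mem_iff.1 h2) with h3 | h3
  · rw [h3]; exact (hj _ h1).le
  · exact Nat.sInf_le h3

lemma forestMin_singleton (c : PlanarTree) : forestMin [c] = minLabel c := by
  simp [forestMin, minLabel, forestLeaves]

lemma forestMin_cons {c : PlanarTree} {cs : List PlanarTree} (hc : Branching c)
    (h : ∀ d ∈ cs, minLabel c ≤ minLabel d) :
    forestMin (c :: cs) = minLabel c := by
  refine le_antisymm (Nat.sInf_le ?_) (le_csInf ⟨minLabel c, ?_⟩ fun k hk => ?_)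
  · simp [forestLeaves, minLabel_mem hc]
  · simp [forestLeaves, minLabel_mem hc]
  · obtain ⟨d, hd, hkd⟩ := mem_forestLeaves.1 (show k ∈ forestLeaves _ from hk)
    rcases List.mem_cons.1 hd with rfl | hd
    · exact minLabel_le hkd
    · exact (h d hd).trans (minLabel_le hkd)

/-- If the parent of leaf `i` has two children, then `a` is the least label of the sibling of leaf
`i`, and `b` is the least label in the next spinal bush. -/
lemma localSearch_binary {i : ℕ} {l r : List PlanarTree} {A : PlanarTree} (h : l ++ r = [A])
    (hl : i ∉ forestLeaves l) (σ : List (List PlanarTree × List PlanarTree)) :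
    localSearch i (node (l ++ leaf i :: r)) σ = max i (max (minLabel A) (firstMin σ)) := by
  rw [localSearch_node (by simp [leaves]) hl]
  simp [localSearch, spine_leaf_self, searchList, firstMin, secondMin, h, forestMin_singleton]

lemma not_mem_of_nodup_append {l r : List PlanarTree} {c d : PlanarTree} {k : ℕ}
    (hn : (forestLeaves (l ++ r)).Nodup) (hc : c ∈ l) (hd : d ∈ r) (hk : k ∈ leaves c) :
    k ∉ leaves d := fun hk' => by
  rw [forestLeaves_append, List.nodup_append] at hn
  exact hn.2.2 k (mem_forestLeaves.2 ⟨c, hc, hk⟩) k (mem_forestLeaves.2 ⟨d, hd, hk'⟩) rfl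

/-- If the parent of leaf `i` has at least three children, then `a` is the least label of the
first one of the other subtrees, and `b` that of the third subtree, if leaf `i` is one of the two
leftmost, or of the subtree to the left of leaf `i`, otherwise. -/
lemma localSearch_nonbinary {i : ℕ} {l r : List PlanarTree}
    (hs : SemiPlanar (node (l ++ leaf i :: r))) (hn : (forestLeaves (l ++ leaf i :: r)).Nodup)
    (h2 : 2 ≤ (l ++ r).length) (σ : List (List PlanarTree × List PlanarTree)) :
    localSearch i (node (l ++ leaf i :: r)) σ =
      max i (max (((l ++ r).map minLabel).getD 0 0)
        (((l ++ r).map minLabel).getD (max l.length 2 - 1) 0)) := by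
  have hl : i ∉ forestLeaves l := fun hm => by
    obtain ⟨c, hc, hi⟩ := mem_forestLeaves.1 hm
    exact not_mem_of_nodup_append hn hc (List.mem_cons_self (a := leaf i)) hi (by simp [leaves])
  obtain ⟨hs1, hs2⟩ := hs
  have hb := hs2.branching
  rw [localSearch_node (by simp [leaves]) hl]
  simp only [localSearch, spine_leaf_self, Option.getD_some, List.nil_append, searchList,
    firstMin, secondMin]
  rw [if_neg (by omega)]
  match l, hs1 with
  | [], hs1 =>
    match r, hs1, h2 with
    | A :: B :: r, hs1, h2 =>
      simp only [List.nil_append] at *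
      have hAB : ∀ d ∈ B :: r, minLabel A < minLabel d := hs1.2
      have ha : forestMin (A :: B :: r) = minLabel A :=
        forestMin_cons hb.2.1 fun d hd => (hAB d hd).le
      have hf : (A :: B :: r).filter (fun c => decide (minLabel c < i)) = [] := by
        rw [List.filter_eq_nil_iff]
        intro c hc
        have h3 := hs1.1
        rw [minLabel_leaf] at h3
        rcases List.mem_cons.1 hc with rfl | hc
        · simpa using h3.le
        · have := hAB c hc
          simp; omega
      simp only [ha, hf]
      rw [if_pos (by simp)]
      have hAB' : minLabel A ∉ leaves B :=
        not_mem_of_nodup_append (l := [leaf i, A]) (r := B :: r) hn (by simp) (by simp)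
          (minLabel_mem hb.2.1)
      rw [List.find?_cons_of_neg (by simp [minLabel_mem hb.2.1]),
        List.find?_cons_of_pos (by simpa using hAB')]
      simp
  | [A], hs1 =>
    match r, hs1, h2 with
    | B :: r, hs1, h2 =>
      simp only [List.singleton_append] at *
      have h3 := hs1.1
      have h4 := hs1.2
      rw [minLabel_leaf] at h3 h4
      have ha : forestMin (A :: B :: r) = minLabel A :=
        forestMin_cons hb.1 fun d hd => (h3.trans (h4 d hd)).le
      have hf : (A :: B :: r).filter (fun c => decide (minLabel c < i)) = [A] := by
        rw [List.filter_cons_of_pos (by simpa using h3)]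
        congr 1
        rw [List.filter_eq_nil_iff]
        intro c hc
        simpa using (h4 c hc).le
      simp only [ha, hf]
      rw [if_pos (by simp)]
      have hAB' : minLabel A ∉ leaves B :=
        not_mem_of_nodup_append (l := [A, leaf i]) (r := B :: r) hn (by simp) (by simp)
          (minLabel_mem hb.1)
      rw [List.find?_cons_of_pos (by simpa using hAB')]
      simp
  | A :: B :: l, hs1 =>
    have h3 := hs1.1
    have h4 := hs1.2
    have hi : minLabel B < i := by simpa [minLabel_leaf] using h4 (leaf i) (by simp)
    simp only [List.cons_append] at *
    have ha : forestMin (A :: B :: (l ++ r)) = minLabel A := by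
      refine forestMin_cons hb.1 fun d hd => ?_
      rcases List.mem_cons.1 hd with rfl | hd
      · exact h3.le
      · exact (h3.trans (h4 d (by simp at hd ⊢; tauto))).le
    simp only [ha]
    rw [if_neg (by simp [hi, h3.trans hi])]
    obtain ⟨l', d, hd⟩ : ∃ l' d, B :: l = l' ++ [d] :=
      (List.eq_nil_or_concat' (B :: l)).resolve_left (by simp)
    have hd' : minLabel A ∉ leaves d := by
      refine not_mem_of_nodup_append (l := [A]) (r := B :: (l ++ leaf i :: r)) hn (by simp) ?_
        (minLabel_mem hb.1)
      rw [← List.cons_append, hd]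
      simp
    have hlen : l.length = l'.length := by
      have := congrArg List.length hd
      simpa using this
    have hget : ((A :: B :: (l ++ r)).map minLabel).getD (max (A :: B :: l).length 2 - 1) 0 =
        minLabel d := by
      have : max (A :: B :: l).length 2 - 1 = l'.length + 1 := by simp [hlen]
      rw [this, ← List.cons_append, hd]
      simp [List.getD]
    rw [hget, hd, List.reverse_cons, List.reverse_append, List.reverse_singleton]
    simp only [List.cons_append]
    rw [List.find?_cons_of_pos (by simpa using hd')]
    simp

end PlanarTree

namespace PlanarTree

/-! ### Insertion and local search along the ancestral line -/

/-- The effect on the labels other than `i` of swapping `i` and `m` and closing the gap that the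
deletion of label `m` leaves. -/
def shift (i m k : ℕ) : ℕ :=
  if m < Equiv.swap i m k then Equiv.swap i m k - 1 else Equiv.swap i m k

lemma shift_of_lt {i j k : ℕ} (h : k < j) (hi : k ≠ i) : shift i j k = k := by
  rw [shift, Equiv.swap_apply_of_ne_of_ne hi h.ne, if_neg h.le.not_gt]

lemma shift_self {i j : ℕ} (h : i < j) : shift i j j = i := by
  rw [shift, Equiv.swap_apply_right, if_neg h.le.not_gt]

/-- The down-step from leaf `i` with found label `m`, written as the deletion of leaf `i` followed
by the passage of the label `i` to the former leaf `m`. -/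
noncomputable def pruned (i m : ℕ) (u : PlanarTree) : PlanarTree :=
  canon (relabel (shift i m) ((delete i u).getD (leaf 1)))

lemma swapDelete_eq_pruned {t u : PlanarTree} {i : ℕ} (m : ℕ) (h : delete i t = some u) :
    swapDelete t i m = pruned i m t := by
  have h1 : delete m (swapLabels i m t) = some (relabel (Equiv.swap i m) u) := by
    have h2 := delete_relabel (Equiv.swap i m).injective i t
    rw [Equiv.swap_apply_left, h] at h2
    exact h2
  rw [swapDelete, h1, pruned, h, Option.getD_some, Option.getD_some, relabel_relabel]
  rfl

lemma two_le_length_leaves {cs : List PlanarTree} (h : Branching (node cs)) :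
    2 ≤ (forestLeaves cs).length := by
  match cs, h with
  | [], h => simp [Branching] at h
  | [c], h => simp [Branching] at h
  | c :: d :: cs, h =>
    have h1 := List.length_pos_iff.2 h.2.1.leaves_ne_nil
    have h2 := List.length_pos_iff.2 h.2.2.1.leaves_ne_nil
    simp only [forestLeaves, List.length_append]
    omega

lemma exists_delete {i : ℕ} {t : PlanarTree} (h : Branching t) (hn : (leaves t).Nodup)
    (ht : t ≠ leaf i) : ∃ u, delete i t = some u := by
  cases hd : delete i t with
  | some u => exact ⟨u, rfl⟩
  | none =>
    exfalso
    have h1 := (delete_spec i h).1 hd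
    cases t with
    | leaf k =>
      have : k ≠ i := fun e => ht (by rw [e])
      simp [leaves, this] at h1
    | node cs =>
      have h2 := two_le_length_leaves h
      rw [leaves] at h1 hn
      have h3 : ∀ k ∈ forestLeaves cs, k = i := by
        intro k hk
        by_contra hne
        have : k ∈ (forestLeaves cs).filter (· ≠ i) := by simp [hk, hne]
        rw [h1] at this
        simp at this
      have h4 := List.eq_replicate_of_mem h3
      rw [h4] at hn
      have := List.nodup_replicate.1 hn
      omega

lemma insertIdx_append_left {β : Type*} (y : β) (r : List β) : ∀ {l : List β} {q : ℕ},
    q ≤ l.length → (l ++ r).insertIdx q y = l.insertIdx q y ++ r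
  | _, 0, _ => rfl
  | [], _ + 1, h => by simp at h
  | a :: l, q + 1, h => by
    simp only [List.cons_append, List.insertIdx_succ_cons]
    rw [insertIdx_append_left y r (by simpa using h)]

lemma insertIdx_append_right {β : Type*} (y : β) (r : List β) (q : ℕ) : ∀ l : List β,
    (l ++ r).insertIdx (l.length + q) y = l ++ r.insertIdx q y
  | [] => by simp
  | a :: l => by
    rw [List.length_cons, add_right_comm, List.cons_append, List.insertIdx_succ_cons,
      insertIdx_append_right y r q l, List.cons_append]

lemma exists_insertIdx_middle {β : Type*} (l r : List β) (y : β) {q : ℕ}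
    (hq : q ≤ l.length + r.length + 1) :
    ∃ l' r', (∀ d, (l ++ d :: r).insertIdx q y = l' ++ d :: r') ∧
      (l' ++ r').Perm (y :: (l ++ r)) := by
  by_cases h : q ≤ l.length
  · exact ⟨l.insertIdx q y, r, fun d => insertIdx_append_left y (d :: r) h,
      (List.perm_insertIdx _ _ h).append_right r⟩
  · obtain ⟨p, rfl⟩ : ∃ p, q = l.length + (p + 1) := ⟨q - l.length - 1, by omega⟩
    refine ⟨l, r.insertIdx p y, fun d => ?_, ?_⟩
    · rw [insertIdx_append_right, List.insertIdx_succ_cons]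
    · exact ((List.perm_insertIdx _ _ (by omega)).append_left l).trans List.perm_middle

/-- The identity behind the down-step, for a tree `x` containing leaf `i`, in a surrounding tree
with spine `σ`: of the insertions of leaf `j` into `x`, those found by the local search have total
weight `1`, and the down-step undoes them; the other ones do not change the label found, and
correspond to the insertions into the tree after the down-step. -/
def KeyIdentity (α γ : ℝ) (i j : ℕ) (x : PlanarTree)
    (σ : List (List PlanarTree × List PlanarTree)) : Prop :=
  ∀ x', delete i x = some x' → ∀ F : ℕ → PlanarTree → ℝ,
    wsum (insertions α γ j x)
        (fun u => F (localSearch i u σ) (pruned i (localSearch i u σ) u)) =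
      F j x + wsum (insertions α γ j x') (fun u => F (localSearch i x σ)
        (canon (relabel (shift i (localSearch i x σ)) u)))

lemma pruned_node {i m : ℕ} {l r : List PlanarTree} {c c' : PlanarTree}
    (hl : ForestBranching l) (hr : ForestBranching r) (hil : i ∉ forestLeaves l)
    (hir : i ∉ forestLeaves r) (h2 : l ++ r ≠ []) (hc : delete i c = some c') :
    pruned i m (node (l ++ c :: r)) = canon (relabel (shift i m) (node (l ++ c' :: r))) := by
  rw [pruned, delete_node_cons hl hr hil hir h2 hc, Option.getD_some]

/-- `KeyIdentity` passes from a subtree `c`, in which leaf `i` is not the top vertex, to the branch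
point below it: all insertions outside of `c` leave the spinal decomposition inside `c`, and the
least label in the next spinal bush, unchanged. -/
lemma key_step {α γ : ℝ} {i j : ℕ} {l r : List PlanarTree} {c : PlanarTree}
    (σ : List (List PlanarTree × List PlanarTree)) (hs : SemiPlanar (node (l ++ c :: r)))
    (hn : (forestLeaves (l ++ c :: r)).Nodup) (hj : ∀ k ∈ forestLeaves (l ++ c :: r), k < j)
    (hic : i ∈ leaves c) (hc : c ≠ leaf i) (ih : KeyIdentity α γ i j c ((l, r) :: σ)) :
    KeyIdentity α γ i j (node (l ++ c :: r)) σ := by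
  intro x' hx' F
  have hbs := hs.2.branching
  obtain ⟨hbl, hbc, hbr⟩ : ForestBranching l ∧ Branching c ∧ ForestBranching r := by
    rw [forestBranching_append] at hbs
    exact ⟨hbs.1, hbs.2⟩
  have hne : l ++ r ≠ [] := by
    have := hs.1.two_le
    rw [← List.length_pos_iff]
    simp at this ⊢
    omega
  simp only [forestLeaves_append, forestLeaves, List.mem_append] at hj
  have hn' := hn
  simp only [forestLeaves_append, forestLeaves, List.nodup_append, List.mem_append] at hn'
  obtain ⟨-, ⟨hnc, -, hn2⟩, hn1⟩ := hn'
  have hil : i ∉ forestLeaves l := fun h => hn1 i h i (Or.inl hic) rfl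
  have hir : i ∉ forestLeaves r := fun h => hn2 i hic i h rfl
  have hij : i < j := hj i (Or.inr (Or.inl hic))
  obtain ⟨c', hc'⟩ := exists_delete hbc hnc hc
  obtain rfl : node (l ++ c' :: r) = x' := by
    rw [delete_node_cons hbl hbr hil hir hne hc'] at hx'
    exact Option.some.inj hx'
  -- changing the context by the insertion does not change the label found
  have hctx : ∀ l' r' : List PlanarTree, ForestBranching l' → ForestBranching r' →
      (forestLeaves (l' ++ r')).Perm (j :: forestLeaves (l ++ r)) →
      localSearch i (node (l' ++ c :: r')) σ = localSearch i (node (l ++ c :: r)) σ ∧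
      ∀ m, pruned i m (node (l' ++ c :: r')) =
        canon (relabel (shift i m) (node (l' ++ c' :: r'))) := by
    intro l' r' hl' hr' hp
    have hm : i ∉ forestLeaves (l' ++ r') := by
      rw [hp.mem_iff]
      simp [-mem_forestLeaves, forestLeaves_append, hil, hir, hij.ne]
    simp only [forestLeaves_append, List.mem_append, not_or] at hm
    refine ⟨?_, fun m => pruned_node hl' hr' hm.1 hm.2 ?_ hc'⟩
    · rw [localSearch_node hic hm.1, localSearch_node hic hil]
      refine localSearch_congr hic hc (forestMin_insert (j := j) ?_ hne ?_ hp)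
      · exact forestBranching_append.2 ⟨hbl, hbr⟩
      · intro k hk
        rw [forestLeaves_append, List.mem_append] at hk
        exact hj k (by tauto)
    · rintro h
      rw [h] at hp
      simpa [forestLeaves] using hp.length_eq
  rw [wsum_insertions_node, wsum_insertions_node, wsum_forestInsertions_middle,
    wsum_forestInsertions_middle]
  set m := localSearch i (node (l ++ c :: r)) σ with hm
  have hmc : m = localSearch i c ((l, r) :: σ) := localSearch_node hic hil r σ
  have hlen : (l ++ c' :: r).length = (l ++ c :: r).length := by simp
  have h1 : localSearch i (node [node (l ++ c :: r), leaf j]) σ = m := by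
    rw [show [node (l ++ c :: r), leaf j] = [] ++ node (l ++ c :: r) :: [leaf j] from rfl,
      localSearch_node (by simp [-mem_forestLeaves, leaves, forestLeaves_append, forestLeaves, hic])
        (by simp [forestLeaves]), localSearch_node hic hil, hmc]
    exact localSearch_congr hic hc rfl
  have h1' : pruned i m (node [node (l ++ c :: r), leaf j]) =
      canon (relabel (shift i m) (node [node (l ++ c' :: r), leaf j])) :=
    pruned_node (l := []) (r := [leaf j]) trivial ⟨trivial, trivial⟩ (by simp [forestLeaves])
      (by simp [forestLeaves, leaves, hij.ne]) (by simp) hx'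
  have h2 : ∀ k ∈ Finset.range ((l ++ c :: r).length - 1),
      localSearch i (node ((l ++ c :: r).insertIdx (k + 2) (leaf j))) σ = m ∧
      pruned i m (node ((l ++ c :: r).insertIdx (k + 2) (leaf j))) =
        canon (relabel (shift i m) (node ((l ++ c' :: r).insertIdx (k + 2) (leaf j)))) := by
    intro k hk
    have hk' := Finset.mem_range.1 hk
    simp only [List.length_append, List.length_cons] at hk'
    obtain ⟨l', r', h3, h4⟩ := exists_insertIdx_middle l r (leaf j) (q := k + 2) (by omega)
    rw [h3, h3]
    have h5 : ForestBranching (l' ++ r') := by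
      rw [forestBranching_iff]
      intro d hd
      rcases List.mem_cons.1 (h4.mem_iff.1 hd) with rfl | hd
      · trivial
      · exact forestBranching_iff.1 (forestBranching_append.2 ⟨hbl, hbr⟩) d hd
    rw [forestBranching_append] at h5
    obtain ⟨h6, h7⟩ := hctx l' r' h5.1 h5.2 (forestLeaves_perm h4)
    exact ⟨h6, h7 m⟩
  have h3 : wsum (forestInsertions α γ j l) (fun d =>
      F (localSearch i (node (d ++ c :: r)) σ)
        (pruned i (localSearch i (node (d ++ c :: r)) σ) (node (d ++ c :: r)))) =
      wsum (forestInsertions α γ j l) (fun d =>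
        F m (canon (relabel (shift i m) (node (d ++ c' :: r))))) := by
    refine wsum_congr fun p hp => ?_
    obtain ⟨g1, g2, -⟩ := forestInsertions_leaves hbl p hp
    obtain ⟨g3, g4⟩ := hctx p.2 r g2 hbr (by
      simpa [forestLeaves_append] using g1.append_right (forestLeaves r))
    rw [g3, g4]
  have h4 : wsum (forestInsertions α γ j r) (fun d =>
      F (localSearch i (node (l ++ c :: d)) σ)
        (pruned i (localSearch i (node (l ++ c :: d)) σ) (node (l ++ c :: d)))) =
      wsum (forestInsertions α γ j r) (fun d =>
        F m (canon (relabel (shift i m) (node (l ++ c' :: d))))) := by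
    refine wsum_congr fun p hp => ?_
    obtain ⟨g1, g2, -⟩ := forestInsertions_leaves hbr p hp
    obtain ⟨g3, g4⟩ := hctx l p.2 hbl g2 (by
      simpa [forestLeaves_append] using (g1.append_left (forestLeaves l)).trans List.perm_middle)
    rw [g3, g4]
  -- the insertions into `c` itself
  -- to which the identity for `c` applies, with `F` composed with the formation of the branch point
  set G : ℕ → PlanarTree → ℝ := fun m y => F m (node (leastTwoFirst
    (forestCanon (forestRelabel (shift i m) l) ++ y :: forestCanon (forestRelabel (shift i m) r))))
    with hG
  have hGc : ∀ m u, G m (canon (relabel (shift i m) u)) =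
      F m (canon (relabel (shift i m) (node (l ++ u :: r)))) := by
    intro m u
    simp [hG, relabel, canon, forestCanon_eq_map, forestRelabel_eq_map]
  have h5 : wsum (insertions α γ j c) (fun u =>
      F (localSearch i (node (l ++ u :: r)) σ)
        (pruned i (localSearch i (node (l ++ u :: r)) σ) (node (l ++ u :: r)))) =
      F j (node (l ++ c :: r)) + wsum (insertions α γ j c') (fun u =>
        F m (canon (relabel (shift i m) (node (l ++ u :: r))))) := by
    have h6 := ih c' hc' G
    have h7 : G j c = F j (node (l ++ c :: r)) := by
      have h8 : ∀ k ∈ forestLeaves l, shift i j k = k := fun k hk =>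
        shift_of_lt (hj k (Or.inl hk)) (fun e => hil (e ▸ hk))
      have h9 : ∀ k ∈ forestLeaves r, shift i j k = k := fun k hk =>
        shift_of_lt (hj k (Or.inr (Or.inr hk))) (fun e => hir (e ▸ hk))
      have hs2 := forestSemiPlanar_append.1 hs.2
      simp only [hG]
      rw [forestRelabel_eq_self h8, forestRelabel_eq_self h9, forestCanon_eq_self hs2.1,
        forestCanon_eq_self hs2.2.2, leastTwoFirst_eq_self hs.1]
    rw [h7, ← hmc] at h6
    simp only [hGc] at h6
    rw [← h6]
    refine wsum_congr fun p hp => ?_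
    obtain ⟨g1, g2⟩ := insertions_leaves hbc p hp
    have g3 : i ∈ leaves p.2 := g1.mem_iff.2 (by simp [hic])
    have hjc : j ∉ leaves c := fun h => (hj j (Or.inr (Or.inl h))).false
    have g4 : (leaves p.2).Nodup := g1.nodup_iff.2 (by simp [hnc, hjc])
    have g5 : p.2 ≠ leaf i := by
      intro e
      have := g1.length_eq
      rw [e] at this
      simp [leaves] at this
      exact hbc.leaves_ne_nil this
    obtain ⟨u', hu'⟩ := exists_delete g2 g4 g5
    rw [localSearch_node g3 hil, pruned_node hbl hbr hil hir hne hu', ← hGc, pruned, hu',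
      Option.getD_some]
  have h6 : ∑ k ∈ Finset.range ((l ++ c :: r).length - 1), gapWeight α γ (l ++ c :: r).length k *
      F (localSearch i (node ((l ++ c :: r).insertIdx (k + 2) (leaf j))) σ)
        (pruned i (localSearch i (node ((l ++ c :: r).insertIdx (k + 2) (leaf j))) σ)
          (node ((l ++ c :: r).insertIdx (k + 2) (leaf j)))) =
      ∑ k ∈ Finset.range ((l ++ c :: r).length - 1), gapWeight α γ (l ++ c :: r).length k *
        F m (canon (relabel (shift i m) (node ((l ++ c' :: r).insertIdx (k + 2) (leaf j))))) :=
    Finset.sum_congr rfl fun k hk => by rw [(h2 k hk).1, (h2 k hk).2]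
  rw [h1, h1', h3, h4, h5, h6, hlen]
  ring

end PlanarTree

namespace PlanarTree

/-! ### Insertion and local search at the parent of the leaf -/

lemma getD_map_insertIdx_of_lt {l : List PlanarTree} {q p : ℕ} (y : PlanarTree) (h : p < q) :
    ((l.insertIdx q y).map minLabel).getD p 0 = (l.map minLabel).getD p 0 := by
  rw [List.map_insertIdx, List.getD_eq_getElem?_getD, List.getElem?_insertIdx_of_lt h,
    List.getD_eq_getElem?_getD]

lemma getD_map_insertIdx_of_gt {l : List PlanarTree} {q p : ℕ} (y : PlanarTree) (h : q < p) :
    ((l.insertIdx q y).map minLabel).getD p 0 = (l.map minLabel).getD (p - 1) 0 := by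
  rw [List.map_insertIdx, List.getD_eq_getElem?_getD, List.getElem?_insertIdx_of_gt h,
    List.getD_eq_getElem?_getD]

lemma getD_map_minLabel_lt {cs : List PlanarTree} {j : ℕ} (hb : ForestBranching cs) (h0 : 0 < j)
    (hj : ∀ k ∈ forestLeaves cs, k < j) (p : ℕ) : (cs.map minLabel).getD p 0 < j := by
  by_cases hp : p < cs.length
  · rw [List.getD_eq_getElem _ _ (by simpa using hp), List.getElem_map]
    exact hj _ (mem_forestLeaves.2 ⟨_, List.getElem_mem hp,
      minLabel_mem (forestBranching_iff.1 hb _ (List.getElem_mem hp))⟩)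
  · rw [List.getD_eq_default _ _ (by simpa using hp)]
    exact h0

/-- A sum over a range, with one index singled out. -/
lemma sum_range_single_out (f : ℕ → ℝ) {s L : ℕ} (h : s < L) :
    ∑ k ∈ Finset.range L, f k = f s +
      ∑ k ∈ Finset.range (L - 1), f (if k < s then k else k + 1) := by
  obtain ⟨d, rfl⟩ : ∃ d, L = s + (1 + d) := ⟨L - s - 1, by omega⟩
  rw [show s + (1 + d) - 1 = s + d by omega, Finset.sum_range_add, Finset.sum_range_add,
    Finset.sum_range_add]
  have h1 : ∑ x ∈ Finset.range s, f (if x < s then x else x + 1) = ∑ x ∈ Finset.range s, f x :=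
    Finset.sum_congr rfl fun x hx => by rw [if_pos (Finset.mem_range.1 hx)]
  have h2 : ∑ x ∈ Finset.range d, f (if s + x < s then s + x else s + x + 1) =
      ∑ x ∈ Finset.range d, f (s + (1 + x)) :=
    Finset.sum_congr rfl fun x _ => by
      rw [if_neg (by omega), add_assoc, add_comm x 1]
  rw [h1, h2]
  simp
  ring

lemma pruned_node_leaf {i m : ℕ} {l r : List PlanarTree}
    (hl : ForestBranching l) (hr : ForestBranching r) (hil : i ∉ forestLeaves l)
    (hir : i ∉ forestLeaves r) (h2 : 2 ≤ (l ++ r).length) :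
    pruned i m (node (l ++ leaf i :: r)) = canon (relabel (shift i m) (node (l ++ r))) := by
  rw [pruned, delete_node_leaf hl hr hil hir, ofChildren_of_two_le h2, Option.getD_some]

lemma delete_cherry {i j : ℕ} (h : i ≠ j) :
    delete i (node [leaf i, leaf j]) = some (leaf j) := by
  simp [delete, forestDelete, ofChildren, h.symm]

lemma localSearch_cherry {i j : ℕ} (hij : i < j) {σ : List (List PlanarTree × List PlanarTree)}
    (hσ : firstMin σ < j) : localSearch i (node [leaf i, leaf j]) σ = j := by
  have := localSearch_binary (i := i) (l := []) (r := [leaf j]) rfl (by simp [forestLeaves]) σ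
  rw [List.nil_append, minLabel_leaf] at this
  rw [this]
  omega

lemma forestRelabel_middle (f : ℕ → ℕ) (l r : List PlanarTree) (c : PlanarTree) :
    forestRelabel f (l ++ c :: r) = forestRelabel f l ++ relabel f c :: forestRelabel f r := by
  simp [forestRelabel_eq_map]

lemma forestMin_lt {cs : List PlanarTree} {j : ℕ} (h0 : 0 < j)
    (hj : ∀ k ∈ forestLeaves cs, k < j) : forestMin cs < j := by
  rcases forestMin_mem cs with h | h
  · rwa [h]
  · exact hj _ h

/-- `KeyIdentity` at a parent of leaf `i` with at least three children.  The search finds the new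
leaf if it is inserted into the edge below leaf `i`, of weight `1 - α`, or into one particular gap,
of weight `α`. -/
lemma key_nonbinary {α γ : ℝ} {i j : ℕ} {l r : List PlanarTree}
    (σ : List (List PlanarTree × List PlanarTree)) (hs : SemiPlanar (node (l ++ leaf i :: r)))
    (hn : (forestLeaves (l ++ leaf i :: r)).Nodup)
    (hj : ∀ k ∈ forestLeaves (l ++ leaf i :: r), k < j) (h2 : 2 ≤ (l ++ r).length) :
    KeyIdentity α γ i j (node (l ++ leaf i :: r)) σ := by
  intro x' hx' F
  have hbs := hs.2.branching
  obtain ⟨hbl, -, hbr⟩ : ForestBranching l ∧ Branching (leaf i) ∧ ForestBranching r := by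
    rw [forestBranching_append] at hbs
    exact ⟨hbs.1, hbs.2⟩
  have hj0 := hj
  simp only [forestLeaves_append, forestLeaves, leaves, List.mem_append,
    List.mem_singleton] at hj
  have hn' := hn
  simp only [forestLeaves_append, forestLeaves, leaves, List.nodup_append, List.mem_append,
    List.mem_singleton] at hn'
  obtain ⟨-, ⟨-, -, hn2⟩, hn1⟩ := hn'
  have hil : i ∉ forestLeaves l := fun h => hn1 i h i (Or.inl rfl) rfl
  have hir : i ∉ forestLeaves r := fun h => hn2 i rfl i h rfl
  have hij : i < j := hj i (Or.inr (Or.inl rfl))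
  have hj0' : 0 < j := by omega
  have hjn : j ∉ forestLeaves (l ++ leaf i :: r) := fun h => (hj0 j h).false
  have hblr : ForestBranching (l ++ r) := forestBranching_append.2 ⟨hbl, hbr⟩
  have hjlr : ∀ k ∈ forestLeaves (l ++ r), k < j := by
    intro k hk
    rw [forestLeaves_append, List.mem_append] at hk
    exact hj k (by tauto)
  have hlen : (l ++ leaf i :: r).length = (l ++ r).length + 1 := by simp; omega
  obtain rfl : node (l ++ r) = x' := by
    rw [delete_node_leaf hbl hbr hil hir, ofChildren_of_two_le h2] at hx'
    exact Option.some.inj hx'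
  have hsearch := localSearch_nonbinary hs hn h2 σ
  set m := localSearch i (node (l ++ leaf i :: r)) σ with hm
  have hfixl : forestRelabel (shift i j) l = l := forestRelabel_eq_self fun k hk =>
    shift_of_lt (hj k (Or.inl hk)) (fun e => hil (e ▸ hk))
  have hfixr : forestRelabel (shift i j) r = r := forestRelabel_eq_self fun k hk =>
    shift_of_lt (hj k (Or.inr (Or.inr hk))) (fun e => hir (e ▸ hk))
  have hfixj : relabel (shift i j) (leaf j) = leaf i := by rw [relabel, shift_self hij]
  -- the local search and the down-step after the insertion of `j` as a child of the branch point
  have hins : ∀ l' r' : List PlanarTree, (l' ++ r').Perm (leaf j :: (l ++ r)) →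
      SemiPlanar (node (l' ++ leaf i :: r')) →
      localSearch i (node (l' ++ leaf i :: r')) σ =
        max i (max (((l' ++ r').map minLabel).getD 0 0)
          (((l' ++ r').map minLabel).getD (max l'.length 2 - 1) 0)) ∧
      ∀ m, pruned i m (node (l' ++ leaf i :: r')) =
        canon (relabel (shift i m) (node (l' ++ r'))) := by
    intro l' r' hp hs'
    have hp2 : (forestLeaves (l' ++ r')).Perm (j :: forestLeaves (l ++ r)) := forestLeaves_perm hp
    have hi' : i ∉ forestLeaves (l' ++ r') := by
      rw [hp2.mem_iff]
      simp [-mem_forestLeaves, forestLeaves_append, hil, hir, hij.ne]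
    have hp3 : (l' ++ leaf i :: r').Perm (leaf j :: (l ++ leaf i :: r)) :=
      List.perm_middle.trans ((hp.cons _).trans
        ((List.Perm.swap _ _ _).trans (List.perm_middle.symm.cons _)))
    have hn' : (forestLeaves (l' ++ leaf i :: r')).Nodup := by
      rw [(forestLeaves_perm hp3).nodup_iff]
      simpa [-mem_forestLeaves, forestLeaves, leaves, hn] using hjn
    have hb' := hs'.2.branching
    rw [forestBranching_append] at hb'
    have h2' : 2 ≤ (l' ++ r').length := by rw [hp.length_eq]; simp at h2 ⊢; omega
    rw [forestLeaves_append, List.mem_append, not_or] at hi'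
    exact ⟨localSearch_nonbinary hs' hn' h2' σ,
      fun m => pruned_node_leaf hb'.1 hb'.2.2 hi'.1 hi'.2 h2'⟩
  have hspec : ∀ k ∈ Finset.range (l ++ r).length,
      SemiPlanar (node ((l ++ leaf i :: r).insertIdx (k + 2) (leaf j))) := by
    intro k hk
    refine (branchInsertions_spec (α := 0) (γ := 0) (j := j) (p := (_, _)) hs hj0
      (List.mem_map.2 ⟨k, ?_, rfl⟩)).1
    rw [List.mem_range, hlen]
    simpa using hk
  set s := max l.length 2 - 2 with hsdef
  have hsL : s + 2 ≤ (l ++ r).length := by simp at h2 ⊢; omega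
  have hsl : s < (l ++ r).length := by omega
  -- the only gap where the new leaf is found: to the left of the third subtree if leaf `i` is one
  -- of the two leftmost children, and immediately to the left of leaf `i` otherwise
  have hB1 : localSearch i (node ((l ++ leaf i :: r).insertIdx (s + 2) (leaf j))) σ = j ∧
      pruned i j (node ((l ++ leaf i :: r).insertIdx (s + 2) (leaf j))) =
        node (l ++ leaf i :: r) := by
    have hsp := hspec s (Finset.mem_range.2 hsl)
    have hlt : ∀ p, ((l ++ r).map minLabel).getD p 0 < j :=
      fun p => getD_map_minLabel_lt hblr hj0' hjlr p
    have hlt0 := hlt 0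
    by_cases hl2 : 2 ≤ l.length
    · have hs2 : s + 2 = l.length := by omega
      have he : (l ++ leaf i :: r).insertIdx (s + 2) (leaf j) = (l ++ [leaf j]) ++ leaf i :: r := by
        rw [hs2, show l.length = l.length + 0 from rfl, insertIdx_append_right]
        simp
      rw [he] at hsp ⊢
      obtain ⟨h3, h4⟩ := hins (l ++ [leaf j]) r (by simp [List.perm_middle]) hsp
      rw [h3, h4]
      constructor
      · have h5 : ((l ++ [leaf j] ++ r).map minLabel).getD 0 0 =
            ((l ++ r).map minLabel).getD 0 0 := by
          match l, hl2 with
          | a :: l, _ => simp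
        have h6 : ((l ++ [leaf j] ++ r).map minLabel).getD (max (l ++ [leaf j]).length 2 - 1) 0
            = j := by
          have : max (l ++ [leaf j]).length 2 - 1 = l.length := by simp; omega
          rw [this]
          simp [List.getD, minLabel_leaf]
        rw [h5, h6]
        omega
      · rw [List.append_assoc, List.singleton_append, relabel, forestRelabel_middle, hfixl, hfixr,
          hfixj, canon_eq_self hs]
    · have hs2 : s = 0 := by omega
      rw [hs2] at hsp ⊢
      obtain rfl | ⟨A, rfl⟩ : l = [] ∨ ∃ A, l = [A] := by
        rcases l with _ | ⟨A, _ | ⟨B, l⟩⟩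
        · exact Or.inl rfl
        · exact Or.inr ⟨A, rfl⟩
        · simp at hl2
      · obtain ⟨A, r, rfl⟩ : ∃ A r', r = A :: r' :=
          List.exists_cons_of_ne_nil (by rintro rfl; simp at h2)
        obtain ⟨h3, h4⟩ := hins [] (A :: leaf j :: r) (List.Perm.swap _ _ _) hsp
        change localSearch i (node ([] ++ leaf i :: A :: leaf j :: r)) σ = j ∧
          pruned i j (node ([] ++ leaf i :: A :: leaf j :: r)) = _
        rw [h3, h4]
        constructor
        · simp [minLabel_leaf] at hlt0 ⊢
          omega
        · simp only [forestRelabel, List.cons.injEq] at hfixr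
          simp only [List.nil_append, relabel, forestRelabel, hfixr.1, hfixr.2, shift_self hij]
          exact canon_swap hs
      · obtain ⟨h3, h4⟩ := hins [A] (leaf j :: r) (List.Perm.swap _ _ _) hsp
        change localSearch i (node ([A] ++ leaf i :: leaf j :: r)) σ = j ∧
            pruned i j (node ([A] ++ leaf i :: leaf j :: r)) = _
        rw [h3, h4]
        constructor
        · simp [minLabel_leaf] at hlt0 ⊢
          omega
        · rw [relabel, forestRelabel_middle, hfixl, hfixr, hfixj, canon_eq_self hs]
  -- the other gaps correspond, in the same order, to those of the branch point without leaf `i`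
  have hB2 : ∀ k ∈ Finset.range ((l ++ r).length - 1),
      localSearch i (node ((l ++ leaf i :: r).insertIdx ((if k < s then k else k + 1) + 2)
        (leaf j))) σ = m ∧
      pruned i m (node ((l ++ leaf i :: r).insertIdx ((if k < s then k else k + 1) + 2)
        (leaf j))) = canon (relabel (shift i m) (node ((l ++ r).insertIdx (k + 2) (leaf j)))) := by
    intro k hk
    have hk' := Finset.mem_range.1 hk
    have hsp := hspec (if k < s then k else k + 1) (Finset.mem_range.2 (by split_ifs <;> omega))
    have hperm : ((l ++ r).insertIdx (k + 2) (leaf j)).Perm (leaf j :: (l ++ r)) :=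
      List.perm_insertIdx _ _ (by omega)
    split_ifs at hsp ⊢ with hks
    · have hkl : k + 2 < l.length := by omega
      have he := insertIdx_append_left (leaf j) r hkl.le
      rw [insertIdx_append_left _ _ hkl.le] at hsp ⊢
      obtain ⟨h3, h4⟩ := hins _ r (he ▸ hperm) hsp
      rw [h3, h4, ← he]
      refine ⟨?_, rfl⟩
      rw [hsearch, List.length_insertIdx_of_le_length hkl.le,
        getD_map_insertIdx_of_lt _ (by omega), getD_map_insertIdx_of_gt _ (by omega)]
      congr 4
      omega
    · obtain ⟨q, hq⟩ : ∃ q, k + 2 = l.length + q := ⟨k + 2 - l.length, by omega⟩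
      have he := insertIdx_append_right (leaf j) r q l
      rw [show k + 1 + 2 = l.length + (q + 1) by omega, insertIdx_append_right,
        List.insertIdx_succ_cons] at hsp ⊢
      rw [hq] at hperm
      obtain ⟨h3, h4⟩ := hins l _ (he ▸ hperm) hsp
      rw [h3, h4, ← he, hq]
      refine ⟨?_, rfl⟩
      rw [hsearch, getD_map_insertIdx_of_lt _ (by omega), getD_map_insertIdx_of_lt _ (by omega)]
  have hB : ∑ k ∈ Finset.range ((l ++ leaf i :: r).length - 1),
      gapWeight α γ (l ++ leaf i :: r).length k *
        F (localSearch i (node ((l ++ leaf i :: r).insertIdx (k + 2) (leaf j))) σ)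
          (pruned i (localSearch i (node ((l ++ leaf i :: r).insertIdx (k + 2) (leaf j))) σ)
            (node ((l ++ leaf i :: r).insertIdx (k + 2) (leaf j)))) =
      α * F j (node (l ++ leaf i :: r)) +
      ∑ k ∈ Finset.range ((l ++ r).length - 1), gapWeight α γ (l ++ r).length k *
        F m (canon (relabel (shift i m) (node ((l ++ r).insertIdx (k + 2) (leaf j))))) := by
    rw [hlen, Nat.add_sub_cancel, sum_range_single_out _ hsl, hB1.1, hB1.2]
    congr 1
    · rw [gapWeight, if_neg (by omega)]
    · refine Finset.sum_congr rfl fun k hk => ?_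
      rw [(hB2 k hk).1, (hB2 k hk).2]
      congr 1
      have hk' := Finset.mem_range.1 hk
      unfold gapWeight
      split_ifs <;> first | rfl | omega
  -- insertions into the siblings of leaf `i` do not change their least labels
  have hforest : ∀ l' r' : List PlanarTree,
      (l' ++ r').map minLabel = (l ++ r).map minLabel → l'.length = l.length →
      r'.length = r.length → ForestSemiPlanar l' → ForestSemiPlanar r' →
      (forestLeaves (l' ++ r')).Perm (j :: forestLeaves (l ++ r)) →
      localSearch i (node (l' ++ leaf i :: r')) σ = m ∧
      pruned i m (node (l' ++ leaf i :: r')) =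
        canon (relabel (shift i m) (node (l' ++ r'))) := by
    intro l' r' hmap hl' hr' hsl' hsr' hp
    have hi' : i ∉ forestLeaves (l' ++ r') := by
      rw [hp.mem_iff]
      simp [-mem_forestLeaves, forestLeaves_append, hil, hir, hij.ne]
    have hs' : SemiPlanar (node (l' ++ leaf i :: r')) := by
      rw [List.map_append, List.map_append] at hmap
      have := List.append_inj hmap (by simp [hl'])
      refine ⟨leastTwoFirst_map ?_ hs.1, forestSemiPlanar_append.2 ⟨hsl', trivial, hsr'⟩⟩
      simp [this.1, this.2]
    have hp3 : (forestLeaves (l' ++ leaf i :: r')).Perm (j :: forestLeaves (l ++ leaf i :: r)) := by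
      refine (forestLeaves_perm List.perm_middle).trans ?_
      refine List.Perm.trans ?_ ((forestLeaves_perm List.perm_middle).symm.cons _)
      simp only [forestLeaves, leaves, List.singleton_append]
      exact (hp.cons _).trans (List.Perm.swap _ _ _)
    have hn' : (forestLeaves (l' ++ leaf i :: r')).Nodup := by
      rw [hp3.nodup_iff, List.nodup_cons]
      exact ⟨hjn, hn⟩
    rw [forestLeaves_append, List.mem_append, not_or] at hi'
    have h2' : 2 ≤ (l' ++ r').length := by simp [hl', hr'] at h2 ⊢; omega
    refine ⟨?_, pruned_node_leaf hsl'.branching hsr'.branching hi'.1 hi'.2 h2'⟩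
    rw [localSearch_nonbinary hs' hn' h2', hsearch, hmap, hl']
  have hsl' := (forestSemiPlanar_append.1 hs.2)
  have h3 : wsum (forestInsertions α γ j l) (fun d =>
      F (localSearch i (node (d ++ leaf i :: r)) σ)
        (pruned i (localSearch i (node (d ++ leaf i :: r)) σ) (node (d ++ leaf i :: r)))) =
      wsum (forestInsertions α γ j l) (fun d =>
        F m (canon (relabel (shift i m) (node (d ++ r))))) := by
    refine wsum_congr fun p hp => ?_
    obtain ⟨g1, g2, g3⟩ := forestInsertions_spec hsl'.1 (fun k hk => hj k (Or.inl hk)) p hp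
    obtain ⟨g4, g5⟩ := hforest p.2 r (by simp [g2]) (by simpa using congrArg List.length g2) rfl g1
      hsl'.2.2 (by simpa [forestLeaves_append] using g3.append_right (forestLeaves r))
    rw [g4, g5]
  have h4 : wsum (forestInsertions α γ j r) (fun d =>
      F (localSearch i (node (l ++ leaf i :: d)) σ)
        (pruned i (localSearch i (node (l ++ leaf i :: d)) σ) (node (l ++ leaf i :: d)))) =
      wsum (forestInsertions α γ j r) (fun d =>
        F m (canon (relabel (shift i m) (node (l ++ d))))) := by
    refine wsum_congr fun p hp => ?_
    obtain ⟨g1, g2, g3⟩ := forestInsertions_spec hsl'.2.2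
      (fun k hk => hj k (Or.inr (Or.inr hk))) p hp
    obtain ⟨g4, g5⟩ := hforest l p.2 (by simp [g2]) rfl (by simpa using congrArg List.length g2)
      hsl'.1 g1 (by
        simpa [forestLeaves_append] using (g3.append_left (forestLeaves l)).trans List.perm_middle)
    rw [g4, g5]
  -- insertion into the edge below leaf `i`
  have hne : l ++ r ≠ [] := by rintro h; rw [h] at h2; simp at h2
  have h5 : localSearch i (node (l ++ node [leaf i, leaf j] :: r)) σ = j := by
    rw [localSearch_node (by simp [leaves, forestLeaves]) hil]
    exact localSearch_cherry hij (forestMin_lt hj0' hjlr)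
  have h6 : pruned i j (node (l ++ node [leaf i, leaf j] :: r)) = node (l ++ leaf i :: r) := by
    rw [pruned_node hbl hbr hil hir hne (delete_cherry hij.ne), relabel, forestRelabel_middle,
      hfixl, hfixr, hfixj, canon_eq_self hs]
  -- insertion into the edge below the branch point
  have h7 : localSearch i (node [node (l ++ leaf i :: r), leaf j]) σ = m := by
    rw [show [node (l ++ leaf i :: r), leaf j] = [] ++ node (l ++ leaf i :: r) :: [leaf j] from rfl,
      localSearch_node (by simp [-mem_forestLeaves, leaves, forestLeaves_append, forestLeaves])
        (by simp [forestLeaves]), localSearch_nonbinary hs hn h2, hsearch]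
  have h8 : pruned i m (node [node (l ++ leaf i :: r), leaf j]) =
      canon (relabel (shift i m) (node [node (l ++ r), leaf j])) :=
    pruned_node (l := []) (r := [leaf j]) trivial ⟨trivial, trivial⟩ (by simp [forestLeaves])
      (by simp [forestLeaves, leaves, hij.ne]) (by simp) hx'
  rw [wsum_insertions_node, wsum_insertions_node, wsum_forestInsertions_middle,
    wsum_forestInsertions_append, hB, h3, h4, h7, h8, insertions]
  simp only [wsum_cons, wsum_nil, h5, h6]
  ring

/-- `KeyIdentity` at a parent of leaf `i` with two children.  The search finds the new leaf if it is
inserted into the edge below leaf `i`, of weight `1 - α`, into the parent, of weight `α - γ`, or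
into the edge below the parent, of weight `γ`. -/
lemma key_binary {α γ : ℝ} {i j : ℕ} {l r : List PlanarTree} {A : PlanarTree}
    {σ : List (List PlanarTree × List PlanarTree)} (hlr : l ++ r = [A])
    (hs : SemiPlanar (node (l ++ leaf i :: r)))
    (hn : (forestLeaves (l ++ leaf i :: r)).Nodup)
    (hj : ∀ k ∈ forestLeaves (l ++ leaf i :: r), k < j) :
    KeyIdentity α γ i j (node (l ++ leaf i :: r)) σ := by
  intro x' hx' F
  have hbs := hs.2.branching
  obtain ⟨hbl, -, hbr⟩ : ForestBranching l ∧ Branching (leaf i) ∧ ForestBranching r := by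
    rw [forestBranching_append] at hbs
    exact ⟨hbs.1, hbs.2⟩
  have hj0 := hj
  simp only [forestLeaves_append, forestLeaves, leaves, List.mem_append,
    List.mem_singleton] at hj
  have hn' := hn
  simp only [forestLeaves_append, forestLeaves, leaves, List.nodup_append, List.mem_append,
    List.mem_singleton] at hn'
  obtain ⟨-, ⟨-, -, hn2⟩, hn1⟩ := hn'
  have hil : i ∉ forestLeaves l := fun h => hn1 i h i (Or.inl rfl) rfl
  have hir : i ∉ forestLeaves r := fun h => hn2 i rfl i h rfl
  have hij : i < j := hj i (Or.inr (Or.inl rfl))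
  have hj0' : 0 < j := by omega
  have hjn : j ∉ forestLeaves (l ++ leaf i :: r) := fun h => (hj0 j h).false
  have hblr : ForestBranching (l ++ r) := forestBranching_append.2 ⟨hbl, hbr⟩
  have hlen : (l ++ leaf i :: r).length = 2 := by
    have := congrArg List.length hlr
    simp at this ⊢
    omega
  obtain rfl : A = x' := by
    rw [delete_node_leaf hbl hbr hil hir, hlr] at hx'
    exact Option.some.inj hx'
  have hne : l ++ r ≠ [] := by simp [hlr]
  have hmA : minLabel A < j := by
    have hA : A ∈ l ++ r := by simp [hlr]
    have h1 := mem_forestLeaves.2 ⟨A, hA, minLabel_mem (forestBranching_iff.1 hblr A hA)⟩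
    rw [forestLeaves_append, List.mem_append] at h1
    exact hj _ (by tauto)
  have hsearch := localSearch_binary hlr hil σ
  set m := localSearch i (node (l ++ leaf i :: r)) σ with hm
  have hfixl : forestRelabel (shift i j) l = l := forestRelabel_eq_self fun k hk =>
    shift_of_lt (hj k (Or.inl hk)) (fun e => hil (e ▸ hk))
  have hfixr : forestRelabel (shift i j) r = r := forestRelabel_eq_self fun k hk =>
    shift_of_lt (hj k (Or.inr (Or.inr hk))) (fun e => hir (e ▸ hk))
  have hfixj : relabel (shift i j) (leaf j) = leaf i := by rw [relabel, shift_self hij]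
  -- insertion of `j` next to `A`, in place of leaf `i`
  have hA2 : canon (relabel (shift i j) (node [A, leaf j])) = node (l ++ leaf i :: r) := by
    rcases l with _ | ⟨B, l⟩
    · simp only [List.nil_append] at hlr
      subst hlr
      simp only [forestRelabel, List.cons.injEq, and_true] at hfixr
      simp only [relabel, forestRelabel, hfixr, shift_self hij]
      exact canon_swap hs
    · simp only [List.cons_append, List.cons.injEq, List.append_eq_nil_iff] at hlr
      obtain ⟨rfl, rfl, rfl⟩ := hlr
      simp only [forestRelabel, List.cons.injEq, and_true] at hfixl
      simp only [relabel, forestRelabel, hfixl, shift_self hij]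
      exact canon_eq_self hs
  have htop : localSearch i (node [node (l ++ leaf i :: r), leaf j]) σ = j := by
    rw [show [node (l ++ leaf i :: r), leaf j] = [] ++ node (l ++ leaf i :: r) :: [leaf j] from rfl,
      localSearch_node (by simp [-mem_forestLeaves, leaves, forestLeaves_append, forestLeaves])
        (by simp [forestLeaves]), localSearch_binary hlr hil]
    simp only [firstMin, List.nil_append, forestMin_singleton, minLabel_leaf]
    omega
  have htop' : pruned i j (node [node (l ++ leaf i :: r), leaf j]) = node (l ++ leaf i :: r) := by
    rw [show [node (l ++ leaf i :: r), leaf j] = [] ++ node (l ++ leaf i :: r) :: [leaf j] from rfl,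
      pruned_node (l := []) (r := [leaf j]) trivial ⟨trivial, trivial⟩ (by simp [forestLeaves])
      (by simp [forestLeaves, leaves, hij.ne]) (by simp) hx', ← hA2]
    rfl
  have hbranch : localSearch i (node ((l ++ leaf i :: r).insertIdx 2 (leaf j))) σ = j ∧
      pruned i j (node ((l ++ leaf i :: r).insertIdx 2 (leaf j))) = node (l ++ leaf i :: r) := by
    have hsp : SemiPlanar (node ((l ++ leaf i :: r).insertIdx 2 (leaf j))) := by
      refine (branchInsertions_spec (α := 0) (γ := 0) (j := j) (p := (_, _)) hs hj0
        (List.mem_map.2 ⟨0, ?_, rfl⟩)).1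
      simp [hlen]
    have he : (l ++ leaf i :: r).insertIdx 2 (leaf j) = l ++ leaf i :: (r ++ [leaf j]) := by
      rw [← hlen, List.insertIdx_length_self]
      simp
    have hbj : ForestBranching (r ++ [leaf j]) := forestBranching_append.2 ⟨hbr, trivial, trivial⟩
    rw [he] at hsp ⊢
    have hn3 : (forestLeaves (l ++ leaf i :: (r ++ [leaf j]))).Nodup := by
      rw [show l ++ leaf i :: (r ++ [leaf j]) = (l ++ leaf i :: r) ++ [leaf j] by simp,
        forestLeaves_append, (List.perm_append_comm).nodup_iff]
      simpa [-mem_forestLeaves, forestLeaves, leaves, hn] using hjn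
    have h2 : l ++ (r ++ [leaf j]) = [A, leaf j] := by rw [← List.append_assoc, hlr]; rfl
    have hl1 : l.length ≤ 1 := by simp at hlen; omega
    constructor
    · rw [localSearch_nonbinary hsp hn3 (by simp [h2]), h2,
        show max l.length 2 - 1 = 1 by omega]
      simp [minLabel_leaf]
      omega
    · rw [pruned_node_leaf hbl hbj hil (by
        simp [-mem_forestLeaves, forestLeaves_append, forestLeaves, leaves, hir, hij.ne])
        (by simp [h2]), h2, hA2]
  have hext : localSearch i (node (l ++ node [leaf i, leaf j] :: r)) σ = j := by
    rw [localSearch_node (by simp [leaves, forestLeaves]) hil]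
    refine localSearch_cherry hij ?_
    simp only [firstMin, hlr, forestMin_singleton, hmA]
  have hext' : pruned i j (node (l ++ node [leaf i, leaf j] :: r)) = node (l ++ leaf i :: r) := by
    rw [pruned_node hbl hbr hil hir hne (delete_cherry hij.ne), relabel, forestRelabel_middle,
      hfixl, hfixr, hfixj, canon_eq_self hs]
  -- insertions into `A`
  have hA : ∀ (F : List PlanarTree → List PlanarTree → ℝ) (G : PlanarTree → ℝ),
      (∀ l' r' A', l' ++ r' = [A'] → Branching A' → (leaves A').Perm (j :: leaves A) →
        i ∉ forestLeaves l' → i ∉ forestLeaves r' → minLabel A' = minLabel A → F l' r' = G A') →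
      wsum (forestInsertions α γ j l) (fun d => F d r) +
        wsum (forestInsertions α γ j r) (fun d => F l d) = wsum (insertions α γ j A) G := by
    intro F G h
    have hAb : Branching A := forestBranching_iff.1 hblr A (by simp [hlr])
    have hAj : ∀ k ∈ leaves A, k < j ∧ k ≠ i := by
      intro k hk
      have h1 := mem_forestLeaves.2 ⟨A, (by simp [hlr] : A ∈ l ++ r), hk⟩
      rw [forestLeaves_append, List.mem_append] at h1
      exact ⟨hj _ (by tauto), fun e => h1.elim (fun h1 => hil (e ▸ h1)) (fun h1 => hir (e ▸ h1))⟩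
    have hA' : ∀ p ∈ insertions α γ j A, Branching p.2 ∧ (leaves p.2).Perm (j :: leaves A) ∧
        i ∉ leaves p.2 ∧ minLabel p.2 = minLabel A := by
      intro p hp
      obtain ⟨g1, g2⟩ := insertions_leaves hAb p hp
      refine ⟨g2, g1, ?_, minLabel_insert hAb (fun k hk => (hAj k hk).1) g1⟩
      rw [g1.mem_iff, List.mem_cons, not_or]
      exact ⟨hij.ne, fun hk => (hAj i hk).2 rfl⟩
    rcases l with _ | ⟨B, l⟩
    · simp only [List.nil_append] at hlr
      subst hlr
      rw [wsum_forestInsertions_cons]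
      simp only [forestInsertions, wsum_nil, zero_add, add_zero]
      refine wsum_congr fun p hp => ?_
      obtain ⟨g1, g2, g3, g4⟩ := hA' p hp
      exact h [] [p.2] p.2 rfl g1 g2 (by simp [forestLeaves]) (by simpa [forestLeaves] using g3) g4
    · simp only [List.cons_append, List.cons.injEq, List.append_eq_nil_iff] at hlr
      obtain ⟨rfl, rfl, rfl⟩ := hlr
      rw [wsum_forestInsertions_cons]
      simp only [forestInsertions, wsum_nil, add_zero]
      refine wsum_congr fun p hp => ?_
      obtain ⟨g1, g2, g3, g4⟩ := hA' p hp
      exact h [p.2] [] p.2 rfl g1 g2 (by simpa [forestLeaves] using g3) (by simp [forestLeaves]) g4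
  have hA3 := hA (fun l' r' => F (localSearch i (node (l' ++ leaf i :: r')) σ)
    (pruned i (localSearch i (node (l' ++ leaf i :: r')) σ) (node (l' ++ leaf i :: r'))))
    (fun u => F m (canon (relabel (shift i m) u)))
    (fun l' r' A' h1 h2 _ h4 h5 h6 => by
      have h7 := forestBranching_append.1 (h1 ▸ ⟨h2, trivial⟩ : ForestBranching (l' ++ r'))
      have h8 : localSearch i (node (l' ++ leaf i :: r')) σ = m := by
        rw [localSearch_binary h1 h4, hsearch, h6]
      have h9 : delete i (node (l' ++ leaf i :: r')) = some A' := by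
        rw [delete_node_leaf h7.1 h7.2 h4 h5, h1]
        rfl
      simp only [h8, pruned, h9, Option.getD_some])
  rw [wsum_insertions_node, wsum_forestInsertions_middle, hA3, hlen, insertions]
  simp only [Nat.add_one_sub_one, Finset.range_one, Finset.sum_singleton, zero_add, gapWeight,
    if_true, wsum_cons, wsum_nil, htop, htop', hext, hext', hbranch.1, hbranch.2]
  ring

/-- `KeyIdentity` by induction along the ancestral line of leaf `i`. -/
lemma keyIdentity {α γ : ℝ} {i j : ℕ} : ∀ (cs : List PlanarTree)
    (σ : List (List PlanarTree × List PlanarTree)), SemiPlanar (node cs) →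
    (forestLeaves cs).Nodup → (∀ k ∈ forestLeaves cs, k < j) → i ∈ forestLeaves cs →
    KeyIdentity α γ i j (node cs) σ
  | cs, σ, hs, hn, hj, hi => by
    obtain ⟨l, c, r, rfl, hic, -⟩ := exists_middle hi
    by_cases hc : c = leaf i
    · subst hc
      have h2 := hs.1.two_le
      by_cases h3 : 2 ≤ (l ++ r).length
      · exact key_nonbinary σ hs hn hj h3
      · obtain ⟨A, hA⟩ := List.length_eq_one_iff.1 (show (l ++ r).length = 1 by
          simp at h2 h3 ⊢; omega)
        exact key_binary hA hs hn hj
    · refine key_step σ hs hn hj hic hc ?_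
      have hn' := hn
      simp only [forestLeaves_append, forestLeaves, List.nodup_append] at hn'
      cases c with
      | leaf k =>
        simp only [leaves, List.mem_singleton] at hic
        exact absurd (by rw [hic]) hc
      | node ds =>
        have hj' := hj
        simp only [forestLeaves_append, forestLeaves, List.mem_append, leaves] at hj'
        exact keyIdentity ds _ (forestSemiPlanar_append.1 hs.2).2.1 hn'.2.1.1
          (fun k hk => hj' k (by tauto)) hic
termination_by cs => sizeOf cs
decreasing_by
  subst_vars
  have h1 := List.sizeOf_lt_of_mem
    (List.mem_append_right l (List.mem_cons_self (a := node ds) (l := r)))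
  rw [node.sizeOf_spec] at h1
  omega

end PlanarTree

namespace PlanarTree

/-! ### The order of the subtrees after a down-step -/

lemma minLabel_relabel {f : ℕ → ℕ} {t : PlanarTree} (hb : Branching t)
    (hf : StrictMonoOn f {k | k ∈ leaves t}) : minLabel (relabel f t) = f (minLabel t) := by
  have h1 := minLabel_mem hb
  refine le_antisymm (minLabel_le ?_) ?_
  · rw [leaves_relabel]
    exact List.mem_map_of_mem h1
  · have h2 := minLabel_mem (hb.relabel f)
    rw [leaves_relabel, List.mem_map] at h2
    obtain ⟨k, hk, hk'⟩ := h2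
    rw [← hk']
    exact hf.monotoneOn h1 hk (minLabel_le hk)

lemma leastTwoFirst_relabel {f : ℕ → ℕ} {cs : List PlanarTree} (hb : ForestBranching cs)
    (hf : StrictMonoOn f {k | k ∈ forestLeaves cs}) (h : LeastTwoFirst cs) :
    LeastTwoFirst (forestRelabel f cs) := by
  have hm : ∀ c ∈ cs, minLabel (relabel f c) = f (minLabel c) := fun c hc =>
    minLabel_relabel (forestBranching_iff.1 hb c hc)
      (hf.mono fun k hk => mem_forestLeaves.2 ⟨c, hc, hk⟩)
  have hmem : ∀ c ∈ cs, minLabel c ∈ {k | k ∈ forestLeaves cs} := fun c hc =>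
    mem_forestLeaves.2 ⟨c, hc, minLabel_mem (forestBranching_iff.1 hb c hc)⟩
  rw [forestRelabel_eq_map]
  match cs, h with
  | [], h => exact h.elim
  | [_], h => exact h.elim
  | a :: b :: cs, h =>
    refine ⟨?_, fun c hc => ?_⟩
    · rw [hm a (by simp), hm b (by simp)]
      exact hf (hmem a (by simp)) (hmem b (by simp)) h.1
    · obtain ⟨d, hd, rfl⟩ := List.mem_map.1 hc
      rw [hm b (by simp), hm d (by simp [hd])]
      exact hf (hmem b (by simp)) (hmem d (by simp [hd])) (h.2 d hd)

mutual
lemma SemiPlanar.relabel {f : ℕ → ℕ} : ∀ {t : PlanarTree}, SemiPlanar t →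
    StrictMonoOn f {k | k ∈ leaves t} → SemiPlanar (relabel f t)
  | leaf _, _, _ => trivial
  | node cs, h, hf => by
    simp only [leaves] at hf
    exact ⟨leastTwoFirst_relabel h.2.branching hf h.1, ForestSemiPlanar.relabel h.2 hf⟩
lemma ForestSemiPlanar.relabel {f : ℕ → ℕ} : ∀ {cs : List PlanarTree}, ForestSemiPlanar cs →
    StrictMonoOn f {k | k ∈ forestLeaves cs} → ForestSemiPlanar (forestRelabel f cs)
  | [], _, _ => trivial
  | c :: cs, h, hf => by
    simp only [forestLeaves, List.mem_append] at hf
    exact ⟨SemiPlanar.relabel h.1 (hf.mono fun k hk => Or.inl hk),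
      ForestSemiPlanar.relabel h.2 (hf.mono fun k hk => Or.inr hk)⟩
end

/-- Closing the gap left by the label `m`. -/
def closeGap (m k : ℕ) : ℕ := if m < k then k - 1 else k

lemma shift_eq_closeGap {i m k : ℕ} (h1 : k ≠ i) (h2 : k ≠ m) : shift i m k = closeGap m k := by
  rw [shift, Equiv.swap_apply_of_ne_of_ne h1 h2, closeGap]

lemma shift_right {i m : ℕ} (h : i ≤ m) : shift i m m = i := by
  rw [shift, Equiv.swap_apply_right, if_neg h.not_gt]

lemma closeGap_lt {m k k' : ℕ} (h1 : k ≠ m) (h : k < k') : closeGap m k < closeGap m k' := by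
  unfold closeGap
  split_ifs <;> omega

lemma closeGap_le {m k k' : ℕ} (h : k ≤ k') : closeGap m k ≤ closeGap m k' := by
  unfold closeGap
  split_ifs <;> omega

/-- The passage of the label `i` to the former leaf `m` keeps the order of the labels in a set not
containing `i`, unless `m` is in this set without being its least element. -/
lemma strictMonoOn_shift {i m : ℕ} {S : Set ℕ} (him : i ≤ m) (hi : i ∉ S)
    (hm : m ∈ S → ∀ k ∈ S, m ≤ k) : StrictMonoOn (shift i m) S := by
  intro k hk k' hk' hlt
  have h1 : k ≠ i := fun e => hi (e ▸ hk)
  have h1' : k' ≠ i := fun e => hi (e ▸ hk')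
  by_cases h2' : k' = m
  · subst h2'
    exact absurd (hm hk' k hk) hlt.not_ge
  rw [shift_eq_closeGap h1' h2']
  by_cases h2 : k = m
  · subst h2
    rw [shift_right him, closeGap, if_pos hlt]
    omega
  · rw [shift_eq_closeGap h1 h2]
    exact closeGap_lt h2 hlt

/-- The label found by the local search in a subtree containing leaf `i` is a label of this
subtree, or it is the least label of the next spinal bush, and then greater than leaf `i` and than
the least one of the other labels of the subtree. -/
lemma localSearch_mem {i : ℕ} : ∀ {cs : List PlanarTree}
    {σ : List (List PlanarTree × List PlanarTree)}, SemiPlanar (node cs) →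
    (forestLeaves cs).Nodup → i ∈ forestLeaves cs →
    i ≤ localSearch i (node cs) σ ∧
      (∃ k ∈ forestLeaves cs, k ≠ i ∧ k ≤ localSearch i (node cs) σ) ∧
      (localSearch i (node cs) σ ∈ forestLeaves cs ∨
        (localSearch i (node cs) σ = firstMin σ ∧ i < localSearch i (node cs) σ ∧
          ∃ k ∈ forestLeaves cs, k ≠ i ∧ k < localSearch i (node cs) σ))
  | cs, σ, hs, hn, hi => by
    obtain ⟨l, c, r, rfl, hic, hil⟩ := exists_middle hi
    have hbs := hs.2.branching
    have hblr : ForestBranching (l ++ r) := by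
      rw [forestBranching_append] at hbs ⊢
      exact ⟨hbs.1, hbs.2.2⟩
    have hsub : ∀ k, k ∈ forestLeaves (l ++ c :: r) ↔
        k ∈ leaves c ∨ k ∈ forestLeaves (l ++ r) := by
      intro k
      simp only [forestLeaves_append, forestLeaves, List.mem_append]
      tauto
    have hilr : i ∉ forestLeaves (l ++ r) := by
      simp only [forestLeaves_append, forestLeaves, List.nodup_append] at hn
      rw [forestLeaves_append, List.mem_append, not_or]
      exact ⟨hil, fun h => hn.2.1.2.2 i hic i h rfl⟩
    by_cases hc : c = leaf i
    · subst hc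
      have h2 := hs.1.two_le
      by_cases h3 : 2 ≤ (l ++ r).length
      · have hM : ∀ p < (l ++ r).length,
            ((l ++ r).map minLabel).getD p 0 ∈ forestLeaves (l ++ r) := by
          intro p hp
          rw [List.getD_eq_getElem _ _ (by simpa using hp), List.getElem_map]
          exact mem_forestLeaves.2 ⟨_, List.getElem_mem hp,
            minLabel_mem (forestBranching_iff.1 hblr _ (List.getElem_mem hp))⟩
        have h4 := hM 0 (by omega)
        have h5 := hM (max l.length 2 - 1) (by simp at h3 ⊢; omega)
        rw [localSearch_nonbinary hs hn h3]
        refine ⟨le_max_left _ _, ⟨_, (hsub _).2 (Or.inr h4), fun e => hilr (e ▸ h4), ?_⟩,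
          Or.inl ?_⟩
        · exact (le_max_left _ _).trans (le_max_right _ _)
        · rcases max_choice i (max (((l ++ r).map minLabel).getD 0 0)
            (((l ++ r).map minLabel).getD (max l.length 2 - 1) 0)) with h | h <;> rw [h]
          · exact hi
          · rcases max_choice (((l ++ r).map minLabel).getD 0 0)
              (((l ++ r).map minLabel).getD (max l.length 2 - 1) 0) with h | h <;> rw [h]
            · exact (hsub _).2 (Or.inr h4)
            · exact (hsub _).2 (Or.inr h5)
      · obtain ⟨A, hA⟩ := List.length_eq_one_iff.1 (show (l ++ r).length = 1 by
          simp at h2 h3 ⊢; omega)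
        have h4 : minLabel A ∈ forestLeaves (l ++ r) := mem_forestLeaves.2
          ⟨A, by simp [hA], minLabel_mem (forestBranching_iff.1 hblr A (by simp [hA]))⟩
        have h5 : minLabel A ≠ i := fun e => hilr (e ▸ h4)
        have h6 := (hsub _).2 (Or.inr h4)
        rw [localSearch_binary hA hil]
        refine ⟨le_max_left _ _, ⟨_, h6, h5, (le_max_left _ _).trans (le_max_right _ _)⟩, ?_⟩
        by_cases h7 : i < firstMin σ ∧ minLabel A < firstMin σ
        · right
          have h8 : max i (max (minLabel A) (firstMin σ)) = firstMin σ := by omega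
          rw [h8]
          exact ⟨rfl, h7.1, _, h6, h5, h7.2⟩
        · left
          rcases le_total i (minLabel A) with h8 | h8
          · have h9 : max i (max (minLabel A) (firstMin σ)) = minLabel A := by omega
            rwa [h9]
          · have h9 : max i (max (minLabel A) (firstMin σ)) = i := by omega
            rwa [h9]
    · cases c with
      | leaf k =>
        simp only [leaves, List.mem_singleton] at hic
        exact absurd (by rw [hic]) hc
      | node ds =>
        have hn' := hn
        simp only [forestLeaves_append, forestLeaves, List.nodup_append] at hn'
        obtain ⟨h1, ⟨k, h2, h3, h4⟩, h5⟩ := localSearch_mem (σ := (l, r) :: σ)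
          (forestSemiPlanar_append.1 hs.2).2.1 hn'.2.1.1 hic
        rw [localSearch_node hic hil]
        refine ⟨h1, ⟨k, (hsub k).2 (Or.inl h2), h3, h4⟩, Or.inl ((hsub _).2 ?_)⟩
        refine h5.imp id fun h6 => ?_
        rw [h6.1]
        exact (forestMin_mem (l ++ r)).resolve_left fun h7 => by
          have := h6.1
          rw [show firstMin ((l, r) :: σ) = forestMin (l ++ r) from rfl, h7] at this
          omega
termination_by cs => sizeOf cs
decreasing_by
  subst_vars
  have h1 := List.sizeOf_lt_of_mem
    (List.mem_append_right l (List.mem_cons_self (a := node ds) (l := r)))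
  rw [node.sizeOf_spec] at h1
  omega

/-- If the found label `m` is in the subtree `c` of leaf `i`, then the down-step keeps the least
label of `c`, up to the closing of the gap: if leaf `i` is least, the former leaf `m` inherits its
label. -/
lemma minLabel_relabel_shift {i m : ℕ} {c c' : PlanarTree} (hb : Branching c)
    (hd : delete i c = some c') (him : i ≤ m) (hi : i ∈ leaves c) (hm : m ∈ leaves c)
    (hmin : minLabel c ≠ m) :
    minLabel (relabel (shift i m) c') = closeGap m (minLabel c) := by
  obtain ⟨hb', hl⟩ := (delete_spec i hb).2 c' hd
  have hmem : ∀ k, k ∈ leaves c' ↔ k ∈ leaves c ∧ k ≠ i := by simp [hl]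
  refine le_antisymm (minLabel_le ?_) ?_
  · rw [leaves_relabel, List.mem_map]
    by_cases h : minLabel c = i
    · refine ⟨m, (hmem m).2 ⟨hm, ?_⟩, ?_⟩
      · rintro rfl
        exact hmin h
      · rw [h, shift_right him, closeGap, if_neg him.not_gt]
    · exact ⟨_, (hmem _).2 ⟨minLabel_mem hb, h⟩, shift_eq_closeGap h hmin⟩
  · have h2 := minLabel_mem (hb'.relabel (shift i m))
    rw [leaves_relabel, List.mem_map] at h2
    obtain ⟨k, hk, hk'⟩ := h2
    rw [hmem] at hk
    rw [← hk']
    by_cases h : k = m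
    · have h3 := minLabel_le hi
      rw [h, shift_right him, closeGap, if_neg (h3.trans him).not_gt]
      exact h3
    · rw [shift_eq_closeGap hk.2 h]
      exact closeGap_le (minLabel_le hk.1)

lemma eq_of_mem_leaves {k : ℕ} : ∀ {cs : List PlanarTree}, (forestLeaves cs).Nodup →
    ∀ {c d : PlanarTree}, c ∈ cs → d ∈ cs → k ∈ leaves c → k ∈ leaves d → c = d
  | e :: cs, hn, c, d, hc, hd, hkc, hkd => by
    rw [forestLeaves, List.nodup_append] at hn
    rcases List.mem_cons.1 hc with hc' | hc' <;> rcases List.mem_cons.1 hd with hd' | hd'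
    · rw [hc', hd']
    · exact absurd rfl (hn.2.2 k (hc' ▸ hkc) k (mem_forestLeaves.2 ⟨d, hd', hkd⟩))
    · exact absurd rfl (hn.2.2 k (hd' ▸ hkd) k (mem_forestLeaves.2 ⟨c, hc', hkc⟩))
    · exact eq_of_mem_leaves hn.2.1 hc' hd' hkc hkd

lemma leastTwoLeft_of_map {cs ds : List PlanarTree} (g : ℕ → ℕ)
    (h : ds.map minLabel = cs.map fun c => g (minLabel c))
    (hg : ∀ c ∈ cs, ∀ d ∈ cs, minLabel c < minLabel d → g (minLabel c) < g (minLabel d))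
    (hc : LeastTwoFirst cs) : LeastTwoLeft ds := by
  rw [leastTwoLeft_iff, h]
  match cs, hc with
  | [], hc => exact hc.elim
  | [_], hc => exact hc.elim
  | a :: b :: cs, hc =>
    refine ⟨_, _, _, rfl, (hg a (by simp) b (by simp) hc.1).ne, fun k hk => ?_⟩
    obtain ⟨d, hd, rfl⟩ := List.mem_map.1 hk
    exact ⟨hg a (by simp) d (by simp [hd]) (hc.1.trans (hc.2 d hd)),
      hg b (by simp) d (by simp [hd]) (hc.2 d hd)⟩

lemma shift_of_gt {i m k : ℕ} (him : i ≤ m) (h : m < k) : shift i m k = k - 1 := by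
  rw [shift_eq_closeGap (by omega) (by omega), closeGap, if_pos h]

/-- After the down-step, the two subtrees with the least labels still stand leftmost at every
branch point, but their order may have changed. -/
lemma weakSemiPlanar_shift {i : ℕ} : ∀ {cs : List PlanarTree}
    {σ : List (List PlanarTree × List PlanarTree)} {x' : PlanarTree}, SemiPlanar (node cs) →
    (forestLeaves cs).Nodup → i ∈ forestLeaves cs → firstMin σ ∉ forestLeaves cs →
    delete i (node cs) = some x' →
    WeakSemiPlanar (relabel (shift i (localSearch i (node cs) σ)) x')
  | cs, σ, x', hs, hn, hi, hσ, hx' => by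
    obtain ⟨l, c, r, rfl, hic, hil⟩ := exists_middle hi
    have hbs := hs.2.branching
    have hblr : ForestBranching (l ++ r) := by
      rw [forestBranching_append] at hbs ⊢
      exact ⟨hbs.1, hbs.2.2⟩
    have hslr : ForestSemiPlanar (l ++ r) := by
      have := hs.2
      rw [forestSemiPlanar_append] at this ⊢
      exact ⟨this.1, this.2.2⟩
    have hnp : (forestLeaves (c :: (l ++ r))).Nodup :=
      (forestLeaves_perm List.perm_middle).nodup_iff.1 hn
    rw [forestLeaves, List.nodup_append] at hnp
    obtain ⟨hnc, hnlr, hdisj⟩ := hnp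
    have hilr : i ∉ forestLeaves (l ++ r) := fun h => hdisj i hic i h rfl
    have hir : i ∉ forestLeaves r := fun h => hilr (by
      rw [forestLeaves_append, List.mem_append]; exact Or.inr h)
    have hmi : ∀ d ∈ l ++ r, minLabel d ≠ i := fun d hd e => hilr (mem_forestLeaves.2
      ⟨d, hd, e ▸ minLabel_mem (forestBranching_iff.1 hblr d hd)⟩)
    -- the subtrees not containing leaf `i`
    have hrel : ∀ m, i ≤ m → (∀ d ∈ l ++ r, m ∈ leaves d → m = minLabel d) → ∀ d ∈ l ++ r,
        SemiPlanar (relabel (shift i m) d) ∧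
          minLabel (relabel (shift i m) d) = shift i m (minLabel d) := by
      intro m him hm d hd
      have hmono : StrictMonoOn (shift i m) {k | k ∈ leaves d} :=
        strictMonoOn_shift him (fun h => hilr (mem_forestLeaves.2 ⟨d, hd, h⟩))
          fun h k hk => (hm d hd h).le.trans (minLabel_le hk)
      exact ⟨SemiPlanar.relabel (forestSemiPlanar_iff.1 hslr d hd) hmono,
        minLabel_relabel (forestBranching_iff.1 hblr d hd) hmono⟩
    have hpw := pairwise_minLabel hblr hnlr
    by_cases hc : c = leaf i
    · subst hc
      have h2 := hs.1.two_le
      have hmemb := localSearch_mem (σ := σ) hs hn hi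
      by_cases h3 : 2 ≤ (l ++ r).length
      · have hsearch := localSearch_nonbinary hs hn h3 σ
        obtain rfl : node (l ++ r) = x' := by
          rw [forestBranching_append] at hbs
          rw [delete_node_leaf hbs.1 hbs.2.2 hil hir, ofChildren_of_two_le h3] at hx'
          exact Option.some.inj hx'
        set m := localSearch i (node (l ++ leaf i :: r)) σ with hm
        have hmin : ∀ d ∈ l ++ r, m ∈ leaves d → m = minLabel d := by
          intro d hd hmd
          have hM : ∀ p < (l ++ r).length, ((l ++ r).map minLabel).getD p 0 ∈ leaves d →
              ((l ++ r).map minLabel).getD p 0 = minLabel d := by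
            intro p hp
            rw [List.getD_eq_getElem _ _ (by simpa using hp), List.getElem_map]
            intro hpd
            rw [eq_of_mem_leaves hnlr (List.getElem_mem hp) hd
              (minLabel_mem (forestBranching_iff.1 hblr _ (List.getElem_mem hp))) hpd]
          rcases max_choice i (max (((l ++ r).map minLabel).getD 0 0)
            (((l ++ r).map minLabel).getD (max l.length 2 - 1) 0)) with h | h
          · exact absurd (mem_forestLeaves.2 ⟨d, hd, (hsearch.trans h) ▸ hmd⟩) hilr
          · rcases max_choice (((l ++ r).map minLabel).getD 0 0)
              (((l ++ r).map minLabel).getD (max l.length 2 - 1) 0) with h' | h' <;>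
            rw [hsearch, h, h'] at hmd ⊢
            · exact hM _ (by omega) hmd
            · exact hM _ (by simp at h3 ⊢; omega) hmd
        have hrel' := hrel m hmemb.1 hmin
        rw [relabel, forestRelabel_eq_map]
        refine ⟨?_, ?_⟩
        · rw [leastTwoLeft_iff, List.map_map, List.map_congr_left
            (f := minLabel ∘ relabel (shift i m)) (g := fun d => shift i m (minLabel d))
            (fun d hd => (hrel' d hd).2)]
          have him := hmemb.1
          have hs1 := hs.1
          clear hmemb hrel hrel' hdisj hnlr hblr hslr hilr hnc hic
          match l, hs1 with
          | [], hs1 =>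
            match r, h3, hs1 with
            | A :: B :: r, _, hs1 =>
              have h4 : i < minLabel A := by simpa [minLabel_leaf] using hs1.1
              have h5 : ∀ c ∈ B :: r, minLabel A < minLabel c := hs1.2
              have h6 := h5 B (by simp)
              have h7 : m = minLabel B := by
                rw [hsearch]; simp; omega
              simp only [List.nil_append, List.map_cons]
              rw [shift_of_lt (h7 ▸ h6) h4.ne', ← h7, shift_right him]
              refine ⟨_, _, _, rfl, h4.ne', fun k hk => ?_⟩
              obtain ⟨d, hd, rfl⟩ := List.mem_map.1 hk
              have h8 := h5 d (by simp [hd])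
              have h9 : minLabel B ≠ minLabel d := by
                simp only [List.nil_append, List.pairwise_cons] at hpw
                exact hpw.2.1 d hd
              rcases lt_or_gt_of_ne h9 with h10 | h10
              · rw [shift_of_gt him (by omega)]; omega
              · rw [shift_of_lt (by omega) (by omega)]; omega
          | [A], hs1 =>
            match r, h3, hs1 with
            | B :: r, _, hs1 =>
              have h4 : minLabel A < i := by simpa [minLabel_leaf] using hs1.1
              have h5 : ∀ c ∈ B :: r, i < minLabel c := by simpa [minLabel_leaf] using hs1.2
              have h6 := h5 B (by simp)
              have h7 : m = minLabel B := by
                rw [hsearch]; simp; omega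
              simp only [List.singleton_append, List.map_cons]
              rw [shift_of_lt (by omega) h4.ne, ← h7, shift_right him]
              refine ⟨_, _, _, rfl, h4.ne, fun k hk => ?_⟩
              obtain ⟨d, hd, rfl⟩ := List.mem_map.1 hk
              have h8 := h5 d (by simp [hd])
              have h9 : minLabel B ≠ minLabel d := by
                simp only [List.singleton_append, List.pairwise_cons] at hpw
                exact hpw.2.1 d hd
              rcases lt_or_gt_of_ne h9 with h10 | h10
              · rw [shift_of_gt him (by omega)]; omega
              · rw [shift_of_lt (by omega) (by omega)]; omega
          | A :: B :: l, hs1 =>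
            have h4 : minLabel A < minLabel B := hs1.1
            have h5 : minLabel B < i := by
              simpa [minLabel_leaf] using hs1.2 (leaf i) (by simp)
            have h6 : ∀ c ∈ l ++ r, minLabel B < minLabel c := fun c hc =>
              hs1.2 c (by simp at hc ⊢; tauto)
            simp only [List.cons_append, List.map_cons]
            rw [shift_of_lt (by omega) (by omega), shift_of_lt (by omega) h5.ne]
            refine ⟨_, _, _, rfl, h4.ne, fun k hk => ?_⟩
            obtain ⟨d, hd, rfl⟩ := List.mem_map.1 hk
            have h7 := h6 d hd
            have h8 : minLabel d ≠ i := hmi d (by simp at hd ⊢; tauto)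
            rcases lt_trichotomy (minLabel d) m with h9 | h9 | h9
            · rw [shift_of_lt h9 h8]; omega
            · rw [h9, shift_right him]; omega
            · rw [shift_of_gt him h9]; omega
        · rw [forestWeakSemiPlanar_iff]
          intro d hd
          obtain ⟨e, he, rfl⟩ := List.mem_map.1 hd
          exact (hrel' e he).1.weak
      · obtain ⟨A, hA⟩ := List.length_eq_one_iff.1 (show (l ++ r).length = 1 by
          simp at h2 h3 ⊢; omega)
        obtain rfl : A = x' := by
          rw [forestBranching_append] at hbs
          rw [delete_node_leaf hbs.1 hbs.2.2 hil hir, hA] at hx'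
          exact Option.some.inj hx'
        refine (hrel _ hmemb.1 ?_ A (by simp [hA])).1.weak
        intro d hd hmd
        obtain rfl : d = A := by simpa [hA] using hd
        have h4 : localSearch i (node (l ++ leaf i :: r)) σ ≠ i := fun e =>
          hilr (mem_forestLeaves.2 ⟨d, hd, e ▸ hmd⟩)
        have h5 : localSearch i (node (l ++ leaf i :: r)) σ ≠ firstMin σ := fun e =>
          hσ (mem_forestLeaves.2 ⟨d, by simp at hd ⊢; tauto, e ▸ hmd⟩)
        rw [localSearch_binary hA hil] at h4 h5 ⊢
        omega
    · cases c with
      | leaf k =>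
        simp only [leaves, List.mem_singleton] at hic
        exact absurd (by rw [hic]) hc
      | node ds =>
        have hsc := (forestSemiPlanar_append.1 hs.2).2.1
        obtain ⟨c', hc'⟩ := exists_delete hsc.branching hnc hc
        have hne : l ++ r ≠ [] := by
          have := hs.1.two_le
          rw [← List.length_pos_iff]
          simp at this ⊢
          omega
        obtain rfl : node (l ++ c' :: r) = x' := by
          rw [forestBranching_append] at hbs
          rw [delete_node_cons hbs.1 hbs.2.2 hil hir hne hc'] at hx'
          exact Option.some.inj hx'
        have hmemb := localSearch_mem (σ := (l, r) :: σ) hsc hnc hic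
        have hσ' : firstMin ((l, r) :: σ) ∉ forestLeaves ds := fun h =>
          hdisj _ h _ (Nat.sInf_mem (s := {i | i ∈ forestLeaves (l ++ r)})
            (List.exists_mem_of_ne_nil _ (hblr.leaves_ne_nil hne))) rfl
        have ih := weakSemiPlanar_shift (σ := (l, r) :: σ) hsc hnc hic hσ' hc'
        rw [localSearch_node hic hil]
        set m := localSearch i (node ds) ((l, r) :: σ) with hm
        obtain ⟨him, ⟨k, hk, hki, hkm⟩, h5⟩ := hmemb
        have hmin : ∀ d ∈ l ++ r, m ∈ leaves d → m = minLabel d := by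
          intro d hd hmd
          rcases h5 with h5 | h5
          · exact absurd rfl (hdisj m h5 m (mem_forestLeaves.2 ⟨d, hd, hmd⟩))
          · refine le_antisymm ?_ (minLabel_le hmd)
            rw [h5.1]
            exact Nat.sInf_le (mem_forestLeaves.2
              ⟨d, hd, minLabel_mem (forestBranching_iff.1 hblr d hd)⟩)
        have hrel' := hrel m him hmin
        have hmap : (forestRelabel (shift i m) (l ++ c' :: r)).map minLabel =
            l.map (fun d => shift i m (minLabel d)) ++ minLabel (relabel (shift i m) c') ::
              r.map (fun d => shift i m (minLabel d)) := by
          rw [forestRelabel_eq_map, List.map_map, List.map_append, List.map_cons,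
            List.map_congr_left (l := l) (f := minLabel ∘ relabel (shift i m))
              (g := fun d => shift i m (minLabel d))
              (fun d hd => (hrel' d (by simp [hd])).2),
            List.map_congr_left (l := r) (f := minLabel ∘ relabel (shift i m))
              (g := fun d => shift i m (minLabel d))
              (fun d hd => (hrel' d (by simp [hd])).2)]
          rfl
        rw [relabel]
        refine ⟨?_, ?_⟩
        -- If `m` is outside of the subtree containing leaf `i`, then it is the least label of the
        -- next bush: that subtree is then leftmost, and its sibling receives the label `i`.
        · by_cases hmc : m ∈ leaves (node ds)
          · have hmm : minLabel (node ds) ≠ m := by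
              intro e
              have h6 := minLabel_le (t := node ds) hic
              have h7 := minLabel_le (t := node ds) hk
              have h8 : i = m := by omega
              omega
            have hmm' : ∀ d ∈ l ++ node ds :: r, minLabel d ≠ m := by
              intro d hd e
              rw [List.mem_append, List.mem_cons] at hd
              rcases or_left_comm.1 hd with rfl | hd
              · exact hmm e
              · have hd' : d ∈ l ++ r := List.mem_append.2 hd
                exact hdisj m hmc m (mem_forestLeaves.2 ⟨d, hd', e ▸ minLabel_mem
                  (forestBranching_iff.1 hblr d hd')⟩) rfl
            refine leastTwoLeft_of_map (cs := l ++ node ds :: r) (closeGap m) ?_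
              (fun a ha b _ hab => closeGap_lt (hmm' a ha) hab) hs.1
            rw [hmap, minLabel_relabel_shift hsc.branching hc' him hic hmc hmm, List.map_append,
              List.map_cons]
            have h9 : ∀ d ∈ l ++ r, shift i m (minLabel d) = closeGap m (minLabel d) :=
              fun d hd => shift_eq_closeGap (hmi d hd) (hmm' d (by
                simp at hd ⊢; tauto))
            rw [List.map_congr_left (l := l) (fun d hd => h9 d (by simp [hd])),
              List.map_congr_left (l := r) (fun d hd => h9 d (by simp [hd]))]
          · obtain ⟨h6, h7, k, hk, hki, hkm⟩ := h5.resolve_left hmc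
            have hforest : forestMin (l ++ r) = m := h6.symm
            -- the new least label of the subtree that contained leaf `i`
            obtain ⟨hcb, hcl⟩ := (delete_spec i hsc.branching).2 c' hc'
            have hcm : ∀ x, x ∈ leaves c' ↔ x ∈ forestLeaves ds ∧ x ≠ i := by
              intro x; simp [-mem_forestLeaves, hcl, leaves]
            have h8 := minLabel_mem (hcb.relabel (shift i m))
            rw [leaves_relabel, List.mem_map] at h8
            obtain ⟨x, hx, hx'⟩ := h8
            have hxm : x ≠ m := fun e => hmc (by rw [leaves]; exact e ▸ ((hcm x).1 hx).1)
            have h9 : minLabel (relabel (shift i m) c') ≤ k := by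
              refine minLabel_le ?_
              rw [leaves_relabel, List.mem_map]
              exact ⟨k, (hcm k).2 ⟨hk, hki⟩, shift_of_lt hkm hki⟩
            have h10 : minLabel (relabel (shift i m) c') ≠ i := by
              rw [← hx', shift_eq_closeGap ((hcm x).1 hx).2 hxm, closeGap]
              have := ((hcm x).1 hx).2
              split_ifs <;> omega
            have h11 : minLabel (node ds) < m := (minLabel_le (t := node ds) hic).trans_lt h7
            have hge : ∀ d ∈ l ++ r, m ≤ minLabel d := fun d hd => by
              rw [← hforest]
              exact Nat.sInf_le (mem_forestLeaves.2
                ⟨d, hd, minLabel_mem (forestBranching_iff.1 hblr d hd)⟩)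
            have hs1 := hs.1
            obtain rfl : l = [] := by
              rcases l with _ | ⟨A, l⟩
              · rfl
              · exfalso
                have h12 := hge A (by simp)
                rcases l with _ | ⟨B, l⟩
                · have := hs1.1
                  omega
                · have h13 := hs1.1
                  have h14 := hs1.2 (node ds) (by simp)
                  omega
            obtain ⟨B, r, rfl⟩ := List.exists_cons_of_ne_nil (by simpa using hne)
            have h12 : ∀ d ∈ r, minLabel B < minLabel d := hs1.2
            have h13 : minLabel B = m := by
              rw [← hforest]
              exact (forestMin_cons (forestBranching_iff.1 hblr B (by simp))
                fun d hd => (h12 d hd).le).symm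
            rw [leastTwoLeft_iff, hmap]
            simp only [List.map_nil, List.nil_append, List.map_cons]
            refine ⟨_, _, _, rfl, ?_, fun y hy => ?_⟩
            · rw [h13, shift_right him]
              exact h10
            · obtain ⟨d, hd, rfl⟩ := List.mem_map.1 hy
              have h14 := h12 d hd
              rw [h13, shift_right him, shift_of_gt him (by omega)]
              omega
        · rw [forestWeakSemiPlanar_iff, forestRelabel_eq_map]
          intro d hd
          obtain ⟨e, he, rfl⟩ := List.mem_map.1 hd
          rw [List.mem_append, List.mem_cons] at he
          rcases or_left_comm.1 he with rfl | he
          · exact ih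
          · exact (hrel' e (List.mem_append.2 he)).1.weak
termination_by cs => sizeOf cs
decreasing_by
  subst_vars
  have h1 := List.sizeOf_lt_of_mem
    (List.mem_append_right l (List.mem_cons_self (a := node ds) (l := r)))
  rw [node.sizeOf_spec] at h1
  omega

end PlanarTree

namespace PlanarTree

/-! ### The down-step after a growth step -/

mutual
lemma leaves_canon_perm : ∀ t : PlanarTree, (leaves (canon t)).Perm (leaves t)
  | leaf _ => List.Perm.refl _
  | node cs => by
    simp only [canon, leaves]
    exact (forestLeaves_perm (leastTwoFirst_perm _)).trans (forestLeaves_forestCanon_perm cs)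
lemma forestLeaves_forestCanon_perm : ∀ cs : List PlanarTree,
    (forestLeaves (forestCanon cs)).Perm (forestLeaves cs)
  | [] => List.Perm.refl _
  | c :: cs => (leaves_canon_perm c).append (forestLeaves_forestCanon_perm cs)
end

mutual
/-- Deletion undoes insertion. -/
lemma delete_insertions {α γ : ℝ} {j : ℕ} : ∀ {t : PlanarTree}, Branching t → j ∉ leaves t →
    ∀ p ∈ insertions α γ j t, delete j p.2 = some t
  | leaf i, _, hj, p, hp => by
    have hij : i ≠ j := by rintro rfl; simp [leaves] at hj
    simp only [insertions, List.mem_singleton] at hp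
    subst hp
    simp [delete, forestDelete, ofChildren, hij]
  | node cs, h, hj, p, hp => by
    simp only [insertions, List.cons_append, List.mem_cons, List.mem_append, List.mem_map] at hp
    have hj' : j ∉ forestLeaves cs := by simpa only [leaves] using hj
    rcases hp with rfl | hp | ⟨q, hq, rfl⟩
    · have := delete_of_not_mem h hj
      simp only [delete, forestDelete] at this ⊢
      rw [this]
      simp [ofChildren]
    · obtain ⟨k, hk, rfl⟩ := List.mem_map.1 hp
      have hk' := List.mem_range.1 hk
      have hsplit : cs.insertIdx (k + 2) (leaf j) =
          cs.take (k + 2) ++ leaf j :: cs.drop (k + 2) := by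
        have h1 := insertIdx_append_right (leaf j) (cs.drop (k + 2)) 0 (cs.take (k + 2))
        rwa [List.take_append_drop, List.length_take, min_eq_left (by omega), add_zero,
          List.insertIdx_zero] at h1
      have h2 : ForestBranching (cs.take (k + 2) ++ cs.drop (k + 2)) := by
        rw [List.take_append_drop]; exact h.2
      have h3 : j ∉ forestLeaves (cs.take (k + 2) ++ cs.drop (k + 2)) := by
        rw [List.take_append_drop]; exact hj'
      rw [forestBranching_append] at h2
      rw [forestLeaves_append, List.mem_append, not_or] at h3
      dsimp only
      rw [hsplit, delete_node_leaf h2.1 h2.2 h3.1 h3.2, List.take_append_drop,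
        ofChildren_of_two_le h.1]
    · rw [delete, forestDelete_insertions h.2 hj' q hq, ofChildren_of_two_le h.1]
lemma forestDelete_insertions {α γ : ℝ} {j : ℕ} : ∀ {cs : List PlanarTree},
    ForestBranching cs → j ∉ forestLeaves cs →
    ∀ p ∈ forestInsertions α γ j cs, forestDelete j p.2 = cs
  | [], _, _, p, hp => by simp [forestInsertions] at hp
  | c :: cs, h, hj, p, hp => by
    simp only [forestLeaves, List.mem_append, not_or] at hj
    simp only [forestInsertions, List.mem_append, List.mem_map] at hp
    rcases hp with ⟨q, hq, rfl⟩ | ⟨q, hq, rfl⟩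
    · rw [forestDelete, delete_insertions h.1 hj.1 q hq, forestDelete_of_not_mem h.2 hj.2]
    · rw [forestDelete, delete_of_not_mem h.1 hj.1, forestDelete_insertions h.2 hj.2 q hq]
end

end PlanarTree

namespace SemiPlanarTree
open PlanarTree

lemma exists_tree_eq_node {n : ℕ} (t : SemiPlanarTree (n + 2)) : ∃ cs, t.tree = node cs := by
  cases h : t.tree with
  | leaf k =>
    have := t.length_leaves
    rw [h] at this
    simp [leaves] at this
  | node cs => exact ⟨cs, rfl⟩

lemma search_le {n : ℕ} (t : SemiPlanarTree n) {i : ℕ} (hi : i ∈ t.tree.leaves) :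
    i ≤ t.tree.search i ∧ t.tree.search i ≤ n := by
  refine ⟨?_, (t.mem_leaves.1 (search_mem hi)).2⟩
  rw [search_eq_localSearch hi]
  exact le_max_left _ _

/-- The down-step from an old leaf after an insertion: with total weight `1` it undoes the
insertion, and otherwise down-step and insertion commute. -/
lemma wsum_downStep (α γ : ℝ) {n : ℕ} (t : SemiPlanarTree (n + 2)) (i : Fin (n + 2))
    (F : ℕ → PlanarTree → ℝ) :
    wsum (insertions α γ (n + 3) t.tree)
        (fun u => F (search u (i + 1)) (swapDelete u (i + 1) (search u (i + 1)))) =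
      F (n + 3) t.tree + wsum (insertions α γ (n + 2) (t.downStep i).tree)
        (fun u => F (search t.tree (i + 1)) u) := by
  obtain ⟨cs, hcs⟩ := t.exists_tree_eq_node
  have hi : (i : ℕ) + 1 ∈ t.tree.leaves := t.mem_leaves.2 (by omega)
  obtain ⟨hle, hm⟩ := t.search_le hi
  have hsm := search_eq_localSearch hi
  have hdown : (t.downStep i).tree = t.tree.swapDelete (i + 1) (t.tree.search (i + 1)) := rfl
  have hdperm := (t.downStep i).leaves_perm
  have hs := t.semiPlanar
  have hn := t.nodup_leaves
  have hlt : ∀ k ∈ t.tree.leaves, k < n + 3 := fun k hk => by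
    have := t.mem_leaves.1 hk; omega
  have h0 : ∀ k ∈ t.tree.leaves, 1 ≤ k := fun k hk => (t.mem_leaves.1 hk).1
  rw [hdown] at hdperm ⊢
  rw [hcs] at hi hle hm hsm hdperm hs hn hlt h0 ⊢
  have hne : node cs ≠ leaf ((i : ℕ) + 1) := by simp
  obtain ⟨x', hx'⟩ := exists_delete hs.branching hn hne
  have key := keyIdentity (α := α) (γ := γ) cs [] hs hn hlt hi x' hx' F
  have hw := weakSemiPlanar_shift (σ := []) hs hn hi
    (fun h => by simpa [firstMin] using h0 _ h) hx'
  rw [← hsm] at key hw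
  rw [swapDelete_eq_pruned _ hx', pruned, hx', Option.getD_some] at hdperm ⊢
  set m := search (node cs) (i + 1) with hmdef
  have hp := (leaves_canon_perm (relabel (shift (i + 1) m) x')).symm.trans hdperm
  rw [wsum_insertions_canon α γ hw (hp.nodup_iff.2 List.nodup_range') (fun k hk => by
    have := List.mem_range'_1.1 (hp.mem_iff.1 hk); omega)]
  have hj : shift (i + 1) m (n + 3) = n + 2 := by
    rw [shift_of_gt hle (by omega)]
    rfl
  have key2 := wsum_insertions_relabel α γ (shift (i + 1) m) (n + 3) x' (fun u => F m (canon u))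
  rw [hj] at key2
  rw [key2, ← key]
  refine wsum_congr fun p hp => ?_
  obtain ⟨g1, g2⟩ := insertions_leaves hs.branching p hp
  have g3 : (i : ℕ) + 1 ∈ leaves p.2 := g1.mem_iff.2 (List.mem_cons_of_mem _ hi)
  have g4 : (leaves p.2).Nodup := by
    rw [g1.nodup_iff, List.nodup_cons]
    exact ⟨fun h => (hlt _ h).false, hn⟩
  have g5 : p.2 ≠ leaf ((i : ℕ) + 1) := by
    intro e
    have h1 := g1.length_eq
    rw [e] at h1
    have h2 := two_le_length_leaves hs.branching
    simp only [leaves, List.length_cons, List.length_nil] at h1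
    omega
  obtain ⟨u', hu'⟩ := exists_delete g2 g4 g5
  rw [search_eq_localSearch g3, swapDelete_eq_pruned _ hu']

/-- The down-step from the leaf inserted last. -/
lemma downStep_last {n : ℕ} {α γ : ℝ} (t : SemiPlanarTree (n + 1)) (t' : SemiPlanarTree (n + 2))
    {p : ℝ × PlanarTree} (hp : p ∈ insertions α γ (n + 2) t.tree) (ht' : t'.tree = p.2) :
    t'.tree.search (n + 2) = n + 2 ∧ t'.downStep (Fin.last (n + 1)) = t := by
  have hi : n + 2 ∈ t'.tree.leaves := t'.mem_leaves.2 (by omega)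
  have h1 := t'.search_le hi
  have h2 : t'.tree.search (n + 2) = n + 2 := le_antisymm h1.2 h1.1
  refine ⟨h2, SemiPlanarTree.ext ?_⟩
  have h3 : (t'.downStep (Fin.last (n + 1))).tree = t'.tree.swapDelete (n + 2)
      (t'.tree.search (n + 2)) := rfl
  have hj : n + 2 ∉ t.tree.leaves := fun h => by have := t.mem_leaves.1 h; omega
  have h4 := delete_insertions t.semiPlanar.branching hj p hp
  rw [h3, h2, ht', swapDelete_eq_pruned _ h4, pruned, h4, Option.getD_some, relabel_eq_self,
    canon_eq_self t.semiPlanar]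
  intro k hk
  have := t.mem_leaves.1 hk
  exact shift_of_lt (by omega) (by omega)

lemma exists_of_insertions {α γ : ℝ} {n : ℕ} (t : SemiPlanarTree (n + 1)) :
    ∀ p ∈ t.tree.insertions α γ (n + 2), ∃ t' : SemiPlanarTree (n + 1 + 1), t'.tree = p.2 := by
  intro p hp
  obtain ⟨h1, h2⟩ := PlanarTree.insertions_spec t.semiPlanar
    (fun i hi => by have := t.mem_leaves.1 hi; omega) p hp
  refine ⟨⟨p.2, h1, h2.trans ?_⟩, rfl⟩
  refine (t.leaves_perm.cons _).trans ?_
  rw [List.range'_1_concat (n := n + 1), show 1 + (n + 1) = n + 2 by omega]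
  exact (List.perm_append_singleton _ _).symm

/-- Integration with respect to the growth rule. -/
lemma tsum_growStep {α γ : ℝ} (h : 0 ≤ γ ∧ γ ≤ α ∧ α ≤ 1) (n : ℕ) (t : SemiPlanarTree (n + 1))
    (G : PlanarTree → ℝ≥0∞) : ∑' t', growStep h n t t' * G t'.tree =
      ((t.tree.insertions α γ (n + 2)).map fun p => insertionProb α (n + 1) p.1 * G p.2).sum := by
  classical
  have hs := t.exists_of_insertions (α := α) (γ := γ)
  have hv : ∀ t', growStep h n t t' = ((t.tree.insertions α γ (n + 2)).map fun p =>
      if p.2 = t'.tree then insertionProb α (n + 1) p.1 else 0).sum := fun t' => by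
    change List.sum _ = _
    congr! 2
  simp only [hv]
  generalize t.tree.insertions α γ (n + 2) = l at hs
  induction l with
  | nil => simp
  | cons p l ih =>
    simp only [List.map_cons, List.sum_cons, add_mul]
    rw [ENNReal.tsum_add, ih fun q hq => hs q (List.mem_cons_of_mem _ hq)]
    obtain ⟨t', ht'⟩ := hs p List.mem_cons_self
    congr 1
    rw [tsum_eq_single t']
    · rw [if_pos ht'.symm, ht']
    · intro s hs
      rw [if_neg, zero_mul]
      intro e
      exact hs (SemiPlanarTree.ext (by rw [← e, ht']))

lemma sum_map_ofReal {l : List (ℝ × PlanarTree)} {F : PlanarTree → ℝ} {d : ℝ} (hd : 0 < d)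
    (hl : ∀ p ∈ l, 0 ≤ p.1) (hF : ∀ u, 0 ≤ F u) :
    (l.map fun p => ENNReal.ofReal (p.1 / d) * ENNReal.ofReal (F p.2)).sum =
      ENNReal.ofReal (wsum l F / d) ∧ 0 ≤ wsum l F := by
  induction l with
  | nil => simp
  | cons p l ih =>
    obtain ⟨h1, h2⟩ := ih fun q hq => hl q (List.mem_cons_of_mem _ hq)
    have h3 := hl p List.mem_cons_self
    have h4 := hF p.2
    simp only [List.map_cons, List.sum_cons, wsum_cons]
    refine ⟨?_, by positivity⟩
    rw [h1, ← ENNReal.ofReal_mul (by positivity), ← ENNReal.ofReal_add (by positivity)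
      (by positivity)]
    congr 1
    ring

/-- The probability that the local search, after the insertion of a leaf into a tree with `n + 2`
leaves, finds the new leaf. -/
noncomputable def newProb (α : ℝ) (n : ℕ) : ℝ≥0∞ := ENNReal.ofReal (1 / (n + 2 - α))

/-- The probability that the local search, after the insertion of a leaf into a tree with `n + 2`
leaves, finds the same leaf as before. -/
noncomputable def oldProb (α : ℝ) (n : ℕ) : ℝ≥0∞ := ENNReal.ofReal ((n + 1 - α) / (n + 2 - α))

open Classical in
/-- The joint distribution of the label found by the local search and of the tree after the
down-step, for the tree obtained from `t` by the growth rule. -/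
lemma tsum_growStep_downStep {α γ : ℝ} (h : 0 ≤ γ ∧ γ ≤ α ∧ α ≤ 1) {n : ℕ}
    (t : SemiPlanarTree (n + 2)) (i : Fin (n + 2)) (j : ℕ) (s : SemiPlanarTree (n + 2)) :
    ∑' t', growStep h (n + 1) t t' *
      (if t'.tree.search (i + 1) = j ∧ t'.downStep i.castSucc = s then 1 else 0) =
    newProb α n * (if n + 3 = j ∧ t = s then 1 else 0) +
      oldProb α n * (if t.tree.search (i + 1) = j then growStep h n (t.downStep i) s else 0) := by
  have hα : (0 : ℝ) < n + 2 - α := by have := h.2.2; have : (0 : ℝ) ≤ n := n.cast_nonneg; linarith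
  set F : ℕ → PlanarTree → ℝ := fun k u => if k = j ∧ u = s.tree then 1 else 0 with hF
  have hF0 : ∀ k u, 0 ≤ F k u := fun k u => by simp only [hF]; split_ifs <;> norm_num
  have h1 : ∀ t' : SemiPlanarTree (n + 3),
      (if t'.tree.search (i + 1) = j ∧ t'.downStep i.castSucc = s then (1 : ℝ≥0∞) else 0) =
      (fun u : PlanarTree => ENNReal.ofReal
        (F (search u (i + 1)) (swapDelete u (i + 1) (search u (i + 1))))) t'.tree := by
    intro t'
    have h2 : t'.downStep i.castSucc = s ↔ t'.tree.swapDelete (i + 1) (t'.tree.search (i + 1)) =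
        s.tree := ⟨fun e => by rw [← e]; rfl, fun e => SemiPlanarTree.ext e⟩
    simp only [hF, h2]
    split_ifs <;> simp
  have hcast : ((n + 1 + 1 : ℕ) : ℝ) - α = n + 2 - α := by push_cast; ring
  simp only [h1]
  rw [tsum_growStep h (n + 1) t (fun u : PlanarTree => ENNReal.ofReal
        (F (search u (i + 1)) (swapDelete u (i + 1) (search u (i + 1)))))]
  simp only [insertionProb, if_neg (show n + 1 + 1 ≠ 1 by omega), hcast]
  rw [(sum_map_ofReal (F := fun u => F (search u (i + 1))
      (swapDelete u (i + 1) (search u (i + 1)))) hα (insertions_nonneg h _ t.tree)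
      (fun u => hF0 _ _)).1, wsum_downStep α γ t i F, add_div]
  obtain ⟨h3, h4⟩ := sum_map_ofReal (F := F (t.tree.search (i + 1))) hα
    (insertions_nonneg h (n + 2) (t.downStep i).tree) (fun u => hF0 _ _)
  rw [ENNReal.ofReal_add (div_nonneg (hF0 _ _) hα.le) (div_nonneg h4 hα.le), ← h3]
  congr 1
  · have h5 : t.tree = s.tree ↔ t = s := ⟨SemiPlanarTree.ext, fun e => by rw [e]⟩
    simp only [hF, h5, newProb]
    split_ifs <;> simp
  · have h6 : (if t.tree.search (i + 1) = j then growStep h n (t.downStep i) s else 0) =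
        ∑' t', growStep h n (t.downStep i) t' *
          (fun u => ENNReal.ofReal (F (t.tree.search (i + 1)) u)) t'.tree := by
      rw [tsum_eq_single s]
      · by_cases h7 : t.tree.search (i + 1) = j <;> simp [hF, h7]
      · intro t' ht'
        have : t'.tree ≠ s.tree := fun e => ht' (SemiPlanarTree.ext e)
        simp [hF, this]
    rw [h6, tsum_growStep h n (t.downStep i)
      (fun u => ENNReal.ofReal (F (t.tree.search (i + 1)) u)), ← List.sum_map_mul_left]
    congr 1
    refine List.map_congr_left fun p hp => ?_
    rw [← mul_assoc]
    congr 1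
    rw [oldProb, insertionProb]
    split_ifs with h8
    -- for the tree with one leaf the only insertion has probability one and weight `1 - α`
    · obtain rfl : n = 0 := by omega
      have h9 := (t.downStep i).length_leaves
      cases h10 : (t.downStep i).tree with
      | leaf k =>
        rw [h10] at hp
        simp only [insertions, List.mem_singleton] at hp
        subst hp
        simp
      | node cs =>
        have h11 := (t.downStep i).semiPlanar.branching
        rw [h10] at h9 h11
        have := two_le_length_leaves h11
        rw [leaves] at h9
        omega
    · have h9 : (1 : ℝ) ≤ n := by exact_mod_cast (show 1 ≤ n by omega)
      have h10 : (0 : ℝ) < n + 1 - α := by have := h.2.2; linarith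
      rw [← ENNReal.ofReal_mul (by positivity)]
      congr 1
      push_cast
      field_simp

end SemiPlanarTree

/-! ### Countability of the state spaces and laws of Markov chains -/

namespace PlanarTree

mutual
/-- An injective encoding of planar trees by natural numbers. -/
def encode : PlanarTree → ℕ
  | leaf i => 2 * i
  | node cs => 2 * forestEncode cs + 1
/-- An injective encoding of lists of planar trees by natural numbers. -/
def forestEncode : List PlanarTree → ℕ
  | [] => 0
  | c :: cs => Nat.pair (encode c) (forestEncode cs) + 1
end

mutual
lemma encode_injective : ∀ s t : PlanarTree, encode s = encode t → s = t
  | leaf i, leaf j, h => by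
    simp only [encode] at h
    rw [show i = j by omega]
  | leaf _, node _, h => by simp only [encode] at h; omega
  | node _, leaf _, h => by simp only [encode] at h; omega
  | node cs, node ds, h => by
    simp only [encode] at h
    rw [forestEncode_injective cs ds (by omega)]
lemma forestEncode_injective : ∀ cs ds : List PlanarTree, forestEncode cs = forestEncode ds →
    cs = ds
  | [], [], _ => rfl
  | [], _ :: _, h => by simp [forestEncode] at h
  | _ :: _, [], h => by simp [forestEncode] at h
  | c :: cs, d :: ds, h => by
    simp only [forestEncode, Nat.add_right_cancel_iff, Nat.pair_eq_pair] at h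
    rw [encode_injective c d h.1, forestEncode_injective cs ds h.2]
end

end PlanarTree

instance SemiPlanarTree.instCountable (n : ℕ) : Countable (SemiPlanarTree n) :=
  Function.Injective.countable (f := fun t : SemiPlanarTree n => t.tree.encode)
    fun _ _ h => SemiPlanarTree.ext (PlanarTree.encode_injective _ _ h)

instance LabelledTree.instCountable (n : ℕ) : Countable (LabelledTree n) :=
  Function.Injective.countable (f := fun t : LabelledTree n => t.clusters)
    fun _ _ h => LabelledTree.ext h

/-- The law of a Markov chain at time `k + 1` is obtained from its law at time `k` by applying the
kernel: sum the transition property over all histories. -/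
lemma IsMarkovChain.map_succ {Ω : Type*} [MeasurableSpace Ω] {μ : Measure Ω}
    [IsProbabilityMeasure μ] {S : ℕ → Type*} [∀ k, MeasurableSpace (S k)]
    [∀ k, MeasurableSingletonClass (S k)] [∀ k, Countable (S k)] {X : ∀ k, Ω → S k}
    {K : ∀ k, S k → PMF (S (k + 1))} (hX : IsMarkovChain μ X K) {k : ℕ} {p : PMF (S k)}
    (hp : μ.map (X k) = p.toMeasure) : μ.map (X (k + 1)) = (p.bind (K k)).toMeasure := by
  obtain ⟨ω₀⟩ := nonempty_of_isProbabilityMeasure μ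
  set H : Ω → ∀ j : Fin (k + 1), S j := fun ω j => X j ω with hH
  have hHm : Measurable H := measurable_pi_lambda _ fun j => hX.measurable j
  refine Measure.ext_of_singleton fun y => ?_
  rw [Measure.map_apply (hX.measurable _) (measurableSet_singleton y),
    PMF.toMeasure_apply_singleton _ _ (measurableSet_singleton y), PMF.bind_apply]
  have h1 : μ (X (k + 1) ⁻¹' {y}) = ∑' g, μ (H ⁻¹' {g} ∩ X (k + 1) ⁻¹' {y}) := by
    rw [← measure_iUnion]
    · congr 1
      ext ω
      simp
    · intro g g' hg
      refine Set.disjoint_left.2 fun ω h h' => hg ?_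
      rw [← h.1, ← h'.1]
    · exact fun g => (hHm (measurableSet_singleton g)).inter
        (hX.measurable _ (measurableSet_singleton y))
  have h2 : ∀ g, μ (H ⁻¹' {g} ∩ X (k + 1) ⁻¹' {y}) =
      K k (g (Fin.last k)) y * μ (H ⁻¹' {g}) := by
    intro g
    set x : ∀ j, S j := fun j => if hj : j < k + 1 then g ⟨j, hj⟩ else X j ω₀ with hx
    have hxg : ∀ j (hj : j < k + 1), x j = g ⟨j, hj⟩ := fun j hj => dif_pos hj
    have hset : {ω | ∀ j ≤ k, X j ω = x j} = H ⁻¹' {g} := by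
      ext ω
      simp only [Set.mem_ofPred_eq, Set.mem_preimage, Set.mem_singleton_iff, funext_iff, hH]
      constructor
      · intro h j
        exact (h j (by omega)).trans (hxg j j.isLt)
      · intro h j hj
        exact (h ⟨j, by omega⟩).trans (hxg j (by omega)).symm
    have h3 := hX.transition k x y
    rw [hset] at h3
    have h4 : x k = g (Fin.last k) := hxg k (by omega)
    rw [← h4, mul_comm, ← h3, ← hset]
    rfl
  have h5 : ∑' g, K k (g (Fin.last k)) y * μ (H ⁻¹' {g}) = ∫⁻ ω, K k (X k ω) y ∂μ := by
    have h6 : ∀ g, μ (H ⁻¹' {g}) = μ.map H {g} := fun g => by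
      rw [Measure.map_apply hHm (measurableSet_singleton g)]
    simp only [h6]
    rw [← lintegral_countable' (fun g : ∀ j : Fin (k + 1), S j => K k (g (Fin.last k)) y),
      lintegral_map (measurable_of_countable _) hHm]
    rfl
  rw [h1, tsum_congr h2, h5]
  have h7 : ∫⁻ ω, K k (X k ω) y ∂μ = ∫⁻ x, K k x y ∂(μ.map (X k)) := by
    rw [lintegral_map (measurable_of_countable _) (hX.measurable k)]
  rw [h7, hp, lintegral_countable']
  refine tsum_congr fun x => ?_
  rw [PMF.toMeasure_apply_singleton _ _ (measurableSet_singleton x), mul_comm]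

namespace SemiPlanarTree
open PlanarTree

lemma tree_eq_leaf (t : SemiPlanarTree 1) : t.tree = leaf 1 := by
  have h := t.leaves_perm
  have hl := t.length_leaves
  cases ht : t.tree with
  | leaf k =>
    rw [ht] at h
    simpa [leaves] using h
  | node cs =>
    have hb := t.semiPlanar.branching
    rw [ht] at hb hl
    have := two_le_length_leaves hb
    rw [leaves] at hl
    omega

instance instSubsingletonOne : Subsingleton (SemiPlanarTree 1) :=
  ⟨fun s t => SemiPlanarTree.ext (by rw [s.tree_eq_leaf, t.tree_eq_leaf])⟩

lemma tree_eq_node (t : SemiPlanarTree 2) : t.tree = node [leaf 1, leaf 2] := by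
  have h := t.leaves_perm
  have hl := t.length_leaves
  have hs := t.semiPlanar
  obtain ⟨cs, hcs⟩ := exists_tree_eq_node (n := 0) t
  rw [hcs] at h hl hs ⊢
  have key : ∀ c : PlanarTree, SemiPlanar c → (leaves c).length ≤ 1 → ∃ k, c = leaf k := by
    intro c hc hlen
    cases c with
    | leaf k => exact ⟨k, rfl⟩
    | node ds =>
      have := two_le_length_leaves hc.branching
      rw [leaves] at hlen
      omega
  match cs, hs with
  | c :: d :: ds, hs =>
    have h1 := List.length_pos_iff.2 hs.2.1.branching.leaves_ne_nil
    have h2 := List.length_pos_iff.2 hs.2.2.1.branching.leaves_ne_nil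
    simp only [leaves, forestLeaves, List.length_append] at hl
    obtain rfl : ds = [] := by
      by_contra hne
      have := List.length_pos_iff.2 (hs.2.2.2.branching.leaves_ne_nil hne)
      omega
    obtain ⟨k, rfl⟩ := key c hs.2.1 (by omega)
    obtain ⟨l, rfl⟩ := key d hs.2.2.1 (by omega)
    have h3 := hs.1.1
    rw [minLabel_leaf, minLabel_leaf] at h3
    have h4 : k ∈ [1, 2] := h.mem_iff.1 (by simp [leaves, forestLeaves])
    have h5 : l ∈ [1, 2] := h.mem_iff.1 (by simp [leaves, forestLeaves])
    simp only [List.mem_cons, List.not_mem_nil, or_false] at h4 h5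
    obtain rfl : k = 1 := by omega
    obtain rfl : l = 2 := by omega
    rfl

instance instSubsingletonTwo : Subsingleton (SemiPlanarTree 2) :=
  ⟨fun s t => SemiPlanarTree.ext (by rw [s.tree_eq_node, t.tree_eq_node])⟩

/-- The tree with one leaf. -/
def single : SemiPlanarTree 1 := ⟨leaf 1, trivial, List.Perm.refl _⟩

/-- The law of the semi-planar growth process: `growthLaw h n` is the distribution of the tree
with `n + 1` leaves. -/
noncomputable def growthLaw {α γ : ℝ} (h : 0 ≤ γ ∧ γ ≤ α ∧ α ≤ 1) :
    ∀ n : ℕ, PMF (SemiPlanarTree (n + 1))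
  | 0 => PMF.pure single
  | n + 1 => (growthLaw h n).bind (growStep h n)

end SemiPlanarTree

lemma PMF.eq_of_subsingleton {S : Type*} [Subsingleton S] (p q : PMF S) : p = q := by
  ext s
  have h : ∀ r : PMF S, r s = 1 := fun r => by
    rw [← r.tsum_coe]
    exact (tsum_eq_single s fun t ht => absurd (Subsingleton.elim t s) ht).symm
  rw [h, h]

lemma IsSemiPlanarGrowthProcess.map_eq {α γ : ℝ} {h : 0 ≤ γ ∧ γ ≤ α ∧ α ≤ 1} {Ω : Type*}
    [MeasurableSpace Ω] {μ : Measure Ω} [IsProbabilityMeasure μ]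
    {T : ∀ k : ℕ, Ω → SemiPlanarTree (k + 1)} (hT : IsSemiPlanarGrowthProcess h μ T) (k : ℕ) :
    μ.map (T k) = (SemiPlanarTree.growthLaw h k).toMeasure := by
  induction k with
  | zero =>
    have := Measure.isProbabilityMeasure_map (μ := μ) (hT.measurable 0).aemeasurable
    rw [← (μ.map (T 0)).toPMF_toMeasure]
    congr 1
    exact PMF.eq_of_subsingleton (S := SemiPlanarTree 1) _ _
  | succ k ih => exact hT.map_succ ih

/-! ### The down-step on the growth process -/

namespace SemiPlanarTree
open PlanarTree

variable {α γ : ℝ} (h : 0 ≤ γ ∧ γ ≤ α ∧ α ≤ 1)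

/-- The trees reachable by the growth rule arise from an insertion. -/
lemma exists_mem_insertions {n : ℕ} {t : SemiPlanarTree (n + 1)} {t' : SemiPlanarTree (n + 1 + 1)}
    (ht : growStep h n t t' ≠ 0) : ∃ p ∈ insertions α γ (n + 2) t.tree, t'.tree = p.2 := by
  classical
  by_contra! hne
  refine ht ?_
  change List.sum _ = _
  refine List.sum_eq_zero fun x hx => ?_
  obtain ⟨p, hp, rfl⟩ := List.mem_map.1 hx
  exact if_neg fun e => hne p hp e.symm

open Classical in
/-- In the growth process, the label found by the local search is independent of the tree after
the down-step, which has the law of the previous tree.  The induction step for an old leaf is the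
commutation of down-step and growth; for the leaf inserted last it is trivial. -/
lemma tsum_growthLaw_downStep (n : ℕ) : ∀ (i : Fin (n + 2)) (j : ℕ), ∃ p : ℝ≥0∞,
    ∀ s : SemiPlanarTree (n + 1), ∑' t, growthLaw h (n + 1) t *
      (if t.tree.search (i + 1) = j ∧ t.downStep i = s then 1 else 0) = p * growthLaw h n s := by
  induction n with
  | zero =>
    intro i j
    refine ⟨∑' t, growthLaw h 1 t *
      (if t.tree.search (i + 1) = j ∧ t.downStep i = single then 1 else 0), fun s => ?_⟩
    obtain rfl : s = single := Subsingleton.elim (α := SemiPlanarTree 1) _ _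
    rw [growthLaw, PMF.pure_apply_self, mul_one]
  | succ n ih =>
    intro i j
    -- integration over the last growth step
    have swap : ∀ G : SemiPlanarTree (n + 1 + 2) → ℝ≥0∞, ∑' t', growthLaw h (n + 1 + 1) t' * G t' =
        ∑' t, growthLaw h (n + 1) t * ∑' t', growStep h (n + 1) t t' * G t' := by
      intro G
      simp only [growthLaw, PMF.bind_apply, ← ENNReal.tsum_mul_right, ← ENNReal.tsum_mul_left]
      rw [ENNReal.tsum_comm]
      simp only [mul_assoc]
    have single' : ∀ s : SemiPlanarTree (n + 1 + 1), ∑' t, growthLaw h (n + 1) t *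
        (if n + 3 = j ∧ t = s then 1 else 0) =
        (if n + 3 = j then 1 else 0) * growthLaw h (n + 1) s := by
      intro s
      rw [tsum_eq_single s fun t ht => by simp [ht], mul_comm]
      simp
    refine Fin.lastCases ?_ (fun i => ?_) i
    · refine ⟨if n + 3 = j then 1 else 0, fun s => ?_⟩
      rw [swap, ← single']
      refine tsum_congr fun t => ?_
      congr 1
      have h1 : ∀ t', growStep h (n + 1) t t' *
          (if t'.tree.search ((Fin.last (n + 2) : ℕ) + 1) = j ∧
            t'.downStep (Fin.last (n + 2)) = s then 1 else 0) =
          growStep h (n + 1) t t' * (if n + 3 = j ∧ t = s then 1 else 0) := by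
        intro t'
        by_cases h2 : growStep h (n + 1) t t' = 0
        · rw [h2, zero_mul, zero_mul]
        · obtain ⟨p, hp, hp'⟩ := exists_mem_insertions h h2
          obtain ⟨h3, h4⟩ := downStep_last t t' hp hp'
          rw [h4, Fin.val_last, h3]
      rw [tsum_congr h1, ENNReal.tsum_mul_right, PMF.tsum_coe, one_mul]
    · obtain ⟨p, hp⟩ := ih i j
      refine ⟨newProb α n * (if n + 3 = j then 1 else 0) + oldProb α n * p, fun s => ?_⟩
      rw [swap]
      simp only [Fin.val_castSucc]
      rw [tsum_congr fun t => by rw [tsum_growStep_downStep h t i j s]]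
      simp only [mul_add]
      rw [ENNReal.tsum_add, add_mul]
      congr 1
      · simp only [mul_left_comm _ (newProb α n)]
        rw [ENNReal.tsum_mul_left, single', mul_assoc]
      · simp only [mul_left_comm _ (oldProb α n)]
        rw [ENNReal.tsum_mul_left, mul_assoc]
        congr 1
        have h1 : ∀ t : SemiPlanarTree (n + 2), (if t.tree.search (i + 1) = j then
            growStep h n (t.downStep i) s else 0) = ∑' u, (if t.tree.search (i + 1) = j ∧
              t.downStep i = u then 1 else 0) * growStep h n u s := by
          intro t
          rw [tsum_eq_single (t.downStep i) fun u hu => by simp [hu.symm]]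
          simp
        simp only [h1, ← ENNReal.tsum_mul_left]
        rw [ENNReal.tsum_comm]
        simp only [← mul_assoc]
        simp only [ENNReal.tsum_mul_right, hp]
        rw [growthLaw, PMF.bind_apply, ← ENNReal.tsum_mul_left]
        simp only [mul_assoc]

/-- The down-step from a given leaf inverts the growth rule in law. -/
lemma growthLaw_map_downStep (n : ℕ) (i : Fin (n + 2)) :
    (growthLaw h (n + 1)).map (fun t => t.downStep i) = growthLaw h n := by
  classical
  choose p hp using tsum_growthLaw_downStep h n i
  have h1 : ∀ s, (growthLaw h (n + 1)).map (fun t => t.downStep i) s =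
      (∑' j, p j) * growthLaw h n s := by
    intro s
    rw [PMF.map_apply, ← ENNReal.tsum_mul_right]
    simp only [← hp]
    rw [ENNReal.tsum_comm]
    refine tsum_congr fun t => ?_
    rw [ENNReal.tsum_mul_left, tsum_eq_single (t.tree.search (i + 1)) fun j hj => by simp [hj.symm]]
    simp [eq_comm]
  have h2 : ∑' j, p j = 1 := by
    have h3 := PMF.tsum_coe ((growthLaw h (n + 1)).map (fun t => t.downStep i))
    simp only [h1] at h3
    rwa [ENNReal.tsum_mul_left, PMF.tsum_coe, mul_one] at h3
  ext s
  rw [h1, h2, one_mul]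

/-- The growth law is stationary for the chain: the down-step followed by growth leads from the law
of the tree to that of the previous tree and back. -/
lemma growthLaw_bind_chainStep (n : ℕ) :
    (growthLaw h (n + 1)).bind (chainStep h n) = growthLaw h (n + 1) := by
  unfold chainStep
  rw [PMF.bind_comm]
  have h1 : ∀ i : Fin (n + 2), ((growthLaw h (n + 1)).bind fun t => growStep h n (t.downStep i)) =
      growthLaw h (n + 1) := fun i => by
    conv_rhs => rw [growthLaw, ← growthLaw_map_downStep h n i, PMF.bind_map]
    rfl
  simp only [h1, PMF.bind_const]

end SemiPlanarTree

lemma IsSemiPlanarGrowthProcess.identDistrib_downStep {α γ : ℝ} {h : 0 ≤ γ ∧ γ ≤ α ∧ α ≤ 1}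
    {Ω : Type*} [MeasurableSpace Ω] {μ : Measure Ω} [IsProbabilityMeasure μ]
    {T : ∀ k : ℕ, Ω → SemiPlanarTree (k + 1)} (hT : IsSemiPlanarGrowthProcess h μ T)
    (n : ℕ) (i : Fin (n + 2)) (j : ℕ) (hj : μ {ω | (T (n + 1) ω).tree.search (i + 1) = j} ≠ 0) :
    IdentDistrib (fun ω => (T (n + 1) ω).downStep i) (T n)
      (μ[|{ω | (T (n + 1) ω).tree.search (i + 1) = j}]) μ := by
  classical
  have hd : Measurable (fun t : SemiPlanarTree (n + 2) => t.downStep i) := measurable_of_countable _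
  have hm : Measurable fun ω => (T (n + 1) ω).downStep i := hd.comp (hT.measurable (n + 1))
  refine ⟨hm.aemeasurable, (hT.measurable n).aemeasurable, Measure.ext_of_singleton fun s => ?_⟩
  have hA : ∀ A : Set (SemiPlanarTree (n + 2)), MeasurableSet (T (n + 1) ⁻¹' A) := fun A =>
    hT.measurable (n + 1) MeasurableSet.of_discrete
  obtain ⟨p, hp⟩ := SemiPlanarTree.tsum_growthLaw_downStep h n i j
  have hjoint : ∀ s, μ ({ω | (T (n + 1) ω).tree.search (i + 1) = j} ∩
      (fun ω => (T (n + 1) ω).downStep i) ⁻¹' {s}) = p * SemiPlanarTree.growthLaw h n s := by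
    intro s
    have h1 : {ω | (T (n + 1) ω).tree.search (i + 1) = j} ∩
      (fun ω => (T (n + 1) ω).downStep i) ⁻¹' {s} =
      T (n + 1) ⁻¹' {t | t.tree.search (i + 1) = j ∧ t.downStep i = s} := rfl
    rw [h1, ← Measure.map_apply (hT.measurable (n + 1)) MeasurableSet.of_discrete, hT.map_eq,
      PMF.toMeasure_apply _ MeasurableSet.of_discrete, ← hp]
    refine tsum_congr fun t => ?_
    simp [Set.indicator_apply]
  have htot : μ {ω | (T (n + 1) ω).tree.search (i + 1) = j} = p := by
    have h1 : μ {ω | (T (n + 1) ω).tree.search (i + 1) = j} =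
        ∑' s, μ ({ω | (T (n + 1) ω).tree.search (i + 1) = j} ∩
          (fun ω => (T (n + 1) ω).downStep i) ⁻¹' {s}) := by
      rw [← measure_iUnion]
      · congr 1
        ext ω
        simp
      · intro s s' hs
        refine Set.disjoint_left.2 fun ω h h' => hs ?_
        rw [← h.2, ← h'.2]
      · exact fun s => hA {t | t.tree.search (i + 1) = j ∧ t.downStep i = s}
    simp only [h1, hjoint]
    rw [ENNReal.tsum_mul_left, PMF.tsum_coe, mul_one]
  have hE : MeasurableSet {ω | (T (n + 1) ω).tree.search (i + 1) = j} :=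
    hA {t | t.tree.search (i + 1) = j}
  rw [Measure.map_apply hm (measurableSet_singleton s), cond_apply hE, hjoint, htot, hT.map_eq,
    PMF.toMeasure_apply_singleton _ _ (measurableSet_singleton s), ← mul_assoc,
    ENNReal.inv_mul_cancel (htot ▸ hj) (htot ▸ measure_ne_top _ _), one_mul]

/-! ### Convergence of the chain -/

namespace SemiPlanarTree
open PlanarTree

variable {α γ : ℝ} (h : 0 ≤ γ ∧ γ ≤ α ∧ α ≤ 1)

/-- `q` is the distribution of the tree with `n + 1` leaves grown from a fixed tree with `a + 1`
leaves. -/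
def Grown (a : ℕ) : ∀ n : ℕ, PMF (SemiPlanarTree (n + 1)) → Prop
  | 0, q => a = 0 ∧ ∃ s, q = PMF.pure s
  | n + 1, q => (a = n + 1 ∧ ∃ s, q = PMF.pure s) ∨
      ∃ q', Grown a n q' ∧ q = q'.bind (growStep h n)

lemma grown_pure : ∀ (n : ℕ) (s : SemiPlanarTree (n + 1)), Grown h n n (PMF.pure s)
  | 0, s => ⟨rfl, s, rfl⟩
  | _ + 1, s => Or.inl ⟨rfl, s, rfl⟩

lemma Grown.le : ∀ {a n : ℕ} {q : PMF (SemiPlanarTree (n + 1))}, Grown h a n q → a ≤ n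
  | _, 0, _, hq => hq.1.le
  | _, _ + 1, _, Or.inl hq => hq.1.le
  | _, _ + 1, _, Or.inr ⟨_, hq, _⟩ => hq.le.trans (Nat.le_succ _)

/-- As there is only one semi-planar tree with two leaves, growth from it has the law of the growth
process. -/
lemma Grown.eq_growthLaw : ∀ {n : ℕ} {q : PMF (SemiPlanarTree (n + 1 + 1))},
    Grown h 1 (n + 1) q → q = growthLaw h (n + 1)
  | 0, _, _ => PMF.eq_of_subsingleton (S := SemiPlanarTree 2) _ _
  | n + 1, _, Or.inl hq => absurd hq.1 (by omega)
  | n + 1, _, Or.inr ⟨q', hq, e⟩ => by rw [e, hq.eq_growthLaw]; rfl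

/-- With probability at least `oldProb α n`, the local search from an old leaf does not find the
leaf inserted last, and then the down-step commutes with the insertion. -/
lemma oldProb_mul_le_map_downStep {n : ℕ} (t : SemiPlanarTree (n + 2)) (i : Fin (n + 2))
    (s : SemiPlanarTree (n + 2)) : oldProb α n * growStep h n (t.downStep i) s ≤
      (growStep h (n + 1) t).map (fun t' => t'.downStep i.castSucc) s := by
  classical
  have h1 := tsum_growStep_downStep h t i (t.tree.search (i + 1)) s
  rw [if_pos rfl] at h1
  refine (le_add_self.trans h1.symm.le).trans ?_
  rw [PMF.map_apply]
  refine ENNReal.tsum_le_tsum fun t' => ?_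
  by_cases h2 : t'.downStep i.castSucc = s
  · rw [if_pos h2.symm]
    exact mul_le_of_le_one_right' (by split_ifs <;> simp)
  · simp [h2]

lemma oldProb_ne_zero {α : ℝ} (hα : α ≤ 1) {n : ℕ} (hn : n ≠ 0) : oldProb α n ≠ 0 := by
  have h1 : (1 : ℝ) ≤ n := by exact_mod_cast Nat.one_le_iff_ne_zero.2 hn
  rw [oldProb, Ne, ENNReal.ofReal_eq_zero, not_le]
  exact div_pos (by linarith) (by linarith)

/-- The down-step from leaf `1` applied to a tree grown from `a + 2` leaves yields, up to a
constant factor, at least the law of a tree grown from `a + 1` leaves. -/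
lemma Grown.exists_le_map_downStep {a : ℕ} (ha : a ≠ 0) (n : ℕ) : ∃ c : ℝ≥0∞, c ≠ 0 ∧
    ∀ q : PMF (SemiPlanarTree (n + 2)), Grown h (a + 1) (n + 1) q →
      ∃ q' : PMF (SemiPlanarTree (n + 1)), Grown h a n q' ∧
        ∀ s, c * q' s ≤ q.map (fun t => t.downStep 0) s := by
  induction n with
  | zero => exact ⟨1, one_ne_zero, fun q hq => absurd (Grown.le h hq) (by omega)⟩
  | succ n ih =>
    have base : ∀ s : SemiPlanarTree (n + 1 + 2), a = n + 1 →
        ∃ q' : PMF (SemiPlanarTree (n + 1 + 1)),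
        Grown h a (n + 1) q' ∧ ∀ u, q' u ≤ (PMF.pure s).map (fun t => t.downStep 0) u := by
      rintro s rfl
      exact ⟨PMF.pure (s.downStep 0), grown_pure h _ _, fun u => by rw [PMF.pure_map]⟩
    -- for `n = 0`, where `oldProb` may vanish, no growth step has taken place, as `a` is positive
    by_cases hn : n = 0
    · subst hn
      refine ⟨1, one_ne_zero, fun q hq => ?_⟩
      rcases hq with ⟨h1, s, rfl⟩ | ⟨q₁, hq₁, -⟩
      · simpa only [one_mul] using base s (Nat.succ.inj h1)
      · have h2 : a + 1 ≤ 0 + 1 := Grown.le h hq₁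
        exact absurd h2 (by omega)
    · obtain ⟨c, hc, hle⟩ := ih
      refine ⟨min 1 (oldProb α n * c), ?_, fun q hq => ?_⟩
      · exact (lt_min one_pos (pos_iff_ne_zero.2 (mul_ne_zero (oldProb_ne_zero h.2.2 hn) hc))).ne'
      rcases hq with ⟨h1, s, rfl⟩ | ⟨q₁, hq₁, rfl⟩
      · obtain ⟨q', h2, h3⟩ := base s (by omega)
        exact ⟨q', h2, fun u => (mul_le_of_le_one_left' (min_le_left _ _)).trans (h3 u)⟩
      · obtain ⟨q', h2, h3⟩ := hle q₁ hq₁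
        refine ⟨q'.bind (growStep h n), Or.inr ⟨q', h2, rfl⟩, fun s => ?_⟩
        calc min 1 (oldProb α n * c) * (q'.bind (growStep h n)) s
            ≤ oldProb α n * c * (q'.bind (growStep h n)) s := by gcongr; exact min_le_right _ _
          _ = oldProb α n * ∑' u, c * q' u * growStep h n u s := by
            rw [PMF.bind_apply, mul_assoc, ← ENNReal.tsum_mul_left]
            simp only [mul_assoc]
          _ ≤ oldProb α n * ((q₁.map fun t => t.downStep 0).bind (growStep h n)) s := by
            rw [PMF.bind_apply]
            gcongr with u
            exact h3 u
          _ = ∑' t, q₁ t * (oldProb α n * growStep h n (t.downStep 0) s) := by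
            rw [PMF.bind_map, PMF.bind_apply, ← ENNReal.tsum_mul_left]
            refine tsum_congr fun t => ?_
            rw [Function.comp_apply, mul_left_comm]
          _ ≤ ((q₁.bind (growStep h (n + 1))).map fun t => t.downStep 0) s := by
            rw [PMF.map_bind, PMF.bind_apply]
            gcongr with t
            exact oldProb_mul_le_map_downStep h t 0 s

/-- The law of the chain after `m` transitions, from the initial law `q`. -/
noncomputable def chainLaw (n : ℕ) (q : PMF (SemiPlanarTree (n + 2))) (m : ℕ) :
    PMF (SemiPlanarTree (n + 2)) := (fun p => p.bind (chainStep h n))^[m] q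

lemma le_bind_of_le {S : Type*} {S' : Type*} {q : PMF S} {f : S → ℝ≥0∞} {c : ℝ≥0∞}
    (K : S → PMF S') (hle : ∀ s, c * f s ≤ q s) (s : S') :
    c * ∑' t, f t * K t s ≤ q.bind K s := by
  rw [PMF.bind_apply, ← ENNReal.tsum_mul_left]
  refine ENNReal.tsum_le_tsum fun t => ?_
  rw [← mul_assoc]
  exact mul_le_mul_left (hle t) _

lemma chainLaw_le (n : ℕ) {c : ℝ≥0∞} {p q : PMF (SemiPlanarTree (n + 2))}
    (hle : ∀ s, c * p s ≤ q s) (m : ℕ) (s : SemiPlanarTree (n + 2)) :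
    c * chainLaw h n p m s ≤ chainLaw h n q m s := by
  induction m generalizing p q with
  | zero => exact hle s
  | succ m ih => exact ih (le_bind_of_le (chainStep h n) hle)

lemma chainLaw_growthLaw (n m : ℕ) :
    chainLaw h n (growthLaw h (n + 1)) m = growthLaw h (n + 1) := by
  exact Function.iterate_fixed (growthLaw_bind_chainStep h n) m

/-- One transition leads from a tree grown from `a + 2` leaves, up to a constant factor, at least
to a tree grown from `a + 1` leaves. -/
lemma Grown.exists_le_bind_chainStep {a : ℕ} (ha : a ≠ 0) (n : ℕ) : ∃ c : ℝ≥0∞, c ≠ 0 ∧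
    ∀ q : PMF (SemiPlanarTree (n + 2)), Grown h (a + 1) (n + 1) q →
      ∃ q' : PMF (SemiPlanarTree (n + 2)), Grown h a (n + 1) q' ∧
        ∀ s, c * q' s ≤ q.bind (chainStep h n) s := by
  obtain ⟨c, hc, hle⟩ := Grown.exists_le_map_downStep h ha n
  refine ⟨((n + 2 : ℕ) : ℝ≥0∞)⁻¹ * c, mul_ne_zero (by simp) hc, fun q hq => ?_⟩
  obtain ⟨q', h1, h2⟩ := hle q hq
  refine ⟨q'.bind (growStep h n), Or.inr ⟨q', h1, rfl⟩, fun s => ?_⟩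
  have h3 := le_bind_of_le (growStep h n) h2 s
  rw [← PMF.bind_apply] at h3
  unfold chainStep
  rw [PMF.bind_comm, PMF.bind_apply]
  refine le_trans ?_ (ENNReal.le_tsum 0)
  rw [PMF.uniformOfFintype_apply, Fintype.card_fin, mul_assoc]
  refine mul_le_mul_right ?_ _
  rw [PMF.bind_map] at h3
  exact h3

lemma Grown.exists_le_chainLaw (n a : ℕ) : ∃ c : ℝ≥0∞, c ≠ 0 ∧
    ∀ q : PMF (SemiPlanarTree (n + 2)), Grown h (a + 1) (n + 1) q →
      ∀ s, c * growthLaw h (n + 1) s ≤ chainLaw h n q a s := by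
  induction a with
  | zero =>
    refine ⟨1, one_ne_zero, fun q hq s => ?_⟩
    rw [one_mul, Grown.eq_growthLaw h hq]
    rfl
  | succ a ih =>
    obtain ⟨c, hc, hle⟩ := ih
    obtain ⟨d, hd, hle'⟩ := Grown.exists_le_bind_chainStep h (Nat.succ_ne_zero a) n
    refine ⟨d * c, mul_ne_zero hd hc, fun q hq s => ?_⟩
    obtain ⟨q', h1, h2⟩ := hle' q hq
    calc d * c * growthLaw h (n + 1) s = d * (c * growthLaw h (n + 1) s) := mul_assoc _ _ _
      _ ≤ d * chainLaw h n q' a s := by gcongr; exact hle q' h1 s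
      _ ≤ chainLaw h n q (a + 1) s := chainLaw_le h n h2 a s

/-- Doeblin's condition: after `n` transitions, from whatever tree, the law of the chain is bounded
below by a multiple of the growth law. -/
lemma exists_le_chainLaw (n : ℕ) : ∃ c : ℝ≥0∞, c ≠ 0 ∧ c ≤ 1 ∧
    ∀ t s : SemiPlanarTree (n + 2), c * growthLaw h (n + 1) s ≤ chainLaw h n (PMF.pure t) n s := by
  obtain ⟨c, hc, hle⟩ := Grown.exists_le_chainLaw h n n
  refine ⟨min 1 c, (lt_min one_pos (pos_iff_ne_zero.2 hc)).ne', min_le_left _ _, fun t s => ?_⟩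
  exact (mul_le_mul_left (min_le_right _ _) _).trans (hle _ (grown_pure h (n + 1) t) s)

lemma chainLaw_eq_bind (n m : ℕ) (q : PMF (SemiPlanarTree (n + 2))) :
    chainLaw h n q m = q.bind fun t => chainLaw h n (PMF.pure t) m := by
  induction m with
  | zero => exact q.bind_pure.symm
  | succ m ih =>
    have h1 : ∀ p, chainLaw h n p (m + 1) = (chainLaw h n p m).bind (chainStep h n) := fun p =>
      Function.iterate_succ_apply' _ _ _
    simp only [h1]
    rw [ih, PMF.bind_bind]

lemma chainLaw_add (n k m : ℕ) (q : PMF (SemiPlanarTree (n + 2))) :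
    chainLaw h n q (k + m) = chainLaw h n (chainLaw h n q m) k :=
  Function.iterate_add_apply _ _ _ _

/-- Doeblin's argument: the part of the law of the chain that has not yet been absorbed in the
stationary law decays geometrically. -/
lemma exists_forall_le_chainLaw (n : ℕ) : ∃ c : ℝ≥0∞, c ≠ 0 ∧ c ≤ 1 ∧
    ∀ (q : PMF (SemiPlanarTree (n + 2))) (k : ℕ), ∀ m ≥ k * n, ∀ s,
      (1 - (1 - c) ^ k) * growthLaw h (n + 1) s ≤ chainLaw h n q m s := by
  obtain ⟨c, hc, hc1, hle⟩ := exists_le_chainLaw h n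
  refine ⟨c, hc, hc1, fun q k => ?_⟩
  set π := growthLaw h (n + 1) with hπ
  have step : ∀ k, ∀ s, (1 - (1 - c) ^ k) * π s ≤ chainLaw h n q (k * n) s := by
    intro k
    induction k with
    | zero => simp
    | succ k ih =>
      intro s
      set x := (1 - c) ^ k with hx
      have hx1 : x ≤ 1 := pow_le_one' tsub_le_self _
      have hxt : x ≠ ⊤ := (hx1.trans_lt ENNReal.one_lt_top).ne
      set p := chainLaw h n q (k * n) with hp
      have h1 : ∀ t, p t = (1 - x) * π t + (p t - (1 - x) * π t) := fun t =>
        (add_tsub_cancel_of_le (ih t)).symm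
      have h2 : ∑' t, (p t - (1 - x) * π t) = x := by
        have h3 : ∑' t, p t = (1 - x) + ∑' t, (p t - (1 - x) * π t) := by
          rw [tsum_congr h1, ENNReal.tsum_add, ENNReal.tsum_mul_left, PMF.tsum_coe, mul_one]
        rw [PMF.tsum_coe] at h3
        have h4 : (1 - x) + x = 1 := tsub_add_cancel_of_le hx1
        exact (ENNReal.add_right_inj (by finiteness)).1 (h3.symm.trans h4.symm)
      rw [Nat.succ_mul, add_comm (k * n), chainLaw_add, ← hp, chainLaw_eq_bind, PMF.bind_apply,
        tsum_congr fun t => by rw [h1 t, add_mul], ENNReal.tsum_add]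
      have h5 : ∑' t, (1 - x) * π t * chainLaw h n (PMF.pure t) n s = (1 - x) * π s := by
        simp only [mul_assoc]
        rw [ENNReal.tsum_mul_left, ← PMF.bind_apply, ← chainLaw_eq_bind, chainLaw_growthLaw]
      have h6 : x * (c * π s) ≤
          ∑' t, (p t - (1 - x) * π t) * chainLaw h n (PMF.pure t) n s := by
        conv_lhs => rw [← h2, ← ENNReal.tsum_mul_right]
        exact ENNReal.tsum_le_tsum fun t => mul_le_mul_right (hle t s) _
      rw [h5]
      refine le_trans ?_ (add_le_add_right h6 _)
      rw [← mul_assoc, ← add_mul]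
      refine mul_le_mul_left ?_ _
      rw [pow_succ, ← hx, tsub_le_iff_right, ENNReal.mul_sub (fun _ _ => hxt), mul_one, add_assoc,
        add_tsub_cancel_of_le (mul_le_of_le_one_right' hc1), tsub_add_cancel_of_le hx1]
  intro m hm s
  obtain ⟨l, rfl⟩ := Nat.exists_eq_add_of_le' hm
  have h1 := chainLaw_le h n (step k) l s
  rwa [chainLaw_growthLaw, ← chainLaw_add] at h1

end SemiPlanarTree

lemma IsSemiPlanarChain.map_eq {α γ : ℝ} {h : 0 ≤ γ ∧ γ ≤ α ∧ α ≤ 1} {Ω : Type*}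
    [MeasurableSpace Ω] {P : Measure Ω} [IsProbabilityMeasure P] {n : ℕ}
    {X : ℕ → Ω → SemiPlanarTree (n + 2)} (hX : IsSemiPlanarChain h P n X) :
    ∃ q, ∀ m, P.map (X m) = (SemiPlanarTree.chainLaw h n q m).toMeasure := by
  have := Measure.isProbabilityMeasure_map (μ := P) (hX.measurable 0).aemeasurable
  refine ⟨(P.map (X 0)).toPMF, fun m => ?_⟩
  induction m with
  | zero => exact ((P.map (X 0)).toPMF_toMeasure).symm
  | succ m ih =>
    rw [IsMarkovChain.map_succ hX ih]
    congr 1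
    exact (Function.iterate_succ_apply' (fun p => p.bind (SemiPlanarTree.chainStep h n)) m
      (P.map (X 0)).toPMF).symm

lemma IsSemiPlanarChain.tendstoInDistribution {α γ : ℝ} {h : 0 ≤ γ ∧ γ ≤ α ∧ α ≤ 1}
    {Ω : Type*} [MeasurableSpace Ω] {μ : Measure Ω} [IsProbabilityMeasure μ]
    {T : ∀ k : ℕ, Ω → SemiPlanarTree (k + 1)} (hT : IsSemiPlanarGrowthProcess h μ T)
    {Ω' : Type*} [MeasurableSpace Ω'] {P : Measure Ω'} [IsProbabilityMeasure P]
    {n : ℕ} {X : ℕ → Ω' → SemiPlanarTree (n + 2)} (hX : IsSemiPlanarChain h P n X) :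
    TendstoInDistribution X atTop (T (n + 1)) (fun _ => P) μ := by
  refine ⟨fun m => (hX.measurable m).aemeasurable, (hT.measurable (n + 1)).aemeasurable, ?_⟩
  refine tendsto_of_forall_isOpen_le_liminf' fun G _ => ?_
  obtain ⟨q, hq⟩ := hX.map_eq
  obtain ⟨c, hc, hc1, hle⟩ := SemiPlanarTree.exists_forall_le_chainLaw h n
  have h1 : ∀ k, (1 - (1 - c) ^ k) * (μ.map (T (n + 1))) G ≤
      atTop.liminf fun m => (P.map (X m)) G := by
    intro k
    refine le_liminf_of_le (by isBoundedDefault) ?_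
    filter_upwards [eventually_ge_atTop (k * n)] with m hm
    rw [hq, hT.map_eq, PMF.toMeasure_apply _ MeasurableSet.of_discrete,
      PMF.toMeasure_apply _ MeasurableSet.of_discrete, ← ENNReal.tsum_mul_left]
    refine ENNReal.tsum_le_tsum fun s => ?_
    by_cases hs : s ∈ G
    · rw [Set.indicator_of_mem hs, Set.indicator_of_mem hs]
      exact hle q k m hm s
    · rw [Set.indicator_of_notMem hs, Set.indicator_of_notMem hs, mul_zero]
  have h2 : Tendsto (fun k : ℕ => (1 - (1 - c) ^ k) * (μ.map (T (n + 1))) G) atTop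
      (nhds ((1 - 0) * (μ.map (T (n + 1))) G)) := by
    refine ENNReal.Tendsto.mul_const ?_ (Or.inl (by simp))
    refine ENNReal.Tendsto.sub tendsto_const_nhds ?_ (Or.inl ENNReal.one_ne_top)
    exact ENNReal.tendsto_pow_atTop_nhds_zero_of_lt_one
      (ENNReal.sub_lt_self ENNReal.one_ne_top one_ne_zero hc)
  rw [tsub_zero, one_mul] at h2
  exact le_of_tendsto' h2 h1

/-! ### Projection to non-planar trees -/

namespace LabelledTree

/-- The sum of the values of `F` over all insertions of leaf `j` into the tree shape `H`, with
their weights; it is used for the shapes of single trees and of lists of trees. -/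
noncomputable def attachSum (α γ : ℝ) (j : ℕ) (H : Finset (Finset ℕ))
    (F : Finset (Finset ℕ) → ℝ) : ℝ :=
  ∑ C ∈ H, edgeWeight α γ C * F (insertEdge H C j) +
    ∑ C ∈ branchPoints H, branchWeight α γ H C * F (insertBranch H C j)

/-- Insertions into a union of shapes with disjoint sets of labels take place in one of them. -/
lemma attachSum_union (α γ : ℝ) (j : ℕ) {H K : Finset (Finset ℕ)}
    (hH : ∀ C ∈ H, C.Nonempty) (hK : ∀ C ∈ K, C.Nonempty)
    (hd : ∀ C ∈ H, ∀ D ∈ K, Disjoint C D) (F : Finset (Finset ℕ) → ℝ) :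
    attachSum α γ j (H ∪ K) F = attachSum α γ j H (fun X => F (X ∪ K)) +
      attachSum α γ j K (fun X => F (H ∪ X)) := by
  have not_sub : ∀ C ∈ H, ∀ D ∈ K, ¬ C ⊆ D ∧ ¬ D ⊆ C := fun C hC D hD => by
    refine ⟨fun h => ?_, fun h => ?_⟩
    · obtain ⟨x, hx⟩ := hH C hC
      exact Finset.disjoint_left.1 (hd C hC D hD) hx (h hx)
    · obtain ⟨x, hx⟩ := hK D hD
      exact Finset.disjoint_left.1 (hd C hC D hD) (h hx) hx
  have hdis : Disjoint H K := Finset.disjoint_left.2 fun C hC hC' =>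
    (not_sub C hC C hC').1 subset_rfl
  have chH : ∀ C ∈ H, children (H ∪ K) C = children H C := fun C hC => by
    ext D
    simp only [children, Finset.mem_filter, Finset.mem_union]
    constructor
    · rintro ⟨hD | hD, h1, h2⟩
      · exact ⟨hD, h1, fun E hE => h2 E (Or.inl hE)⟩
      · exact absurd h1.subset (not_sub C hC D hD).2
    · rintro ⟨hD, h1, h2⟩
      exact ⟨Or.inl hD, h1, fun E hE hDE => hE.elim (fun hE => h2 E hE hDE)
        fun hE => absurd hDE.subset (not_sub D hD E hE).1⟩
  have chK : ∀ C ∈ K, children (H ∪ K) C = children K C := fun C hC => by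
    ext D
    simp only [children, Finset.mem_filter, Finset.mem_union]
    constructor
    · rintro ⟨hD | hD, h1, h2⟩
      · exact absurd h1.subset (not_sub D hD C hC).1
      · exact ⟨hD, h1, fun E hE => h2 E (Or.inr hE)⟩
    · rintro ⟨hD, h1, h2⟩
      exact ⟨Or.inr hD, h1, fun E hE hDE => hE.elim
        (fun hE => absurd hDE.subset (not_sub E hE D hD).2) fun hE => h2 E hE hDE⟩
  have imH : ∀ p : Finset ℕ → Prop, ∀ [DecidablePred p], (∀ D ∈ H, ¬ p D) →
      H.image (fun D => if p D then insert j D else D) = H := fun p _ hp => by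
    conv_rhs => rw [← Finset.image_id (s := H)]
    exact Finset.image_congr fun D hD => if_neg (hp D hD)
  have imK : ∀ p : Finset ℕ → Prop, ∀ [DecidablePred p], (∀ D ∈ K, ¬ p D) →
      K.image (fun D => if p D then insert j D else D) = K := fun p _ hp => by
    conv_rhs => rw [← Finset.image_id (s := K)]
    exact Finset.image_congr fun D hD => if_neg (hp D hD)
  have bp : branchPoints (H ∪ K) = branchPoints H ∪ branchPoints K := Finset.filter_union _ _ _
  have hdis' : Disjoint (branchPoints H) (branchPoints K) :=
    Finset.disjoint_filter_filter hdis
  unfold attachSum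
  rw [bp, Finset.sum_union hdis, Finset.sum_union hdis', add_add_add_comm]
  congr 1 <;> congr 1 <;> refine Finset.sum_congr rfl fun C hC => ?_
  · rw [insertEdge, Finset.image_union, imK _ fun D hD h => (not_sub C hC D hD).1 h.subset,
      ← Finset.insert_union, ← Finset.insert_union]
    rfl
  · have hC' := (Finset.mem_filter.1 hC).1
    rw [branchWeight, chH C hC', insertBranch, Finset.image_union,
      imK _ fun D hD h => (not_sub C hC' D hD).1 h, ← Finset.insert_union]
    rfl
  · rw [insertEdge, Finset.image_union, imH _ fun D hD h => (not_sub D hD C hC).2 h.subset,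
      ← Finset.union_insert, ← Finset.union_insert]
    rfl
  · have hC' := (Finset.mem_filter.1 hC).1
    rw [branchWeight, chK C hC', insertBranch, Finset.image_union,
      imH _ fun D hD h => (not_sub D hD C hC').2 h, ← Finset.union_insert]
    rfl

/-- Insertions into a shape with first branch point `L`, whose other vertices are `H`: into the edge
below `L`, into `L`, or above `L`. -/
lemma attachSum_insert (α γ : ℝ) (j : ℕ) {H : Finset (Finset ℕ)} {L : Finset ℕ}
    (hL : 2 ≤ L.card) (hH : ∀ C ∈ H, C ⊂ L) (F : Finset (Finset ℕ) → ℝ) :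
    attachSum α γ j (insert L H) F =
      γ * F (insert {j} (insert (insert j L) (insert L H))) +
      (((children (insert L H) L).card - 1) * α - γ) * F (insert {j} (insert (insert j L) H)) +
      attachSum α γ j H (fun X => F (insert (insert j L) X)) := by
  have hLH : L ∉ H := fun h => (hH L h).ne rfl
  have bp : branchPoints (insert L H) = insert L (branchPoints H) := by
    rw [branchPoints, Finset.filter_insert, if_pos hL]
    rfl
  have hLb : L ∉ branchPoints H := fun h => hLH (Finset.mem_filter.1 h).1
  have ch : ∀ C ∈ H, children (insert L H) C = children H C := fun C hC => by
    ext D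
    simp only [children, Finset.mem_filter, Finset.mem_insert]
    constructor
    · rintro ⟨rfl | hD, h1, h2⟩
      · exact absurd ((hH C hC).trans h1) (lt_irrefl _)
      · exact ⟨hD, h1, fun E hE => h2 E (Or.inr hE)⟩
    · rintro ⟨hD, h1, h2⟩
      refine ⟨Or.inr hD, h1, ?_⟩
      rintro E (rfl | hE) hDE hEC
      · exact absurd ((hH C hC).trans hEC) (lt_irrefl _)
      · exact h2 E hE hDE hEC
  have im : ∀ p : Finset ℕ → Prop, ∀ [DecidablePred p], (∀ D ∈ H, ¬ p D) →
      H.image (fun D => if p D then insert j D else D) = H := fun p _ hp => by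
    conv_rhs => rw [← Finset.image_id (s := H)]
    exact Finset.image_congr fun D hD => if_neg (hp D hD)
  have hno : ∀ D ∈ H, ¬ L ⊆ D := fun D hD h => ((hH D hD).trans_subset h).ne rfl
  have e1 : insertEdge (insert L H) L j = insert {j} (insert (insert j L) (insert L H)) := by
    rw [insertEdge, Finset.image_insert, if_neg (lt_irrefl L), im _ fun D hD h => hno D hD h.subset]
  have e2 : insertBranch (insert L H) L j = insert {j} (insert (insert j L) H) := by
    rw [insertBranch, Finset.image_insert, if_pos subset_rfl, im _ hno]
  have e3 : ∀ C ∈ H, insertEdge (insert L H) C j = insert (insert j L) (insertEdge H C j) := by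
    intro C hC
    rw [insertEdge, Finset.image_insert, if_pos (hH C hC), insertEdge,
      Finset.insert_comm (insert j L) {j}, Finset.insert_comm (insert j L) (insert j C)]
  have e4 : ∀ C ∈ H, insertBranch (insert L H) C j = insert (insert j L) (insertBranch H C j) := by
    intro C hC
    rw [insertBranch, Finset.image_insert, if_pos (hH C hC).subset, insertBranch,
      Finset.insert_comm (insert j L) {j}]
  unfold attachSum
  rw [bp, Finset.sum_insert hLH, Finset.sum_insert hLb, e1, e2, add_add_add_comm]
  congr 1
  · rw [edgeWeight, if_neg (by omega), branchWeight]
  · congr 1 <;> refine Finset.sum_congr rfl fun C hC => ?_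
    · rw [e3 C hC]
    · have hC' := (Finset.mem_filter.1 hC).1
      rw [e4 C hC', branchWeight, branchWeight, ch C hC']

end LabelledTree

namespace PlanarTree
open LabelledTree

lemma mem_forestClusters {C : Finset ℕ} {cs : List PlanarTree} :
    C ∈ forestClusters cs ↔ ∃ c ∈ cs, C ∈ clusters c := by
  induction cs with
  | nil => simp [forestClusters]
  | cons c cs ih => simp [forestClusters, ih]

lemma forestClusters_perm {cs ds : List PlanarTree} (h : cs.Perm ds) :
    forestClusters cs = forestClusters ds := by
  ext C
  simp only [mem_forestClusters, h.mem_iff]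

lemma pairwise_disjoint_leaves {cs : List PlanarTree} (hn : (forestLeaves cs).Nodup) :
    cs.Pairwise fun c d => Disjoint (leaves c).toFinset (leaves d).toFinset := by
  induction cs with
  | nil => exact List.Pairwise.nil
  | cons c cs ih =>
    rw [forestLeaves, List.nodup_append] at hn
    refine List.Pairwise.cons (fun d hd => ?_) (ih hn.2.1)
    rw [Finset.disjoint_left]
    intro x hx hy
    exact hn.2.2 x (List.mem_toFinset.1 hx) x
      (mem_forestLeaves.2 ⟨d, hd, List.mem_toFinset.1 hy⟩) rfl

/-- All vertices above a branch point have fewer descendants. -/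
lemma ssubset_of_mem_forestClusters {cs : List PlanarTree} (hb : Branching (node cs))
    (hn : (forestLeaves cs).Nodup) {C : Finset ℕ} (hC : C ∈ forestClusters cs) :
    C ⊂ (forestLeaves cs).toFinset := by
  obtain ⟨c, hc, hCc⟩ := mem_forestClusters.1 hC
  obtain ⟨l, r, rfl⟩ := List.append_of_mem hc
  have hbl := forestBranching_append.1 hb.2
  have hsub := ((clusters_spec hbl.2.1).2.2.1 C hCc).1
  have hne : forestLeaves (l ++ r) ≠ [] := by
    refine ForestBranching.leaves_ne_nil (forestBranching_append.2 ⟨hbl.1, hbl.2.2⟩) ?_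
    have := hb.1
    intro e
    simp only [List.append_eq_nil_iff] at e
    simp [e.1, e.2] at this
  obtain ⟨x, hx⟩ := List.exists_mem_of_ne_nil _ hne
  have hperm : (forestLeaves (l ++ c :: r)).Perm (leaves c ++ forestLeaves (l ++ r)) :=
    forestLeaves_perm List.perm_middle
  rw [hperm.nodup_iff, List.nodup_append] at hn
  refine (Finset.ssubset_iff_of_subset ?_).2 ⟨x, ?_, fun h => ?_⟩
  · refine hsub.trans fun y hy => ?_
    rw [List.mem_toFinset, hperm.mem_iff, List.mem_append]
    exact Or.inl (List.mem_toFinset.1 hy)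
  · rw [List.mem_toFinset, hperm.mem_iff, List.mem_append]
    exact Or.inr hx
  · exact hn.2.2 x (List.mem_toFinset.1 (hsub h)) x hx rfl

/-- In the tree shape, the children of a branch point are the vertices of its subtrees. -/
lemma card_children {cs : List PlanarTree} (hb : Branching (node cs))
    (hn : (forestLeaves cs).Nodup) :
    (children (clusters (node cs)) (forestLeaves cs).toFinset).card = cs.length := by
  have hpair := pairwise_disjoint_leaves hn
  have hspec := fun c (hc : c ∈ cs) => clusters_spec (forestBranching_iff.1 hb.2 c hc)
  have hne : ∀ c ∈ cs, (leaves c).toFinset.Nonempty := fun c hc =>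
    ((hspec c hc).2.2.1 _ (hspec c hc).1).2
  have hdisj : ∀ c ∈ cs, ∀ d ∈ cs, c ≠ d → Disjoint (leaves c).toFinset (leaves d).toFinset :=
    have : Std.Symm fun c d : PlanarTree => Disjoint (leaves c).toFinset (leaves d).toFinset :=
      ⟨fun _ _ h => h.symm⟩
    fun c hc d hd hcd => hpair.forall hc hd hcd
  have hlist : (cs.map fun c => (leaves c).toFinset).Nodup := by
    refine List.Nodup.of_map id ?_
    rw [List.map_id, List.Nodup, List.pairwise_map]
    refine hpair.imp_of_mem fun {c d} hc _ h e => ?_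
    rw [← e, disjoint_self] at h
    exact (hne c hc).ne_empty h
  rw [← List.length_map (as := cs) (fun c => (leaves c).toFinset),
    ← List.toFinset_card_of_nodup hlist]
  congr 1
  ext D
  rw [clusters, children, Finset.mem_filter]
  simp only [Finset.mem_insert, List.mem_toFinset, List.mem_map]
  constructor
  · rintro ⟨rfl | hD, h1, h2⟩
    · exact absurd h1 (lt_irrefl _)
    · obtain ⟨c, hc, hDc⟩ := mem_forestClusters.1 hD
      refine ⟨c, hc, ?_⟩
      by_contra hne'
      have h3 : (leaves c).toFinset ∈ forestClusters cs :=
        mem_forestClusters.2 ⟨c, hc, (hspec c hc).1⟩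
      exact h2 _ (Or.inr h3) ((((hspec c hc).2.2.1 D hDc).1).ssubset_of_ne (Ne.symm hne'))
        (ssubset_of_mem_forestClusters hb hn h3)
  · rintro ⟨c, hc, rfl⟩
    have h3 : (leaves c).toFinset ∈ forestClusters cs :=
      mem_forestClusters.2 ⟨c, hc, (hspec c hc).1⟩
    refine ⟨Or.inr h3, ssubset_of_mem_forestClusters hb hn h3, ?_⟩
    rintro E (rfl | hE) h4 h5
    · exact absurd h5 (lt_irrefl _)
    · obtain ⟨d, hd, hEd⟩ := mem_forestClusters.1 hE
      have h6 := ((hspec d hd).2.2.1 E hEd).1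
      obtain ⟨x, hx⟩ := hne c hc
      obtain rfl : c = d := by
        by_contra hcd
        exact Finset.disjoint_left.1 (hdisj c hc d hd hcd) hx (h6 (h4.subset hx))
      exact (h4.trans_subset h6).ne rfl

lemma sum_gapWeight (α γ : ℝ) {c : ℕ} (hc : 2 ≤ c) :
    ∑ k ∈ Finset.range (c - 1), gapWeight α γ c k = (c - 1) * α - γ := by
  obtain ⟨c, rfl⟩ := Nat.exists_eq_add_of_le' hc
  rw [show c + 2 - 1 = c + 1 by omega, Finset.sum_range_succ]
  have h1 : ∀ k ∈ Finset.range c, gapWeight α γ (c + 2) k = α := fun k hk => by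
    have := Finset.mem_range.1 hk
    rw [gapWeight, if_neg (by omega)]
  rw [Finset.sum_congr rfl h1, gapWeight, if_pos (by omega)]
  simp
  ring

mutual
/-- Forgetting the orders turns the weighted insertions into a semi-planar tree into those into
its shape: the weights of the places at a branch point with `c` children add up to
`(c - 1) * α - γ`. -/
lemma wsum_insertions_clusters (α γ : ℝ) (j : ℕ) : ∀ (t : PlanarTree), Branching t →
    (leaves t).Nodup → j ∉ leaves t → ∀ F : Finset (Finset ℕ) → ℝ,
    wsum (insertions α γ j t) (fun u => F (clusters u)) = attachSum α γ j (clusters t) F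
  | leaf i, _, _, hj, F => by
    simp [insertions, attachSum, clusters, forestClusters, forestLeaves, leaves, branchPoints,
      Finset.filter_singleton, edgeWeight, insertEdge]
    left
    congr 1
    ext C
    simp only [Finset.mem_insert, Finset.mem_singleton, Finset.pair_comm i j]
    tauto
  | node cs, hb, hn, hj, F => by
    rw [leaves] at hn hj
    have hL : 2 ≤ (forestLeaves cs).toFinset.card := by
      rw [List.toFinset_card_of_nodup hn]
      exact two_le_length_leaves hb
    have hsub : ∀ C ∈ forestClusters cs, C ⊂ (forestLeaves cs).toFinset := fun C hC =>
      ssubset_of_mem_forestClusters hb hn hC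
    rw [clusters, attachSum_insert α γ j hL hsub, wsum_insertions_node,
      ← wsum_forestInsertions_clusters α γ j cs hb.2 hn hj]
    congr 1
    · congr 1
      · congr 2
        simp only [clusters, forestClusters, forestLeaves, leaves, List.toFinset_append,
          List.toFinset_cons, List.toFinset_nil, List.append_nil]
        ext C
        simp only [Finset.mem_insert, Finset.mem_union, Finset.mem_singleton,
          insert_empty_eq, Finset.union_comm _ {j}, ← Finset.insert_eq]
        tauto
      · have h1 : ∀ k ∈ Finset.range (cs.length - 1),
            clusters (node (cs.insertIdx (k + 2) (leaf j))) =
            insert {j} (insert (insert j (forestLeaves cs).toFinset) (forestClusters cs)) := by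
          intro k hk
          have hk' := Finset.mem_range.1 hk
          have hp : (cs.insertIdx (k + 2) (leaf j)).Perm (leaf j :: cs) :=
            List.perm_insertIdx _ _ (by omega)
          rw [clusters, forestClusters_perm hp, List.toFinset_eq_of_perm _ _ (forestLeaves_perm hp)]
          simp only [forestClusters, forestLeaves, leaves, clusters, List.singleton_append,
            List.toFinset_cons]
          rw [← Finset.insert_eq, Finset.insert_comm]
        rw [Finset.sum_congr rfl fun k hk => by rw [h1 k hk], ← Finset.sum_mul,
          sum_gapWeight α γ hb.1, ← card_children hb hn]
        rfl
    · refine wsum_congr fun p hp => ?_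
      have h1 := (forestInsertions_leaves hb.2 p hp).1
      rw [clusters, List.toFinset_eq_of_perm _ _ h1, List.toFinset_cons]
lemma wsum_forestInsertions_clusters (α γ : ℝ) (j : ℕ) : ∀ (cs : List PlanarTree),
    ForestBranching cs → (forestLeaves cs).Nodup → j ∉ forestLeaves cs →
    ∀ F : Finset (Finset ℕ) → ℝ,
      wsum (forestInsertions α γ j cs) (fun ds => F (forestClusters ds)) =
      attachSum α γ j (forestClusters cs) F
  | [], _, _, _, F => by simp [forestInsertions, forestClusters, attachSum, branchPoints]
  | c :: cs, hb, hn, hj, F => by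
    rw [forestLeaves, List.nodup_append] at hn
    rw [forestLeaves, List.mem_append, not_or] at hj
    have h1 := (clusters_spec hb.1).2.2.1
    have h2 := (forestClusters_spec hb.2).2.1
    have hd : Disjoint (leaves c).toFinset (forestLeaves cs).toFinset := by
      rw [Finset.disjoint_left]
      intro x hx hy
      exact hn.2.2 x (List.mem_toFinset.1 hx) x (List.mem_toFinset.1 hy) rfl
    rw [forestClusters, attachSum_union α γ j (fun C hC => (h1 C hC).2) (fun C hC => (h2 C hC).2)
      (fun C hC D hD => hd.mono (h1 C hC).1 (h2 D hD).1), wsum_forestInsertions_cons,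
      ← wsum_insertions_clusters α γ j c hb.1 hn.1 hj.1,
      ← wsum_forestInsertions_clusters α γ j cs hb.2 hn.2.1 hj.2]
    rfl
end

end PlanarTree

namespace LabelledTree

instance instSubsingletonOne : Subsingleton (LabelledTree 1) := by
  have h : ∀ t : LabelledTree 1, t.clusters = {{1}} := fun t => by
    ext C
    rw [Finset.mem_singleton]
    constructor
    · intro hC
      have h2 := t.subset_labels C hC
      rw [Finset.Icc_self] at h2
      exact (Finset.subset_singleton_iff.1 h2).resolve_left (t.nonempty C hC).ne_empty
    · rintro rfl
      exact t.singleton_mem 1 (by simp)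
  exact ⟨fun s t => LabelledTree.ext ((h s).trans (h t).symm)⟩

instance instSubsingletonTwo : Subsingleton (LabelledTree 2) := by
  have h : ∀ t : LabelledTree 2, t.clusters = (Finset.Icc 1 2).powerset.erase ∅ := fun t => by
    ext C
    rw [Finset.mem_erase, Finset.mem_powerset]
    constructor
    · exact fun hC => ⟨(t.nonempty C hC).ne_empty, t.subset_labels C hC⟩
    · rintro ⟨h1, h2⟩
      have h3 : C ∈ (Finset.Icc 1 2).powerset := Finset.mem_powerset.2 h2
      have h4 : (Finset.Icc 1 2).powerset = {∅, {1}, {2}, Finset.Icc 1 2} := by decide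
      rw [h4] at h3
      simp only [Finset.mem_insert, Finset.mem_singleton] at h3
      rcases h3 with rfl | rfl | rfl | rfl
      · exact absurd rfl h1
      · exact t.singleton_mem 1 (by simp)
      · exact t.singleton_mem 2 (by simp)
      · exact t.labels_mem
  exact ⟨fun s t => LabelledTree.ext ((h s).trans (h t).symm)⟩

end LabelledTree

namespace SemiPlanarTree
open PlanarTree LabelledTree

/-- The projection intertwines the two growth rules. -/
lemma map_proj_growStep {α γ : ℝ} (h : 0 ≤ γ ∧ γ ≤ α ∧ α ≤ 1) (n : ℕ)
    (t : SemiPlanarTree (n + 1)) :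
    (growStep h n t).map proj = LabelledTree.growStep h n t.proj := by
  classical
  by_cases hn : n = 0
  · subst hn
    exact PMF.eq_of_subsingleton (S := LabelledTree 2) _ _
  have hd : (0 : ℝ) < (n + 1 : ℕ) - α := by
    have h1 : (1 : ℝ) ≤ n := by exact_mod_cast Nat.one_le_iff_ne_zero.2 hn
    have h2 := h.2.2
    push_cast
    linarith
  have hn1 : n + 1 ≠ 1 := by omega
  ext s
  set F : Finset (Finset ℕ) → ℝ := fun X => if X = s.clusters then 1 else 0 with hF
  have hF0 : ∀ X, 0 ≤ F X := fun X => by simp only [hF]; split_ifs <;> norm_num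
  have h1 : ((growStep h n t).map proj) s =
      ∑' t', growStep h n t t' * (fun u => ENNReal.ofReal (F (PlanarTree.clusters u))) t'.tree := by
    rw [PMF.map_apply]
    refine tsum_congr fun t' => ?_
    have h2 : s = t'.proj ↔ t'.tree.clusters = s.clusters :=
      ⟨fun e => by rw [e]; rfl, fun e => LabelledTree.ext e.symm⟩
    simp only [hF, h2]
    split_ifs <;> simp
  rw [h1, tsum_growStep h n t (fun u => ENNReal.ofReal (F (PlanarTree.clusters u)))]
  simp only [insertionProb, if_neg hn1]
  rw [(sum_map_ofReal (F := fun u => F (PlanarTree.clusters u)) hd (insertions_nonneg h _ t.tree)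
    (fun u => hF0 _)).1, wsum_insertions_clusters α γ (n + 2) t.tree t.semiPlanar.branching
    t.nodup_leaves (fun hm => by have := t.mem_leaves.1 hm; omega)]
  obtain ⟨w1, w2⟩ := t.proj.weights_nonneg h
  have ite_eq : ∀ (X : Finset (Finset ℕ)) (w : ℝ) [Decidable (X = s.clusters)],
      (if X = s.clusters then insertionProb α (n + 1) w else 0) =
        ENNReal.ofReal (w * F X / ((n + 1 : ℕ) - α)) := by
    intro X w _
    by_cases hX : X = s.clusters <;> simp [hF, hX, insertionProb, hn]
  have h3 : LabelledTree.growStep h n t.proj s =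
      ∑ C ∈ t.proj.clusters, ENNReal.ofReal (edgeWeight α γ C *
        F (insertEdge t.proj.clusters C (n + 2)) / ((n + 1 : ℕ) - α)) +
      ∑ C ∈ branchPoints t.proj.clusters, ENNReal.ofReal (branchWeight α γ t.proj.clusters C *
        F (insertBranch t.proj.clusters C (n + 2)) / ((n + 1 : ℕ) - α)) := by
    simp only [← ite_eq]
    rfl
  rw [h3, ← ENNReal.ofReal_sum_of_nonneg
      (fun C _ => div_nonneg (mul_nonneg (w1 C) (hF0 _)) hd.le),
    ← ENNReal.ofReal_sum_of_nonneg
      (fun C hC => div_nonneg (mul_nonneg (w2 C hC) (hF0 _)) hd.le),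
    ← ENNReal.ofReal_add
      (Finset.sum_nonneg fun C _ => div_nonneg (mul_nonneg (w1 C) (hF0 _)) hd.le)
      (Finset.sum_nonneg fun C hC => div_nonneg (mul_nonneg (w2 C hC) (hF0 _)) hd.le),
    ← Finset.sum_div, ← Finset.sum_div, ← add_div]
  rfl

end SemiPlanarTree

lemma IsGrowthProcess.map_eq {α γ : ℝ} {h : 0 ≤ γ ∧ γ ≤ α ∧ α ≤ 1} {Ω : Type*}
    [MeasurableSpace Ω] {ν : Measure Ω} [IsProbabilityMeasure ν]
    {S : ∀ k : ℕ, Ω → LabelledTree (k + 1)} (hS : IsGrowthProcess h ν S) (k : ℕ) :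
    ν.map (S k) = ((SemiPlanarTree.growthLaw h k).map SemiPlanarTree.proj).toMeasure := by
  induction k with
  | zero =>
    have := Measure.isProbabilityMeasure_map (μ := ν) (hS.measurable 0).aemeasurable
    rw [← (ν.map (S 0)).toPMF_toMeasure]
    congr 1
    exact PMF.eq_of_subsingleton (S := LabelledTree 1) _ _
  | succ k ih =>
    rw [IsMarkovChain.map_succ hS ih, SemiPlanarTree.growthLaw, PMF.map_bind, PMF.bind_map]
    congr 2
    funext t
    exact (SemiPlanarTree.map_proj_growStep h k t).symm

lemma IsSemiPlanarGrowthProcess.identDistrib_proj {α γ : ℝ} {h : 0 ≤ γ ∧ γ ≤ α ∧ α ≤ 1}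
    {Ω : Type*} [MeasurableSpace Ω] {μ : Measure Ω} [IsProbabilityMeasure μ]
    {T : ∀ k : ℕ, Ω → SemiPlanarTree (k + 1)} (hT : IsSemiPlanarGrowthProcess h μ T)
    {Ω' : Type*} [MeasurableSpace Ω'] {ν : Measure Ω'} [IsProbabilityMeasure ν]
    {S : ∀ k : ℕ, Ω' → LabelledTree (k + 1)} (hS : IsGrowthProcess h ν S) (k : ℕ) :
    IdentDistrib (fun ω => (T k ω).proj) (S k) μ ν := by
  have hp : Measurable (SemiPlanarTree.proj (n := k + 1)) := measurable_of_countable _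
  refine ⟨(hp.comp (hT.measurable k)).aemeasurable, (hS.measurable k).aemeasurable, ?_⟩
  rw [hS.map_eq, ← PMF.toMeasure_map (p := SemiPlanarTree.growthLaw h k) (hf := hp), ← hT.map_eq,
    Measure.map_map hp (hT.measurable k)]
  rfl

theorem mainTheorem2 {α γ : ℝ} (h : 0 ≤ γ ∧ γ ≤ α ∧ α ≤ 1)
    {Ω : Type*} [MeasurableSpace Ω] (μ : Measure Ω) [IsProbabilityMeasure μ]
    (T : ∀ k : ℕ, Ω → SemiPlanarTree (k + 1)) (hT : IsSemiPlanarGrowthProcess h μ T)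
    {Ω' : Type*} [MeasurableSpace Ω'] (ν : Measure Ω') [IsProbabilityMeasure ν]
    (S : ∀ k : ℕ, Ω' → LabelledTree (k + 1)) (hS : IsGrowthProcess h ν S)
    {Ω'' : Type*} [MeasurableSpace Ω''] (P : Measure Ω'') [IsProbabilityMeasure P]
    (n : ℕ) (X : ℕ → Ω'' → SemiPlanarTree (n + 2)) (hX : IsSemiPlanarChain h P n X) :
    -- the chain converges in distribution to the step `n + 2` of the semi-planar growth process
    TendstoInDistribution X atTop (T (n + 1)) (fun _ => P) μ ∧
    -- every step of the semi-planar growth process projects to that of the growth process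
    (∀ k : ℕ, IdentDistrib (fun ω => (T k ω).proj) (S k) μ ν) ∧
    -- the down-step from leaf `i + 1`, conditional on the label found by the local search
    (∀ (i : Fin (n + 2)) (j : ℕ), μ {ω | (T (n + 1) ω).tree.search (i + 1) = j} ≠ 0 →
      IdentDistrib (fun ω => (T (n + 1) ω).downStep i) (T n)
        (μ[|{ω | (T (n + 1) ω).tree.search (i + 1) = j}]) μ) :=
  ⟨hX.tendstoInDistribution hT, hT.identDistrib_proj hS, fun i j => hT.identDistrib_downStep n i j⟩
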